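/- Let $(X_i)_{i\ge 1}$ be i.i.d. real random variables whose law has a density $h$ with respect to Lebesgue measure, where $h$ is continuous, bounded, and positive in a neighborhood of $0$, and assume $\mathbf E[X_1]=0$ and $\mathbf E[X_1^2]<\infty$. Under $\mathbf P_x$ let $S_0=x$ and $S_n=x+\sum_{i=1}^nX_i$, and write $\mathbf P=\mathbf P_0$. Fix $a>0$. For $\beta\in\mathbb R$ and $N\in\mathbb N$ put $$Z^f_{N,a,\beta}=\mathbf E\Big[e^{\beta\sum_{k=1}^N\mathbf 1_{S_k\in[0,a]}}\mathbf 1_{S_1\ge 0,\dots,S_N\ge 0}\Big],\qquad Z^c_{N,a,\beta}=\mathbf E\Big[e^{\beta\sum_{k=1}^N\mathbf 1_{S_k\in[0,a]}}\mathbf 1_{S_1\ge 0,\dots,S_N\ge 0}\mathbf 1_{S_N\in[0,a]}\Big],$$ $$Z^c_{N,a,\beta}(x,dy)=\mathbf E_x\Big[e^{\beta\sum_{k=1}^N\mathbf 1_{S_k\in[0,a]}}\mathbf 1_{S_1\ge 0,\dots,S_N\ge 0}\mathbf 1_{S_N\in dy}\Big]\mathbf 1_{y\in[0,a]} .$$ Define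 the free energy $F^a(\beta)=\lim_{N\to\infty}\frac1N\log Z^f_{N,a,\beta}$ (read as an upper limit as long as the limit is not known to exist) and the critical point $\beta_c^a=\inf\{\beta\in\mathbb R: F^a(\beta)>0\}$. For $n\ge1$ let $$F_{x,dy}(n)=\mathbf P_x[S_1>a,\dots,S_{n-1}>a,\ S_n\in dy]\,\mathbf 1_{x,y\in[0,a]},\qquad B^{\lambda}_{x,dy}=\sum_{n\ge1}e^{-\lambda n}F_{x,dy}(n).$$ A right Perron–Frobenius eigenfunction of $B^\lambda$ is a function $v\in L^2([0,a])$, positive at every point of $[0,a]$, with $\int v(y)B^\lambda_{x,dy}=\rho\,v(x)$ for every $x\in[0,a]$; a left one is a function $w\in L^2([0,a])$, positive almost everywhere, with $\int_{[0,a]}w(x)B^\lambda_{x,dy}\,dx=\rho\,w(y)\,dy$ on $[0,a]$. Here $\rho$ is the spectral radius of the integral operator with kernel $B^\lambda$ on $L^2([0,a])$. **Theorem.** Let $\beta>\beta_c^a$. Then the limit defining $F^a(\beta)$ exists, and $B^{F^a(\beta)}$ has a right and a left Perron–Frobenius eigenfunction $v_\beta$ and $w_\beta$ with $\int_{[0,a]}v_\beta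 w_\beta\,dx=1$. For all such $v_\beta,w_\beta$, put $\mu_\beta(dx)=v_\beta(x)w_\beta(x)\mathbf 1_{x\in[0,a]}dx$ and $$K^\beta_{x,dy}(k)=e^{\beta}e^{-F^a(\beta)k}\frac{v_\beta(y)}{v_\beta(x)}F_{x,dy}(k),\qquad C_\beta=\int\mu_\beta(dx)\sum_{k\ge1}k\int K^\beta_{x,dy}(k).$$ Then $0<C_\beta<\infty$ and, for every $x\in[0,a]$, as $N\to\infty$, $$e^{-F^a(\beta)N}\,Z^c_{N,a,\beta}(x,dy)\ \longrightarrow\ \frac{v_\beta(x)\,w_\beta(y)}{C_\beta}\,\mathbf 1_{y\in[0,a]}\,dy\quad\text{in total variation norm,}$$ and for every Borel set $A$, $$Z^c_{N,a,\beta}(x,A)\sim e^{F^a(\beta)N}\int_{A\cap[0,a]}\frac{v_\beta(x)w_\beta(y)}{C_\beta}\,dy,$$ where a sequence is $\sim 0$ if it vanishes for all large $N$. Moreover there are constants $C^a(\beta)>0$ and $C^a_f(\beta)>0$ such that $$Z^c_{N,a,\beta}\sim C^a(\beta)\,e^{F^a(\beta)N},\qquad Z^f_{N,a,\beta}\sim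 C^a_f(\beta)\,e^{F^a(\beta)N}.$$ -/

import Mathlib

open MeasureTheory ProbabilityTheory Filter Topology Asymptotics
open scoped ENNReal

namespace StripWetting

noncomputable section

variable {Ω : Type*} [MeasurableSpace Ω]

/-- The walk started from `x` with increments `X 0, X 1, …`, that is
`S_n = x + X_1 + ⋯ + X_n` (the increment `X_{i+1}` is `X i`). -/
def walk (X : ℕ → Ω → ℝ) (x : ℝ) (n : ℕ) (ω : Ω) : ℝ :=
  x + ∑ i ∈ Finset.range n, X i ω

/-- The number of `k ∈ {1, …, N}` with `S_k ∈ [0,a]`. -/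
def contacts (X : ℕ → Ω → ℝ) (a x : ℝ) (N : ℕ) (ω : Ω) : ℝ :=
  ∑ k ∈ Finset.Icc 1 N, (Set.Icc (0 : ℝ) a).indicator (fun _ => (1 : ℝ)) (walk X x k ω)

/-- The event that the walk started from `x` is nonnegative at the times `1, …, N`. -/
def staysNonneg (X : ℕ → Ω → ℝ) (x : ℝ) (N : ℕ) : Set Ω :=
  {ω | ∀ k ∈ Finset.Icc 1 N, 0 ≤ walk X x k ω}

/-- The Boltzmann weight `exp (β ∑_{k=1}^N 1_{S_k ∈ [0,a]}) 1_{S_1 ≥ 0, …, S_N ≥ 0}`. -/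
def weight (X : ℕ → Ω → ℝ) (a β x : ℝ) (N : ℕ) : Ω → ℝ :=
  (staysNonneg X x N).indicator fun ω => Real.exp (β * contacts X a x N ω)

/-- The free partition function (walk started from `0`). -/
def Zf (P : Measure Ω) (X : ℕ → Ω → ℝ) (a β : ℝ) (N : ℕ) : ℝ :=
  ∫ ω, weight X a β 0 N ω ∂P

/-- The constrained partition function (walk started from `0`). -/
def Zc (P : Measure Ω) (X : ℕ → Ω → ℝ) (a β : ℝ) (N : ℕ) : ℝ :=
  ∫ ω, (walk X 0 N ⁻¹' Set.Icc 0 a).indicator (weight X a β 0 N) ω ∂P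

/-- The constrained partition kernel: `ZcKer P X a β N x` is the measure
`A ↦ E_x[exp (β ∑_{k=1}^N 1_{S_k ∈ [0,a]}) 1_{S_1 ≥ 0, …, S_N ≥ 0} 1_{S_N ∈ A ∩ [0,a]}]`. -/
def ZcKer (P : Measure Ω) (X : ℕ → Ω → ℝ) (a β : ℝ) (N : ℕ) (x : ℝ) : Measure ℝ :=
  ((P.withDensity fun ω => ENNReal.ofReal (weight X a β x N ω)).map (walk X x N)).restrict
    (Set.Icc 0 a)

/-- The free energy `lim_N (1/N) log Z^f_N`. It is written as an upper limit so that it is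
defined before the existence of the limit is known; the two agree whenever the limit exists. -/
def freeEnergy (P : Measure Ω) (X : ℕ → Ω → ℝ) (a β : ℝ) : ℝ :=
  limsup (fun N : ℕ => (1 / (N : ℝ)) * Real.log (Zf P X a β N)) atTop

/-- The critical point: the model is localized when the free energy is positive. -/
def criticalPoint (P : Measure Ω) (X : ℕ → Ω → ℝ) (a : ℝ) : ℝ :=
  sInf {β : ℝ | 0 < freeEnergy P X a β}

open Classical in
/-- For `n ≥ 1`, the measure
`F_{x,dy}(n) = P_x[S_1 > a, …, S_{n-1} > a, S_n ∈ dy] 1_{x ∈ [0,a], y ∈ [0,a]}`. -/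
def excursionKer (P : Measure Ω) (X : ℕ → Ω → ℝ) (a : ℝ) (n : ℕ) (x : ℝ) : Measure ℝ :=
  if x ∈ Set.Icc 0 a then
    ((P.restrict {ω | ∀ k ∈ Finset.Ico 1 n, a < walk X x k ω}).map (walk X x n)).restrict
      (Set.Icc 0 a)
  else 0

/-- `B^l_{x,dy} = ∑_{n ≥ 1} e^{-l n} F_{x,dy}(n)`. -/
def laplaceKer (P : Measure Ω) (X : ℕ → Ω → ℝ) (a l : ℝ) (x : ℝ) : Measure ℝ :=
  Measure.sum fun n : ℕ =>
    ENNReal.ofReal (Real.exp (-l * ((n + 1 : ℕ) : ℝ))) • excursionKer P X a (n + 1) x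

/-- The (complex) Hilbert space `L²([0,a])`. -/
abbrev L2Strip (a : ℝ) : Type := Lp ℂ 2 (volume.restrict (Set.Icc (0 : ℝ) a))

/-- `T` is the integral operator `f ↦ (x ↦ ∫ f(y) κ_{x,dy})` on `L²([0,a])`. -/
def IsIntegralOperator (a : ℝ) (κ : ℝ → Measure ℝ) (T : L2Strip a →L[ℂ] L2Strip a) : Prop :=
  ∀ f : L2Strip a, T f =ᵐ[volume.restrict (Set.Icc (0 : ℝ) a)] fun x => ∫ y, f y ∂(κ x)

/-- The spectral radius of the integral operator with kernel `κ` on `L²([0,a])`. There is at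
most one such bounded operator, so the supremum is over one element if the operator exists
(and is `0` if it does not). -/
def kernelSpectralRadius (a : ℝ) (κ : ℝ → Measure ℝ) : ℝ≥0∞ :=
  ⨆ (T : L2Strip a →L[ℂ] L2Strip a) (_ : IsIntegralOperator a κ T), spectralRadius ℂ T

/-- `v` is a right Perron–Frobenius eigenfunction of `κ` on `[0,a]`: square integrable,
positive at every point of `[0,a]`, and for every `x ∈ [0,a]`,
`∫ v(y) κ_{x,dy} = ρ v(x)` with `ρ` the spectral radius. -/
structure IsRightPF (a : ℝ) (κ : ℝ → Measure ℝ) (v : ℝ → ℝ) : Prop where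
  memLp : MemLp v 2 (volume.restrict (Set.Icc (0 : ℝ) a))
  pos : ∀ x ∈ Set.Icc (0 : ℝ) a, 0 < v x
  eigen : ∀ x ∈ Set.Icc (0 : ℝ) a,
    ∫⁻ y, ENNReal.ofReal (v y) ∂(κ x) = kernelSpectralRadius a κ * ENNReal.ofReal (v x)

/-- `w` is a left Perron–Frobenius eigenfunction of `κ` on `[0,a]`: square integrable, positive
almost everywhere on `[0,a]`, and `∫_{[0,a]} w(x) κ_{x,dy} dx = ρ w(y) dy` as measures on
`[0,a]`, with `ρ` the spectral radius. -/
structure IsLeftPF (a : ℝ) (κ : ℝ → Measure ℝ) (w : ℝ → ℝ) : Prop where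
  memLp : MemLp w 2 (volume.restrict (Set.Icc (0 : ℝ) a))
  pos : ∀ᵐ x ∂(volume.restrict (Set.Icc (0 : ℝ) a)), 0 < w x
  eigen : ∀ A : Set ℝ, MeasurableSet A → A ⊆ Set.Icc 0 a →
    ∫⁻ x in Set.Icc 0 a, ENNReal.ofReal (w x) * κ x A =
      kernelSpectralRadius a κ * ∫⁻ y in A, ENNReal.ofReal (w y)

/-- `v`, `w` are right and left Perron–Frobenius eigenfunctions of `B^{F(β)}`, normalized by
`∫_{[0,a]} v w = 1`. -/
structure IsPFPair (P : Measure Ω) (X : ℕ → Ω → ℝ) (a β : ℝ) (v w : ℝ → ℝ) : Prop where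
  right : IsRightPF a (laplaceKer P X a (freeEnergy P X a β)) v
  left : IsLeftPF a (laplaceKer P X a (freeEnergy P X a β)) w
  normalized : ∫ x in Set.Icc 0 a, v x * w x = 1

/-- `K^β_{x,dy}(n) = e^β F_{x,dy}(n) e^{-F(β) n} v(y) / v(x)`, for `n ≥ 1`. -/
def renewalKer (P : Measure Ω) (X : ℕ → Ω → ℝ) (a β : ℝ) (v : ℝ → ℝ) (n : ℕ) (x : ℝ) :
    Measure ℝ :=
  (excursionKer P X a n x).withDensity fun y =>
    ENNReal.ofReal (Real.exp β * Real.exp (-freeEnergy P X a β * n) * (v y / v x))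

/-- The measure `μ_β(dx) = v(x) w(x) 1_{x ∈ [0,a]} dx`. -/
def invMeasure (a : ℝ) (v w : ℝ → ℝ) : Measure ℝ :=
  (volume.restrict (Set.Icc 0 a)).withDensity fun x => ENNReal.ofReal (v x * w x)

/-- The mean return time `C_β = ∫ μ_β(dx) ∑_{k ≥ 1} k K^β_{x,dy}(k)`. -/
def meanReturn (P : Measure Ω) (X : ℕ → Ω → ℝ) (a β : ℝ) (v w : ℝ → ℝ) : ℝ≥0∞ :=
  ∫⁻ x, ∑' k : ℕ, ((k + 1 : ℕ) : ℝ≥0∞) * renewalKer P X a β v (k + 1) x Set.univ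
    ∂(invMeasure a v w)

/-- The measure `v(x) w(y) / C_β dy` on `[0,a]`. -/
def limitMeasure (P : Measure Ω) (X : ℕ → Ω → ℝ) (a β : ℝ) (v w : ℝ → ℝ) (x : ℝ) :
    Measure ℝ :=
  (volume.restrict (Set.Icc 0 a)).withDensity fun y =>
    ENNReal.ofReal (v x * w y / (meanReturn P X a β v w).toReal)

/-- Total variation distance `sup_A |μ(A) - ν(A)|` over measurable sets, for finite measures.
It lies between one half of and the full total mass of `|μ - ν|`. -/
def tvDist (μ ν : Measure ℝ) : ℝ≥0∞ :=
  ⨆ (A : Set ℝ) (_ : MeasurableSet A), max (μ A - ν A) (ν A - μ A)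

end

end StripWetting

namespace StripWetting

/-! ### Harris' theorem for a kernel with a positive bounded harmonic function -/

section Harris

variable {S : Type*} [MeasurableSpace S]

/-! Let `κ_l` be the step kernel of the walk with weight `e^{β-l}` for a step into `[0,a]`, `e^{-l}`
for a step into `(a,∞)` and `0` for a step below `0` (`stepKernel h (gAll a β l)`). By the
Feynman-Kac formula (`IsDensityWalk.lintegral_prod`) the partition functions are `e^{lN}` times
powers of `κ_l`. With `F = F^a(β)`, which is positive above the critical point, everything follows
once the powers of `κ_F` converge uniformly to a rank one kernel `φ ↦ Λ φ • V` (`RankOneLimit`).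

The harmonic function `V` is obtained by compactness. The generating function `green` of the free
partition functions is bounded for `l > F` and its supremum blows up as `l ↓ F` (`green_blowup`): if
it stayed bounded, the discount could be lowered below `F` (`partition_le_of_supersolution`).
Divided by their suprema these functions are equicontinuous, because translations of `h` are
continuous in `L¹`, and a subsequential limit is harmonic for `κ_F`. It does not vanish, because
steps above the strip carry only mass `e^{-F} < 1` (`exists_harmonic`).

The convergence is a form of Harris' theorem (`HarrisStep.exists_limit`). The drift condition `κ_F 1
≤ e^{-F} + C V` holds because `V` is bounded below on the strip. As `V` tends to `0` at infinity, a
set `{V ≥ 1/R}` is bounded above, and there some power of `κ_F` dominates a multiple of Lebesgue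
measure (`exists_minorization`). Together these make a power of `κ_F` contract the distance to the
line spanned by `V` in the weight `V + b`.

The limit is identified by cutting paths at their visits to the strip. Let `G = ∑ (κ^out)^n` be the
potential of the steps above the strip. Then `G κ^in = e^β B^F` on the strip, and its bounded fixed
points are the bounded `κ_F`-harmonic functions. Hence `B^F` has spectral radius `e^{-β}`
(`kernelSpectralRadius_eq`), any right eigenfunction extends to a bounded harmonic function `u`, and
any left eigenfunction `w` gives the `κ_F`-invariant measure `(w dx) G`. Testing the rank one limit
against both gives `Λ φ • V = v ∫ φ w / ∫ w G u` for bounded `φ` supported in the strip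
(`RankOneLimit.mul_eq`), and `∫ w G u` is the mean return time, since `u = G κ^in u` and `G G`
counts an excursion with its length (`potential_potential`). Conversely, `V` and the density of `Λ`
on the strip provide a pair of eigenfunctions (`RankOneLimit.exists_isPFPair`). -/

lemma integrable_of_abs_le {μ : Measure S} [IsFiniteMeasure μ] {φ : S → ℝ} (hφ : Measurable φ)
    {K : ℝ} (hK : ∀ x, |φ x| ≤ K) : Integrable φ μ :=
  Integrable.of_bound hφ.aestronglyMeasurable K (Eventually.of_forall hK)

lemma isFiniteKernel_pow (κ : Kernel S S) [IsFiniteKernel κ] (n : ℕ) : IsFiniteKernel (κ ^ n) := by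
  induction n with
  | zero => rw [pow_zero]; exact inferInstanceAs (IsFiniteKernel Kernel.id)
  | succ n ih => rw [pow_succ]; exact inferInstanceAs (IsFiniteKernel ((κ ^ n) ∘ₖ κ))

lemma integral_pow_add (κ : Kernel S S) [IsFiniteKernel κ] (m n : ℕ) (x : S) {φ : S → ℝ}
    (hφ : Measurable φ) {K : ℝ} (hK : ∀ x, |φ x| ≤ K) :
    ∫ y, φ y ∂((κ ^ (m + n)) x) = ∫ z, ∫ y, φ y ∂((κ ^ n) z) ∂((κ ^ m) x) := by
  have := isFiniteKernel_pow κ m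
  have := isFiniteKernel_pow κ n
  rw [add_comm, Kernel.pow_add, Kernel.integral_comp (integrable_of_abs_le hφ hK)]

lemma lintegral_pow_add (κ : Kernel S S) (m n : ℕ) (x : S) {φ : S → ℝ≥0∞} (hφ : Measurable φ) :
    ∫⁻ y, φ y ∂((κ ^ (m + n)) x) = ∫⁻ z, ∫⁻ y, φ y ∂((κ ^ n) z) ∂((κ ^ m) x) := by
  rw [add_comm, Kernel.pow_add, Kernel.lintegral_comp _ _ _ hφ]

lemma lintegral_pow_one (κ : Kernel S S) (x : S) {φ : S → ℝ≥0∞} :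
    ∫⁻ y, φ y ∂((κ ^ 1) x) = ∫⁻ y, φ y ∂(κ x) := by
  rw [pow_one]

lemma lintegral_pow_zero (κ : Kernel S S) (x : S) {φ : S → ℝ≥0∞} (hφ : Measurable φ) :
    ∫⁻ y, φ y ∂((κ ^ 0) x) = φ x := by
  rw [pow_zero]
  exact Kernel.lintegral_id' hφ x

lemma measurable_integral_pow (κ : Kernel S S) [IsFiniteKernel κ] (n : ℕ) {φ : S → ℝ}
    (hφ : Measurable φ) : Measurable fun x => ∫ y, φ y ∂((κ ^ n) x) := by
  have := isFiniteKernel_pow κ n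
  exact (hφ.stronglyMeasurable.integral_kernel (κ := κ ^ n)).measurable

/-- Data for Harris' theorem for a kernel with a positive harmonic function `V`. -/
structure HarrisStep (T : Kernel S S) (V : S → ℝ) (α C : ℝ) : Prop where
  V_meas : Measurable V
  V_pos : ∀ x, 0 < V x
  V_le : ∀ x, V x ≤ 1
  harmonic : ∀ x, ∫ y, V y ∂(T x) = V x
  α_nonneg : 0 ≤ α
  α_lt : α < 1
  C_nonneg : 0 ≤ C
  drift : ∀ x, (T x).real Set.univ ≤ α + C * V x

namespace HarrisStep

variable {T : Kernel S S} [IsFiniteKernel T] {V : S → ℝ} {α C : ℝ}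

omit [IsFiniteKernel T] in
lemma abs_V_le (H : HarrisStep T V α C) (x : S) : |V x| ≤ 1 := by
  rw [abs_of_pos (H.V_pos x)]; exact H.V_le x

/-- The reason for the weight `V + b`: harmonicity preserves its `V` part exactly, while the drift
condition shrinks its constant part by `α`, up to a multiple of `V`. -/
lemma integral_weight (H : HarrisStep T V α C) {b d : ℝ} (hb : 0 ≤ b) (hd : 0 ≤ d) (x : S) :
    ∫ y, d * (V y + b) ∂(T x) ≤ d * (V x + b * (α + C * V x)) := by
  have h1 : Integrable V (T x) := integrable_of_abs_le H.V_meas H.abs_V_le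
  rw [integral_const_mul, integral_add h1 (integrable_const _), H.harmonic, integral_const,
    smul_eq_mul, mul_comm ((T x).real Set.univ)]
  gcongr
  exact H.drift x

lemma abs_integral_le (H : HarrisStep T V α C) {b d : ℝ} (hb : 0 ≤ b) (hd : 0 ≤ d) {ψ : S → ℝ}
    (hle : ∀ x, |ψ x| ≤ d * (V x + b)) (x : S) :
    |∫ y, ψ y ∂(T x)| ≤ d * (V x + b * (α + C * V x)) := by
  refine le_trans ?_ (H.integral_weight hb hd x)
  refine (abs_integral_le_integral_abs).trans ?_
  refine integral_mono_of_nonneg (Eventually.of_forall fun _ => abs_nonneg _) ?_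
    (Eventually.of_forall hle)
  exact ((integrable_of_abs_le H.V_meas H.abs_V_le).add (integrable_const _)).const_mul _

/-- As `V x ≤ 1`, also `V x • l ≤ T x`, so this part can be removed and what is left is a positive
measure. Removing `V x • l` rather than `l` makes the removed terms cancel in the cross difference
`V y • T x - V x • T y`. -/
lemma abs_integral_sub_le (H : HarrisStep T V α C) {b d : ℝ} (hb : 0 ≤ b) (hd : 0 ≤ d)
    {ψ : S → ℝ} (hψ : Measurable ψ) (hle : ∀ x, |ψ x| ≤ d * (V x + b)) (x : S)
    {l : Measure S} [IsFiniteMeasure l] (hl : l ≤ T x) :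
    |∫ y, ψ y ∂(T x) - V x * ∫ y, ψ y ∂l| ≤
      d * (V x + b * (α + C * V x)) - V x * (d * ∫ y, V y ∂l) := by
  have hV1 : Integrable V l := integrable_of_abs_le H.V_meas H.abs_V_le
  have hK : ∀ x, |ψ x| ≤ d * (1 + b) := fun x =>
    (hle x).trans (by gcongr; exact H.V_le x)
  have iψ : Integrable ψ (T x) := integrable_of_abs_le hψ hK
  have iψl : Integrable ψ l := integrable_of_abs_le hψ hK
  have iw : Integrable (fun y => d * (V y + b)) (T x) :=
    ((integrable_of_abs_le H.V_meas H.abs_V_le).add (integrable_const _)).const_mul _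
  have iwl : Integrable (fun y => d * (V y + b)) l := (hV1.add (integrable_const _)).const_mul _
  have key : ∀ f : S → ℝ, (∀ y, 0 ≤ f y) → Integrable f (T x) →
      V x * ∫ y, f y ∂l ≤ ∫ y, f y ∂(T x) := by
    intro f hf hi
    have h1 : ∫ y, f y ∂l ≤ ∫ y, f y ∂(T x) :=
      integral_mono_measure hl (Eventually.of_forall hf) hi
    have h0 : 0 ≤ ∫ y, f y ∂l := integral_nonneg hf
    nlinarith [H.V_pos x, H.V_le x]
  have hw := H.integral_weight hb hd x
  have hwl : d * ∫ y, V y ∂l ≤ ∫ y, d * (V y + b) ∂l := by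
    rw [integral_const_mul]
    gcongr 1
    refine integral_mono hV1 (hV1.add (integrable_const _)) fun y => ?_
    simpa using hb
  have hwl' := mul_le_mul_of_nonneg_left hwl (H.V_pos x).le
  have k1 := key (fun y => d * (V y + b) - ψ y) (fun y => by linarith [le_abs_self (ψ y), hle y])
    (iw.sub iψ)
  have k2 := key (fun y => d * (V y + b) + ψ y) (fun y => by linarith [neg_abs_le (ψ y), hle y])
    (iw.add iψ)
  rw [integral_sub iw iψ, integral_sub iwl iψl] at k1
  rw [integral_add iw iψ, integral_add iwl iψl] at k2
  rw [abs_le]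
  constructor <;> nlinarith

omit [MeasurableSpace S] in
-- The admissible `c` for each `x` form an interval. The hypothesis says that any two of these
-- intervals meet, so all of them contain the supremum of the left endpoints.
lemma exists_center {V : S → ℝ} [Nonempty S] (hV : ∀ x, 0 < V x) {ψ : S → ℝ} {b d : ℝ}
    (h : ∀ x y, ψ x * V y - ψ y * V x ≤ d * (2 * (V x * V y) + b * (V x + V y))) :
    ∃ c, ∀ x, |ψ x - c * V x| ≤ d * (V x + b) := by
  have hpair : ∀ x y, (ψ x - d * (V x + b)) / V x ≤ (ψ y + d * (V y + b)) / V y := by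
    intro x y
    rw [div_le_div_iff₀ (hV x) (hV y)]
    nlinarith [h x y]
  refine ⟨⨆ x, (ψ x - d * (V x + b)) / V x, fun x => ?_⟩
  have y0 : S := Classical.arbitrary S
  have hbdd : BddAbove (Set.range fun x => (ψ x - d * (V x + b)) / V x) :=
    ⟨_, by rintro _ ⟨x, rfl⟩; exact hpair x y0⟩
  have h1 := le_ciSup hbdd x
  have h2 : (⨆ x, (ψ x - d * (V x + b)) / V x) ≤ (ψ x + d * (V x + b)) / V x :=
    ciSup_le fun z => hpair z x
  rw [div_le_iff₀ (hV x)] at h1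
  rw [le_div_iff₀ (hV x)] at h2
  rw [abs_le]
  constructor <;> linarith

/-- One step of the kernel contracts the distance to the line spanned by `V`. -/
lemma exists_contraction (H : HarrisStep T V α C) [Nonempty S] {R : ℝ}
    (hR : ((1 - α) / 2) * R = 2 * ((1 - α) / 2 + C)) {l : Measure S} [IsFiniteMeasure l]
    (hVl : 0 < ∫ y, V y ∂l) (hl : ∀ x, 1 ≤ R * V x → l ≤ T x) :
    ∃ b γ : ℝ, 0 < b ∧ 0 ≤ γ ∧ γ < 1 ∧ ∀ φ : S → ℝ, Measurable φ → ∀ d, 0 ≤ d →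
      (∃ c, ∀ x, |φ x - c * V x| ≤ d * (V x + b)) →
      ∃ c, ∀ x, |∫ y, φ y ∂(T x) - c * V x| ≤ γ * d * (V x + b) := by
  obtain ⟨s, hs⟩ : ∃ s, s = (1 - α) / 2 := ⟨_, rfl⟩
  have hα := H.α_lt
  have hα0 := H.α_nonneg
  have hC := H.C_nonneg
  have hs0 : 0 < s := by rw [hs]; linarith
  rw [← hs] at hR
  set θ := ∫ y, V y ∂l with hθ
  have hCs : 0 < C + s := by linarith
  -- Small enough that the `V`-mass `θ` of the minorizing measure absorbs `b * (C + s)`, the growth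
  -- of the constant part of the weight.
  obtain ⟨b, hb⟩ : ∃ b, b = min 1 (θ / (C + s)) := ⟨_, rfl⟩
  have hb0 : 0 < b := by rw [hb]; exact lt_min one_pos (div_pos hVl hCs)
  have hb1 : b ≤ 1 := by rw [hb]; exact min_le_left _ _
  have hbθ : b * (C + s) ≤ θ := by
    rw [← le_div_iff₀ hCs, hb]; exact min_le_right _ _
  have hbs : b * s ≤ s := by nlinarith
  have hbs0 : 0 < b * s := mul_pos hb0 hs0
  refine ⟨b, 1 - b * s, hb0, by linarith, by linarith, ?_⟩
  rintro φ hφ d hd ⟨c, hc⟩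
  -- As `V` is harmonic, subtracting `c • V` before the step only shifts the centre after the step.
  set ψ : S → ℝ := fun x => φ x - c * V x with hψ
  have hψm : Measurable ψ := hφ.sub (H.V_meas.const_mul c)
  have hK : ∀ x, |ψ x| ≤ d * (1 + b) := fun x =>
    (hc x).trans (by gcongr; exact H.V_le x)
  have hTψ : ∀ x, ∫ y, φ y ∂(T x) = ∫ y, ψ y ∂(T x) + c * V x := by
    intro x
    rw [← H.harmonic x, ← integral_const_mul, ← integral_add (integrable_of_abs_le hψm hK)
      ((integrable_of_abs_le H.V_meas H.abs_V_le).const_mul c)]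
    simp [ψ]
  have hpair : ∀ x y, (∫ z, ψ z ∂(T x)) * V y - (∫ z, ψ z ∂(T y)) * V x ≤
      (1 - b * s) * d * (2 * (V x * V y) + b * (V x + V y)) := by
    intro x y
    have hx := H.V_pos x
    have hy := H.V_pos y
    have hxy := mul_pos hx hy
    -- If `1 / V x + 1 / V y ≥ R`, the drift alone gives the contraction. Otherwise both `V x` and
    -- `V y` exceed `1 / R`, so that `l` lies below both measures.
    by_cases hcase : R * (V x * V y) ≤ V x + V y
    · have h1 := H.abs_integral_le hb0.le hd hc x
      have h2 := H.abs_integral_le hb0.le hd hc y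
      have h1' := mul_le_mul_of_nonneg_right ((le_abs_self _).trans h1) hy.le
      have h2' := mul_le_mul_of_nonneg_right ((neg_le_abs _).trans h2) hx.le
      have e : 2 * (s + C) * (V x * V y) ≤ s * (V x + V y) := by
        calc 2 * (s + C) * (V x * V y) = s * (R * (V x * V y)) := by rw [← hR]; ring
          _ ≤ _ := by gcongr
      have e3 : s ≤ 1 - b * s - α := by linarith
      have e4 : s * (V x + V y) ≤ (1 - b * s - α) * (V x + V y) := by gcongr
      have e2 : 2 * (V x * V y) + b * (α * (V x + V y)) + 2 * (b * C) * (V x * V y) ≤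
          (1 - b * s) * (2 * (V x * V y) + b * (V x + V y)) := by
        have : b * (2 * (s + C) * (V x * V y)) ≤ b * ((1 - b * s - α) * (V x + V y)) := by
          exact mul_le_mul_of_nonneg_left (e.trans e4) hb0.le
        nlinarith
      have := mul_le_mul_of_nonneg_left e2 hd
      nlinarith
    · push Not at hcase
      have hx1 : 1 ≤ R * V x := by
        by_contra hcon
        push Not at hcon
        nlinarith
      have hy1 : 1 ≤ R * V y := by
        by_contra hcon
        push Not at hcon
        nlinarith
      have h1 := H.abs_integral_sub_le hb0.le hd hψm hc x (hl x hx1)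
      have h2 := H.abs_integral_sub_le hb0.le hd hψm hc y (hl y hy1)
      have h1' := mul_le_mul_of_nonneg_right ((le_abs_self _).trans h1) hy.le
      have h2' := mul_le_mul_of_nonneg_right ((neg_le_abs _).trans h2) hx.le
      rw [← hθ] at h1' h2'
      have e2 : 2 * (V x * V y) * (1 - θ) + b * (α * (V x + V y)) + 2 * (b * C) * (V x * V y) ≤
          (1 - b * s) * (2 * (V x * V y) + b * (V x + V y)) := by
        have e3 : 2 * (V x * V y) * (b * (C + s)) ≤ 2 * (V x * V y) * θ := by gcongr
        have e4 : (b * (V x + V y)) * α ≤ (b * (V x + V y)) * (1 - b * s) := by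
          gcongr; linarith
        nlinarith
      have := mul_le_mul_of_nonneg_left e2 hd
      nlinarith
  obtain ⟨c', hc'⟩ := exists_center H.V_pos hpair
  refine ⟨c' + c, fun x => ?_⟩
  rw [hTψ x]
  convert hc' x using 2
  ring

end HarrisStep

/-- The drift inequality for powers of the kernel. -/
lemma HarrisStep.pow {κ : Kernel S S} [IsFiniteKernel κ] {V : S → ℝ} {α C : ℝ}
    (H : HarrisStep κ V α C) (n : ℕ) :
    (∀ x, ∫ y, V y ∂((κ ^ n) x) = V x) ∧
      ∀ x, ((κ ^ n) x).real Set.univ ≤ α ^ n + C / (1 - α) * V x := by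
  have h1α : 0 < 1 - α := by linarith [H.α_lt]
  have hC : 0 ≤ C / (1 - α) := div_nonneg H.C_nonneg h1α.le
  induction n with
  | zero =>
    constructor
    · intro x
      rw [pow_zero]
      change ∫ y, V y ∂((Kernel.id : Kernel S S) x) = V x
      rw [Kernel.id_apply, integral_dirac' _ _ H.V_meas.stronglyMeasurable]
    · intro x
      rw [pow_zero]
      have : ((1 : Kernel S S) x).real Set.univ = 1 := by
        change ((Kernel.id : Kernel S S) x).real Set.univ = 1
        simp [Kernel.id_apply]
      rw [this, pow_zero]
      have := mul_nonneg hC (H.V_pos x).le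
      linarith
  | succ n ih =>
    have := isFiniteKernel_pow κ n
    have := isFiniteKernel_pow κ (n + 1)
    constructor
    · intro x
      rw [integral_pow_add κ n 1 x H.V_meas H.abs_V_le]
      simp_rw [pow_one, H.harmonic]
      exact ih.1 x
    · intro x
      have e : ((κ ^ (n + 1)) x).real Set.univ = ∫ z, (κ z).real Set.univ ∂((κ ^ n) x) := by
        have := integral_pow_add κ n 1 x (φ := fun _ => (1 : ℝ)) measurable_const (K := 1)
          (by simp)
        simpa using this
      have iV : Integrable V ((κ ^ n) x) := integrable_of_abs_le H.V_meas H.abs_V_le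
      rw [e]
      calc ∫ z, (κ z).real Set.univ ∂((κ ^ n) x) ≤ ∫ z, (α + C * V z) ∂((κ ^ n) x) := by
            refine integral_mono_of_nonneg (Eventually.of_forall fun _ => measureReal_nonneg) ?_
              (Eventually.of_forall H.drift)
            exact (integrable_const _).add (iV.const_mul C)
        _ = α * ((κ ^ n) x).real Set.univ + C * V x := by
            rw [integral_add (integrable_const _) (iV.const_mul C), integral_const_mul, ih.1,
              integral_const, smul_eq_mul, mul_comm]
        _ ≤ α * (α ^ n + C / (1 - α) * V x) + C * V x := by
            have := ih.2 x
            have := H.α_nonneg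
            gcongr
        _ = α ^ (n + 1) + C / (1 - α) * V x := by
            field_simp
            ring


/-- **Harris' theorem** for a kernel with a positive harmonic function: the powers converge
uniformly to a rank one limit. -/
theorem HarrisStep.exists_limit {κ : Kernel S S} [IsFiniteKernel κ] [Nonempty S] {V : S → ℝ}
    {α C : ℝ} (H : HarrisStep κ V α C)
    (hmin : ∀ R : ℝ, ∃ m : ℕ, ∃ l : Measure S, 1 ≤ m ∧ IsFiniteMeasure l ∧ 0 < ∫ y, V y ∂l ∧
      ∀ x, 1 ≤ R * V x → l ≤ (κ ^ m) x) :
    ∃ (Λ : (S → ℝ) → ℝ) (ε : ℕ → ℝ), Tendsto ε atTop (𝓝 0) ∧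
      ∀ φ : S → ℝ, Measurable φ → (∀ x, |φ x| ≤ 1) →
        ∀ n x, |∫ y, φ y ∂((κ ^ n) x) - Λ φ * V x| ≤ ε n := by
  have h1α : 0 < 1 - α := by linarith [H.α_lt]
  -- `D` is a drift constant valid for all powers of `κ`, and `R` solves the balance required by
  -- `exists_contraction` with `D` in place of `C`.
  set D := C / (1 - α) with hD
  have hD0 : 0 ≤ D := div_nonneg H.C_nonneg h1α.le
  set R := 2 * ((1 - α) / 2 + D) / ((1 - α) / 2) with hR
  obtain ⟨m, l, hm, hlf, hlV, hl⟩ := hmin R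
  have := isFiniteKernel_pow κ m
  have hT : HarrisStep (κ ^ m) V α D :=
    { H with
      harmonic := (H.pow m).1
      C_nonneg := hD0
      drift := fun x => ((H.pow m).2 x).trans (by
        have : α ^ m ≤ α := pow_le_of_le_one H.α_nonneg H.α_lt.le (by omega)
        gcongr) }
  obtain ⟨b, γ, hb, hγ0, hγ1, hcontr⟩ := hT.exists_contraction (R := R) (by
    rw [hR]; field_simp) hlV hl
  set K := 1 + D with hKdef
  have hK0 : 0 < K := by linarith
  have hmass : ∀ n x, ((κ ^ n) x).real Set.univ ≤ K := fun n x => by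
    refine ((H.pow n).2 x).trans ?_
    have h1 : α ^ n ≤ 1 := pow_le_one₀ H.α_nonneg H.α_lt.le
    have h2 : D * V x ≤ D * 1 := by gcongr; exact H.V_le x
    linarith
  have habs : ∀ n x (φ : S → ℝ) (M : ℝ), (∀ x, |φ x| ≤ M) → |∫ y, φ y ∂((κ ^ n) x)| ≤ M * K := by
    intro n x φ M hφM
    have := isFiniteKernel_pow κ n
    have hM : 0 ≤ M := (abs_nonneg _).trans (hφM x)
    have h1 := norm_integral_le_of_norm_le_const (μ := (κ ^ n) x) (f := φ) (C := M)
      (Eventually.of_forall hφM)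
    rw [Real.norm_eq_abs] at h1
    exact h1.trans (by gcongr; exact hmass n x)
  have hmeas : ∀ n (φ : S → ℝ), Measurable φ → Measurable fun x => ∫ y, φ y ∂((κ ^ n) x) :=
    fun n φ hφ => measurable_integral_pow κ n hφ
  -- geometric contraction along multiples of `m`
  have hgeom : ∀ q (φ : S → ℝ), Measurable φ → ∀ M, 0 ≤ M → (∀ x, |φ x| ≤ M) →
      ∃ c, ∀ x, |∫ y, φ y ∂((κ ^ (m * q)) x) - c * V x| ≤ γ ^ q * (M / b) * (V x + b) := by
    intro q φ hφ M hM hφM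
    induction q with
    | zero =>
      refine ⟨0, fun x => ?_⟩
      rw [mul_zero, pow_zero]
      change |∫ y, φ y ∂((Kernel.id : Kernel S S) x) - _| ≤ _
      rw [Kernel.id_apply, integral_dirac' _ _ hφ.stronglyMeasurable, zero_mul, sub_zero,
        pow_zero, one_mul]
      refine (hφM x).trans ?_
      rw [div_mul_eq_mul_div, le_div_iff₀ hb]
      gcongr
      linarith [H.V_pos x]
    | succ q ih =>
      obtain ⟨c, hc⟩ := hcontr _ (hmeas (m * q) φ hφ) _ (by positivity) ih
      refine ⟨c, fun x => ?_⟩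
      rw [mul_add, mul_one, add_comm, integral_pow_add κ m (m * q) x hφ hφM, pow_succ', mul_assoc γ]
      exact hc x
  -- oscillation of all later powers
  set δ : ℕ → ℝ := fun n => γ ^ (n / m) * (K / b) * (2 * (1 + b)) with hδ
  have hδ0 : ∀ n, 0 ≤ δ n := fun n => by positivity
  have hδlim : Tendsto δ atTop (𝓝 0) := by
    have h1 : Tendsto (fun n : ℕ => n / m) atTop atTop :=
      Nat.tendsto_div_const_atTop (by omega)
    have h2 := (tendsto_pow_atTop_nhds_zero_of_lt_one hγ0 hγ1).comp h1
    simpa [δ] using (h2.mul_const (K / b)).mul_const (2 * (1 + b))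
  have hosc : ∀ n (φ : S → ℝ), Measurable φ → (∀ x, |φ x| ≤ 1) → ∀ x y,
      |(∫ z, φ z ∂((κ ^ n) x)) * V y - (∫ z, φ z ∂((κ ^ n) y)) * V x| ≤ δ n := by
    intro n φ hφ hφ1 x y
    obtain ⟨c, hc⟩ := hgeom (n / m) _ (hmeas (n % m) φ hφ) (1 * K) (by positivity)
      (fun x => habs _ x φ 1 hφ1)
    have e : ∀ x, ∫ z, φ z ∂((κ ^ n) x) =
        ∫ z, ∫ y, φ y ∂((κ ^ (n % m)) z) ∂((κ ^ (m * (n / m))) x) := fun x => by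
      rw [← integral_pow_add κ _ _ x hφ hφ1, Nat.div_add_mod]
    rw [e x, e y]
    have hx := abs_le.1 (hc x)
    have hy := abs_le.1 (hc y)
    rw [one_mul] at hx hy
    have hG : 0 ≤ γ ^ (n / m) * (K / b) := by positivity
    have px := H.V_pos x
    have py := H.V_pos y
    have bx : γ ^ (n / m) * (K / b) * (V x + b) ≤ γ ^ (n / m) * (K / b) * (1 + b) := by
      gcongr; exact H.V_le x
    have bY : γ ^ (n / m) * (K / b) * (V y + b) ≤ γ ^ (n / m) * (K / b) * (1 + b) := by
      gcongr; exact H.V_le y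
    set A := ∫ z, ∫ y, φ y ∂((κ ^ (n % m)) z) ∂((κ ^ (m * (n / m))) x)
    set B := ∫ z, ∫ y, φ y ∂((κ ^ (n % m)) z) ∂((κ ^ (m * (n / m))) y)
    set G := γ ^ (n / m) * (K / b) * (1 + b) with hGdef
    have hG0 : 0 ≤ G := by positivity
    have hA : |A - c * V x| ≤ G := abs_le.2 ⟨by linarith, by linarith⟩
    have hB : |B - c * V y| ≤ G := abs_le.2 ⟨by linarith, by linarith⟩
    have e2 : A * V y - B * V x = (A - c * V x) * V y - (B - c * V y) * V x := by ring
    have e3 : δ n = G + G := by simp only [hδ, hGdef]; ring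
    rw [e2, e3]
    refine (abs_sub _ _).trans (add_le_add ?_ ?_)
    · rw [abs_mul]
      exact (mul_le_mul hA (hT.abs_V_le y) (abs_nonneg _) hG0).trans (by linarith)
    · rw [abs_mul]
      exact (mul_le_mul hB (hT.abs_V_le x) (abs_nonneg _) hG0).trans (by linarith)
  obtain ⟨x₀⟩ := ‹Nonempty S›
  -- The oscillation bound, averaged over its first point with respect to `κ ^ k` started at `x₀`.
  -- The centre `V x₀` is kept because `V` is harmonic for `κ ^ k`. Taking `y = x₀` gives a Cauchy
  -- sequence, letting `k → ∞` gives the uniform rate.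
  have hlater : ∀ n k (φ : S → ℝ), Measurable φ → (∀ x, |φ x| ≤ 1) → ∀ y,
      |(∫ z, φ z ∂((κ ^ (k + n)) x₀)) * V y - (∫ z, φ z ∂((κ ^ n) y)) * V x₀| ≤ δ n * K := by
    intro n k φ hφ hφ1 y
    have := isFiniteKernel_pow κ k
    have hb1 : ∀ z, |∫ u, φ u ∂((κ ^ n) z)| ≤ 1 * K := fun z => habs n z φ 1 hφ1
    have i1 : Integrable (fun z => ∫ u, φ u ∂((κ ^ n) z)) ((κ ^ k) x₀) :=
      integrable_of_abs_le (hmeas n φ hφ) hb1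
    have i2 : Integrable V ((κ ^ k) x₀) := integrable_of_abs_le H.V_meas H.abs_V_le
    have e : (∫ z, φ z ∂((κ ^ (k + n)) x₀)) * V y - (∫ z, φ z ∂((κ ^ n) y)) * V x₀ =
        ∫ z, ((∫ u, φ u ∂((κ ^ n) z)) * V y - (∫ u, φ u ∂((κ ^ n) y)) * V z) ∂((κ ^ k) x₀) := by
      rw [integral_sub (i1.mul_const _) (i2.const_mul _), integral_mul_const, integral_const_mul,
        (H.pow k).1, integral_pow_add κ k n x₀ hφ hφ1]
    rw [e]
    exact habs k x₀ _ _ fun z => hosc n φ hφ hφ1 z y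
  have hcauchy : ∀ φ : S → ℝ, Measurable φ → (∀ x, |φ x| ≤ 1) →
      ∃ L, Tendsto (fun n => ∫ z, φ z ∂((κ ^ n) x₀)) atTop (𝓝 L) := by
    intro φ hφ hφ1
    apply cauchySeq_tendsto_of_complete
    refine Metric.cauchySeq_iff'.2 fun e he => ?_
    have h1 : Tendsto (fun n => δ n * K / V x₀) atTop (𝓝 0) := by
      simpa using (hδlim.mul_const K).div_const (V x₀)
    obtain ⟨N, hN⟩ := (h1.eventually_lt_const he).exists
    refine ⟨N, fun n hn => ?_⟩
    obtain ⟨k, rfl⟩ := Nat.exists_eq_add_of_le' hn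
    refine lt_of_le_of_lt ?_ hN
    have := hlater N k φ hφ hφ1 x₀
    rw [← sub_mul, abs_mul, abs_of_pos (H.V_pos x₀)] at this
    rwa [Real.dist_eq, le_div_iff₀ (H.V_pos x₀)]
  choose! L hL using hcauchy
  refine ⟨fun φ => L φ / V x₀, fun n => δ n * K / V x₀, ?_, ?_⟩
  · simpa using (hδlim.mul_const K).div_const (V x₀)
  · intro φ hφ hφ1 n y
    have h1 : Tendsto (fun k => |(∫ z, φ z ∂((κ ^ (k + n)) x₀)) * V y -
        (∫ z, φ z ∂((κ ^ n) y)) * V x₀|) atTop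
        (𝓝 |L φ * V y - (∫ z, φ z ∂((κ ^ n) y)) * V x₀|) :=
      ((((hL φ hφ hφ1).comp (tendsto_add_atTop_nat n)).mul_const _).sub_const _).abs
    have h2 := le_of_tendsto' h1 fun k => hlater n k φ hφ hφ1 y
    rw [le_div_iff₀ (H.V_pos x₀)]
    refine le_trans (le_of_eq ?_) h2
    nth_rewrite 2 [← abs_of_pos (H.V_pos x₀)]
    rw [← abs_mul, ← abs_neg]
    congr 1
    have := (H.V_pos x₀).ne'
    field_simp
    ring

/-- The powers of `κ` converge to the rank one kernel `φ ↦ Λ φ • V`, uniformly on bounded sets of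
nonnegative measurable functions. -/
structure RankOneLimit (κ : Kernel S S) (V : S → ℝ≥0∞) (Λ : (S → ℝ≥0∞) → ℝ≥0∞) (ε : ℕ → ℝ≥0∞) :
    Prop where
  V_meas : Measurable V
  V_ne_zero : ∀ x, V x ≠ 0
  V_le : ∀ x, V x ≤ 1
  harmonic : ∀ x, ∫⁻ y, V y ∂(κ x) = V x
  tendsto_eps : Tendsto ε atTop (𝓝 0)
  ne_top : ∀ φ, Measurable φ → ∀ K ≠ ∞, (∀ x, φ x ≤ K) → Λ φ ≠ ∞
  upper : ∀ φ, Measurable φ → ∀ K ≠ ∞, (∀ x, φ x ≤ K) →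
    ∀ n x, ∫⁻ y, φ y ∂((κ ^ n) x) ≤ Λ φ * V x + K * ε n
  lower : ∀ φ, Measurable φ → ∀ K ≠ ∞, (∀ x, φ x ≤ K) →
    ∀ n x, Λ φ * V x ≤ ∫⁻ y, φ y ∂((κ ^ n) x) + K * ε n

lemma tendsto_of_two_sided {u ε : ℕ → ℝ≥0∞} {L K : ℝ≥0∞} (hL : L ≠ ∞) (hK : K ≠ ∞)
    (hε : Tendsto ε atTop (𝓝 0)) (h1 : ∀ n, u n ≤ L + K * ε n) (h2 : ∀ n, L ≤ u n + K * ε n) :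
    Tendsto u atTop (𝓝 L) := by
  have hKε : Tendsto (fun n => K * ε n) atTop (𝓝 0) := by
    simpa using ENNReal.Tendsto.const_mul hε (Or.inr hK)
  refine tendsto_of_tendsto_of_tendsto_of_le_of_le (g := fun n => L - K * ε n)
    (h := fun n => L + K * ε n) ?_ ?_ (fun n => tsub_le_iff_right.2 (h2 n)) h1
  · simpa using ENNReal.Tendsto.sub (tendsto_const_nhds (x := L)) hKε (Or.inl hL)
  · simpa using (tendsto_const_nhds (x := L)).add hKε

/-- Transfer of the limit theorem to `[0,∞]`-valued functions, the natural setting for measures and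
kernels. -/
theorem HarrisStep.exists_rankOneLimit {κ : Kernel S S} [IsFiniteKernel κ] [Nonempty S] {V : S → ℝ}
    {α C : ℝ} (H : HarrisStep κ V α C)
    (hmin : ∀ R : ℝ, ∃ m : ℕ, ∃ l : Measure S, 1 ≤ m ∧ IsFiniteMeasure l ∧ 0 < ∫ y, V y ∂l ∧
      ∀ x, 1 ≤ R * V x → l ≤ (κ ^ m) x) :
    ∃ Λ ε, RankOneLimit κ (fun x => ENNReal.ofReal (V x)) Λ ε := by
  obtain ⟨Λ, ε, hε, h⟩ := H.exists_limit hmin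
  have hε0 : ∀ n, 0 ≤ ε n := fun n => by
    obtain ⟨x⟩ := ‹Nonempty S›
    exact (abs_nonneg _).trans (h (fun _ => 0) measurable_const (by simp) n x)
  have hlim : Tendsto (fun n => ENNReal.ofReal (ε n)) atTop (𝓝 0) := by
    simpa using ENNReal.tendsto_ofReal hε
  obtain ⟨x₀⟩ := ‹Nonempty S›
  have hV0 : ∀ x, ENNReal.ofReal (V x) ≠ 0 := fun x => (ENNReal.ofReal_pos.2 (H.V_pos x)).ne'
  have hone : ∀ φ : S → ℝ≥0∞, Measurable φ → (∀ x, φ x ≤ 1) → ∃ L : ℝ≥0∞, L ≠ ∞ ∧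
      (∀ n x, ∫⁻ y, φ y ∂((κ ^ n) x) ≤ L * ENNReal.ofReal (V x) + ENNReal.ofReal (ε n)) ∧
      ∀ n x, L * ENNReal.ofReal (V x) ≤ ∫⁻ y, φ y ∂((κ ^ n) x) + ENNReal.ofReal (ε n) := by
    intro φ hφ hφ1
    have hψ : Measurable fun x => (φ x).toReal := hφ.ennreal_toReal
    have hψ1 : ∀ x, |(φ x).toReal| ≤ 1 := fun x => by
      rw [abs_of_nonneg ENNReal.toReal_nonneg]
      exact ENNReal.toReal_le_of_le_ofReal one_pos.le (by simpa using hφ1 x)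
    have e : ∀ n x, ∫⁻ y, φ y ∂((κ ^ n) x) =
        ENNReal.ofReal (∫ y, (φ y).toReal ∂((κ ^ n) x)) := fun n x => by
      have := isFiniteKernel_pow κ n
      rw [ofReal_integral_eq_lintegral_ofReal (integrable_of_abs_le hψ hψ1)
        (Eventually.of_forall fun _ => ENNReal.toReal_nonneg)]
      refine lintegral_congr fun y => (ENNReal.ofReal_toReal ?_).symm
      exact ne_top_of_le_ne_top ENNReal.one_ne_top (hφ1 y)
    -- A negative value would force the nonnegative integrals along the powers to become negative.
    have hΛ : 0 ≤ Λ fun x => (φ x).toReal := by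
      by_contra hneg
      push Not at hneg
      have h1 := mul_neg_of_neg_of_pos hneg (H.V_pos x₀)
      obtain ⟨n, hn⟩ := (hε.eventually_lt_const (neg_pos.2 h1)).exists
      have h2 := h _ hψ hψ1 n x₀
      have h3 : 0 ≤ ∫ y, (φ y).toReal ∂((κ ^ n) x₀) :=
        integral_nonneg fun _ => ENNReal.toReal_nonneg
      have := le_abs_self (∫ y, (φ y).toReal ∂((κ ^ n) x₀) - (Λ fun x => (φ x).toReal) * V x₀)
      linarith
    refine ⟨ENNReal.ofReal (Λ fun x => (φ x).toReal), ENNReal.ofReal_ne_top, fun n x => ?_,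
      fun n x => ?_⟩
    · rw [e, ← ENNReal.ofReal_mul hΛ, ← ENNReal.ofReal_add (mul_nonneg hΛ (H.V_pos x).le) (hε0 n)]
      apply ENNReal.ofReal_le_ofReal
      have := abs_le.1 (h _ hψ hψ1 n x)
      linarith
    · rw [e, ← ENNReal.ofReal_mul hΛ, ← ENNReal.ofReal_add
        (integral_nonneg fun _ => ENNReal.toReal_nonneg) (hε0 n)]
      apply ENNReal.ofReal_le_ofReal
      have := abs_le.1 (h _ hψ hψ1 n x)
      linarith
  have hK : ∀ φ : S → ℝ≥0∞, Measurable φ → ∀ K ≠ ∞, (∀ x, φ x ≤ K) → ∃ L : ℝ≥0∞, L ≠ ∞ ∧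
      (∀ n x, ∫⁻ y, φ y ∂((κ ^ n) x) ≤ L * ENNReal.ofReal (V x) + K * ENNReal.ofReal (ε n)) ∧
      ∀ n x, L * ENNReal.ofReal (V x) ≤ ∫⁻ y, φ y ∂((κ ^ n) x) + K * ENNReal.ofReal (ε n) := by
    intro φ hφ K hKt hφK
    by_cases hK0 : K = 0
    · refine ⟨0, ENNReal.zero_ne_top, fun n x => ?_, fun n x => by simp⟩
      have : ∀ y, φ y = 0 := fun y => le_antisymm ((hφK y).trans hK0.le) zero_le
      simp [this]
    · obtain ⟨L, hL, h1, h2⟩ := hone (fun x => K⁻¹ * φ x) (hφ.const_mul _) fun x => by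
        calc K⁻¹ * φ x ≤ K⁻¹ * K := by gcongr; exact hφK x
          _ = 1 := ENNReal.inv_mul_cancel hK0 hKt
      have e : ∀ n x, ∫⁻ y, φ y ∂((κ ^ n) x) = K * ∫⁻ y, K⁻¹ * φ y ∂((κ ^ n) x) := fun n x => by
        rw [lintegral_const_mul _ hφ, ← mul_assoc, ENNReal.mul_inv_cancel hK0 hKt, one_mul]
      refine ⟨K * L, ENNReal.mul_ne_top hKt hL, fun n x => ?_, fun n x => ?_⟩
      · rw [e, mul_assoc, ← mul_add]
        gcongr
        exact h1 n x
      · rw [e, mul_assoc, ← mul_add]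
        gcongr
        exact h2 n x
  -- The number `L` found above depends on the bound `K`. Writing it as a limit at `x₀` gives one
  -- formula for the functional, valid for every `K`.
  have hΛ : ∀ φ : S → ℝ≥0∞, Measurable φ → ∀ K ≠ ∞, (∀ x, φ x ≤ K) →
      ∀ L : ℝ≥0∞, L ≠ ∞ →
      (∀ n x, ∫⁻ y, φ y ∂((κ ^ n) x) ≤ L * ENNReal.ofReal (V x) + K * ENNReal.ofReal (ε n)) →
      (∀ n x, L * ENNReal.ofReal (V x) ≤ ∫⁻ y, φ y ∂((κ ^ n) x) + K * ENNReal.ofReal (ε n)) →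
      limsup (fun n => ∫⁻ y, φ y ∂((κ ^ n) x₀)) atTop / ENNReal.ofReal (V x₀) = L := by
    intro φ hφ K hKt hφK L hL h1 h2
    rw [(tendsto_of_two_sided (ENNReal.mul_ne_top hL ENNReal.ofReal_ne_top) hKt hlim
      (fun n => h1 n x₀) (fun n => h2 n x₀)).limsup_eq]
    exact ENNReal.mul_div_cancel_right (hV0 x₀) ENNReal.ofReal_ne_top
  refine ⟨fun φ => limsup (fun n => ∫⁻ y, φ y ∂((κ ^ n) x₀)) atTop / ENNReal.ofReal (V x₀),
    fun n => ENNReal.ofReal (ε n), H.V_meas.ennreal_ofReal, hV0,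
    fun x => by simpa using ENNReal.ofReal_le_ofReal (H.V_le x), fun x => ?_, hlim, ?_, ?_, ?_⟩
  · rw [← ofReal_integral_eq_lintegral_ofReal (integrable_of_abs_le H.V_meas H.abs_V_le)
      (Eventually.of_forall fun y => (H.V_pos y).le), H.harmonic]
  all_goals
    intro φ hφ K hKt hφK
    obtain ⟨L, hL, h1, h2⟩ := hK φ hφ K hKt hφK
    simp only [hΛ φ hφ K hKt hφK L hL h1 h2]
    assumption

/-! ### Properties of the limit functional -/

namespace RankOneLimit

variable {κ : Kernel S S} {V : S → ℝ≥0∞} {Λ : (S → ℝ≥0∞) → ℝ≥0∞} {ε : ℕ → ℝ≥0∞}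

lemma V_ne_top (H : RankOneLimit κ V Λ ε) (x : S) : V x ≠ ∞ :=
  ne_top_of_le_ne_top ENNReal.one_ne_top (H.V_le x)

lemma tendsto (H : RankOneLimit κ V Λ ε) {φ : S → ℝ≥0∞} (hφ : Measurable φ) {K : ℝ≥0∞}
    (hK : K ≠ ∞) (hφK : ∀ x, φ x ≤ K) (x : S) :
    Tendsto (fun n => ∫⁻ y, φ y ∂((κ ^ n) x)) atTop (𝓝 (Λ φ * V x)) :=
  tendsto_of_two_sided (ENNReal.mul_ne_top (H.ne_top φ hφ K hK hφK) (H.V_ne_top x)) hK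
    H.tendsto_eps (fun n => H.upper φ hφ K hK hφK n x) (fun n => H.lower φ hφ K hK hφK n x)

/-- Uniqueness of limits determines `Λ`. Additivity, homogeneity and invariance below are all read
off from the corresponding properties of the powers. -/
lemma eq_of_tendsto [Nonempty S] (H : RankOneLimit κ V Λ ε) {φ : S → ℝ≥0∞} (hφ : Measurable φ)
    {K : ℝ≥0∞} (hK : K ≠ ∞) (hφK : ∀ x, φ x ≤ K) {L : ℝ≥0∞}
    (h : ∀ x, Tendsto (fun n => ∫⁻ y, φ y ∂((κ ^ n) x)) atTop (𝓝 (L * V x))) : Λ φ = L := by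
  obtain ⟨x⟩ := ‹Nonempty S›
  have := tendsto_nhds_unique (H.tendsto hφ hK hφK x) (h x)
  exact (ENNReal.mul_left_inj (H.V_ne_zero x) (H.V_ne_top x)).1 this

lemma map_add [Nonempty S] (H : RankOneLimit κ V Λ ε) {φ ψ : S → ℝ≥0∞} (hφ : Measurable φ)
    (hψ : Measurable ψ) {K : ℝ≥0∞} (hK : K ≠ ∞) (hφK : ∀ x, φ x ≤ K) (hψK : ∀ x, ψ x ≤ K) :
    Λ (fun x => φ x + ψ x) = Λ φ + Λ ψ := by
  refine H.eq_of_tendsto (hφ.add hψ) (ENNReal.add_ne_top.2 ⟨hK, hK⟩)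
    (fun x => add_le_add (hφK x) (hψK x)) fun x => ?_
  rw [add_mul]
  refine ((H.tendsto hφ hK hφK x).add (H.tendsto hψ hK hψK x)).congr fun n => ?_
  exact (lintegral_add_left hφ ψ).symm

lemma map_const_mul [Nonempty S] (H : RankOneLimit κ V Λ ε) {φ : S → ℝ≥0∞} (hφ : Measurable φ)
    {K : ℝ≥0∞} (hK : K ≠ ∞) (hφK : ∀ x, φ x ≤ K) {c : ℝ≥0∞} (hc : c ≠ ∞) :
    Λ (fun x => c * φ x) = c * Λ φ := by
  refine H.eq_of_tendsto (hφ.const_mul c) (ENNReal.mul_ne_top hc hK)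
    (fun x => mul_le_mul_right (hφK x) c) fun x => ?_
  simp_rw [lintegral_const_mul c hφ, mul_assoc]
  exact ENNReal.Tendsto.const_mul (H.tendsto hφ hK hφK x) (Or.inr hc)

lemma map_mono [Nonempty S] (H : RankOneLimit κ V Λ ε) {φ ψ : S → ℝ≥0∞} (hφ : Measurable φ)
    (hψ : Measurable ψ) {K : ℝ≥0∞} (hK : K ≠ ∞) (hψK : ∀ x, ψ x ≤ K) (h : ∀ x, φ x ≤ ψ x) :
    Λ φ ≤ Λ ψ := by
  obtain ⟨x⟩ := ‹Nonempty S›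
  have := le_of_tendsto_of_tendsto' (H.tendsto hφ hK (fun x => (h x).trans (hψK x)) x)
    (H.tendsto hψ hK hψK x) fun n => lintegral_mono h
  exact (ENNReal.mul_le_mul_iff_left (H.V_ne_zero x) (H.V_ne_top x)).1 this

/-- Applying the kernel once more only shifts the index of a convergent sequence. -/
lemma map_kernel [Nonempty S] (H : RankOneLimit κ V Λ ε) {φ : S → ℝ≥0∞} (hφ : Measurable φ)
    {K : ℝ≥0∞} (hK : K ≠ ∞) (hφK : ∀ x, φ x ≤ K) (hκφ : ∀ x, ∫⁻ y, φ y ∂(κ x) ≤ K) :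
    Λ (fun x => ∫⁻ y, φ y ∂(κ x)) = Λ φ := by
  refine H.eq_of_tendsto hφ.lintegral_kernel hK hκφ fun x => ?_
  have := (H.tendsto hφ hK hφK x).comp (tendsto_add_atTop_nat 1)
  refine this.congr fun n => ?_
  rw [Function.comp_apply, lintegral_pow_add κ n 1 x hφ]
  simp_rw [lintegral_pow_one]

lemma lintegral_V_pow (H : RankOneLimit κ V Λ ε) (n : ℕ) (x : S) :
    ∫⁻ y, V y ∂((κ ^ n) x) = V x := by
  induction n with
  | zero => exact lintegral_pow_zero κ x H.V_meas
  | succ n ih =>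
    rw [lintegral_pow_add κ n 1 x H.V_meas]
    simp_rw [lintegral_pow_one, H.harmonic]
    exact ih

/-- A bounded harmonic function is a multiple of `V`. -/
lemma eq_mul_of_harmonic (H : RankOneLimit κ V Λ ε) {φ : S → ℝ≥0∞} (hφ : Measurable φ)
    {K : ℝ≥0∞} (hK : K ≠ ∞) (hφK : ∀ x, φ x ≤ K) (hκφ : ∀ x, ∫⁻ y, φ y ∂(κ x) = φ x) (x : S) :
    φ x = Λ φ * V x := by
  refine tendsto_nhds_unique ?_ (H.tendsto hφ hK hφK x)
  refine tendsto_const_nhds.congr fun n => ?_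
  induction n with
  | zero => exact (lintegral_pow_zero κ x hφ).symm
  | succ n ih =>
    rw [lintegral_pow_add κ n 1 x hφ, ih]
    exact lintegral_congr fun z => by rw [lintegral_pow_one, hκφ]

lemma map_V [Nonempty S] (H : RankOneLimit κ V Λ ε) : Λ V = 1 := by
  refine H.eq_of_tendsto H.V_meas ENNReal.one_ne_top H.V_le fun x => ?_
  simp_rw [H.lintegral_V_pow, one_mul]
  exact tendsto_const_nhds

lemma one_le_map_one [Nonempty S] (H : RankOneLimit κ V Λ ε) : 1 ≤ Λ fun _ => 1 :=
  H.map_V.symm.le.trans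
    (H.map_mono H.V_meas measurable_const ENNReal.one_ne_top (fun _ => le_rfl) H.V_le)

/-- An invariant functional of the form `∫ · dω` is a multiple of `Λ`. -/
lemma functional_eq (H : RankOneLimit κ V Λ ε) {ω : Measure S} [IsFiniteMeasure ω]
    {φ : S → ℝ≥0∞} (hφ : Measurable φ) {K : ℝ≥0∞} (hK : K ≠ ∞) (hφK : ∀ x, φ x ≤ K)
    (hω : ∀ n, ∫⁻ x, ∫⁻ y, φ y ∂((κ ^ n) x) ∂ω = ∫⁻ x, φ x ∂ω) :
    ∫⁻ x, φ x ∂ω = Λ φ * ∫⁻ x, V x ∂ω := by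
  have hV : ∫⁻ x, V x ∂ω ≠ ∞ := by
    refine ne_top_of_le_ne_top (measure_ne_top ω Set.univ) ?_
    calc ∫⁻ x, V x ∂ω ≤ ∫⁻ _, 1 ∂ω := lintegral_mono H.V_le
      _ = _ := by simp
  -- By invariance the integrals against `ω` do not depend on `n`, and the uniform convergence can
  -- be integrated because `ω` is finite.
  refine tendsto_nhds_unique (f := fun _ : ℕ => ∫⁻ x, φ x ∂ω) (l := atTop) tendsto_const_nhds ?_
  refine tendsto_of_two_sided (K := K * ω Set.univ) (ENNReal.mul_ne_top (H.ne_top φ hφ K hK hφK) hV)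
    (ENNReal.mul_ne_top hK (measure_ne_top ω _)) H.tendsto_eps (fun n => ?_) (fun n => ?_)
  · rw [← hω n, ← lintegral_const_mul _ H.V_meas]
    calc ∫⁻ x, ∫⁻ y, φ y ∂((κ ^ n) x) ∂ω ≤ ∫⁻ x, (Λ φ * V x + K * ε n) ∂ω :=
          lintegral_mono fun x => H.upper φ hφ K hK hφK n x
      _ = _ := by
          rw [lintegral_add_right _ measurable_const, lintegral_const]
          ring
  · rw [← hω n, ← lintegral_const_mul _ H.V_meas]
    calc ∫⁻ x, Λ φ * V x ∂ω ≤ ∫⁻ x, (∫⁻ y, φ y ∂((κ ^ n) x) + K * ε n) ∂ω :=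
          lintegral_mono fun x => H.lower φ hφ K hK hφK n x
      _ = _ := by
          rw [lintegral_add_right _ measurable_const, lintegral_const]
          ring

end RankOneLimit

end Harris

/-- The kernel with density `y ↦ g y * h (y - x)`, where the starting point `x` is replaced by its
positive part. -/
noncomputable def stepKernel (h : ℝ → ℝ) (g : ℝ → ℝ≥0∞) : Kernel ℝ ℝ :=
  Kernel.withDensity (Kernel.const ℝ volume) fun x y => g y * ENNReal.ofReal (h (y - max x 0))

/-- A bounded continuous probability density, bounded below by `η` on `[-2δ, 2δ]`. -/
structure IsStepDensity (h : ℝ → ℝ) (M η δ : ℝ) : Prop where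
  cont : Continuous h
  nonneg : ∀ t, 0 ≤ h t
  le : ∀ t, h t ≤ M
  lintegral_eq : ∫⁻ t, ENNReal.ofReal (h t) = 1
  η_pos : 0 < η
  δ_pos : 0 < δ
  lower : ∀ t, |t| ≤ 2 * δ → η ≤ h t

/-! ### Kernels with a weighted translation density -/

section Kernel

variable {h : ℝ → ℝ} {g : ℝ → ℝ≥0∞} {M η δ : ℝ}

lemma measurable_stepDensity (hh : Measurable h) (hg : Measurable g) :
    Measurable (Function.uncurry fun x y => g y * ENNReal.ofReal (h (y - max x 0))) := by
  unfold Function.uncurry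
  fun_prop

lemma lintegral_stepKernel (hh : Measurable h) (hg : Measurable g) {φ : ℝ → ℝ≥0∞}
    (hφ : Measurable φ) (x : ℝ) :
    ∫⁻ y, φ y ∂(stepKernel h g x) = ∫⁻ y, g y * ENNReal.ofReal (h (y - max x 0)) * φ y := by
  rw [stepKernel, Kernel.lintegral_withDensity _ (measurable_stepDensity hh hg) x hφ,
    Kernel.const_apply]

lemma stepKernel_absolutelyContinuous (x : ℝ) : stepKernel h g x ≪ volume := by
  have := Kernel.withDensity_absolutelyContinuous (κ := Kernel.const ℝ (volume : Measure ℝ))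
    (f := fun x y => g y * ENNReal.ofReal (h (y - max x 0))) x
  simpa [stepKernel] using this

lemma IsStepDensity.lintegral_shift (H : IsStepDensity h M η δ) (x : ℝ) :
    ∫⁻ y, ENNReal.ofReal (h (y - x)) = 1 := by
  rw [← H.lintegral_eq]
  exact lintegral_sub_right_eq_self (fun t => ENNReal.ofReal (h t)) x

lemma IsStepDensity.M_pos (H : IsStepDensity h M η δ) : 0 < M :=
  H.η_pos.trans_le ((H.lower 0 (by simpa using H.δ_pos.le)).trans (H.le 0))

lemma lintegral_stepKernel_le (H : IsStepDensity h M η δ) (hg : Measurable g) {c : ℝ≥0∞}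
    (hgc : ∀ y, g y ≤ c) {φ : ℝ → ℝ≥0∞} (hφ : Measurable φ) {K : ℝ≥0∞} (hK : ∀ y, φ y ≤ K)
    (x : ℝ) : ∫⁻ y, φ y ∂(stepKernel h g x) ≤ c * K := by
  have hh := H.cont.measurable
  rw [lintegral_stepKernel hh hg hφ]
  calc ∫⁻ y, g y * ENNReal.ofReal (h (y - max x 0)) * φ y
      ≤ ∫⁻ y, c * ENNReal.ofReal (h (y - max x 0)) * K := by
        gcongr with y
        · exact hgc y
        · exact hK y
    _ = c * K := by
        rw [lintegral_mul_const _ (by fun_prop), lintegral_const_mul _ (by fun_prop),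
          H.lintegral_shift, mul_one]

lemma stepKernel_univ_le (H : IsStepDensity h M η δ) (hg : Measurable g) {c : ℝ≥0∞}
    (hgc : ∀ y, g y ≤ c) (x : ℝ) : stepKernel h g x Set.univ ≤ c := by
  have := lintegral_stepKernel_le H hg hgc (φ := fun _ => 1) measurable_const (K := 1)
    (fun _ => le_rfl) x
  simpa using this

lemma isFiniteKernel_stepKernel (H : IsStepDensity h M η δ) (hg : Measurable g) {c : ℝ≥0∞}
    (hc : c ≠ ∞) (hgc : ∀ y, g y ≤ c) : IsFiniteKernel (stepKernel h g) :=
  ⟨c, hc.lt_top, fun x => stepKernel_univ_le H hg hgc x⟩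

lemma lintegral_stepKernel_indicator_le (H : IsStepDensity h M η δ) {s : Set ℝ}
    (hs : MeasurableSet s) {c : ℝ≥0∞} {φ : ℝ → ℝ≥0∞} (hφ : Measurable φ) (x : ℝ) :
    ∫⁻ y, φ y ∂(stepKernel h (s.indicator fun _ => c) x) ≤
      c * ENNReal.ofReal M * ∫⁻ y in s, φ y := by
  have hh := H.cont.measurable
  rw [lintegral_stepKernel hh (measurable_const.indicator hs) hφ, ← lintegral_const_mul _ hφ,
    ← lintegral_indicator hs]
  refine lintegral_mono fun y => ?_
  by_cases hy : y ∈ s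
  · simp only [Set.indicator_of_mem hy]
    gcongr
    exact H.le _
  · simp [hy]

lemma lintegral_stepKernel_add (hh : Measurable h) {g₁ g₂ : ℝ → ℝ≥0∞} (h₁ : Measurable g₁)
    (h₂ : Measurable g₂) {φ : ℝ → ℝ≥0∞} (hφ : Measurable φ) (x : ℝ) :
    ∫⁻ y, φ y ∂(stepKernel h (fun y => g₁ y + g₂ y) x) =
      ∫⁻ y, φ y ∂(stepKernel h g₁ x) + ∫⁻ y, φ y ∂(stepKernel h g₂ x) := by
  have h12 : Measurable fun y => g₁ y + g₂ y := h₁.add h₂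
  rw [lintegral_stepKernel hh h12 hφ, lintegral_stepKernel hh h₁ hφ,
    lintegral_stepKernel hh h₂ hφ, ← lintegral_add_left (by fun_prop)]
  simp_rw [add_mul]

lemma lintegral_stepKernel_const_mul (hh : Measurable h) (hg : Measurable g) (c : ℝ≥0∞)
    {φ : ℝ → ℝ≥0∞} (hφ : Measurable φ) (x : ℝ) :
    ∫⁻ y, φ y ∂(stepKernel h (fun y => c * g y) x) = c * ∫⁻ y, φ y ∂(stepKernel h g x) := by
  rw [lintegral_stepKernel hh (hg.const_mul c) hφ, lintegral_stepKernel hh hg hφ,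
    ← lintegral_const_mul _ (by fun_prop)]
  simp_rw [mul_assoc]

lemma lintegral_stepKernel_const_mul_pow (hh : Measurable h) (hg : Measurable g) (c : ℝ≥0∞)
    {φ : ℝ → ℝ≥0∞} (hφ : Measurable φ) (n : ℕ) (x : ℝ) :
    ∫⁻ y, φ y ∂((stepKernel h (fun y => c * g y) ^ n) x) =
      c ^ n * ∫⁻ y, φ y ∂((stepKernel h g ^ n) x) := by
  induction n generalizing φ with
  | zero => simp
  | succ n ih =>
    rw [lintegral_pow_add _ n 1 x hφ, lintegral_pow_add _ n 1 x hφ]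
    simp_rw [lintegral_pow_one, lintegral_stepKernel_const_mul hh hg c hφ]
    rw [lintegral_const_mul _ hφ.lintegral_kernel, ih hφ.lintegral_kernel, pow_succ]
    ring

end Kernel

/-- Independent increments with density `h`. -/
structure IsDensityWalk {Ω : Type*} [MeasurableSpace Ω] (P : Measure Ω) (X : ℕ → Ω → ℝ)
    (h : ℝ → ℝ) : Prop where
  meas : ∀ i, Measurable (X i)
  indep : iIndepFun X P
  law : ∀ i, P.map (X i) = volume.withDensity fun t => ENNReal.ofReal (h t)

/-! ### From the walk to powers of the step kernel -/

section Walk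

variable {Ω : Type*} [MeasurableSpace Ω] {P : Measure Ω} [IsProbabilityMeasure P]
  {X : ℕ → Ω → ℝ} {h : ℝ → ℝ}

/-- The increments before time `N`, padded by zeros. -/
noncomputable def past (X : ℕ → Ω → ℝ) (N : ℕ) (ω : Ω) : ℕ → ℝ := fun i =>
  if i < N then X i ω else 0

lemma measurable_walk (hX : ∀ i, Measurable (X i)) (x : ℝ) (n : ℕ) : Measurable (walk X x n) := by
  unfold walk
  fun_prop

omit [MeasurableSpace Ω] in
lemma walk_eq_past (x : ℝ) {k N : ℕ} (hk : k ≤ N) (ω : Ω) :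
    walk X x k ω = x + ∑ i ∈ Finset.range k, past X N ω i := by
  unfold walk past
  congr 1
  refine Finset.sum_congr rfl fun i hi => ?_
  rw [if_pos (lt_of_lt_of_le (Finset.mem_range.1 hi) hk)]

omit [MeasurableSpace Ω] in
lemma walk_succ (x : ℝ) (n : ℕ) (ω : Ω) : walk X x (n + 1) ω = walk X x n ω + X n ω := by
  unfold walk
  rw [Finset.sum_range_succ, add_assoc]

omit [IsProbabilityMeasure P] in
lemma IsDensityWalk.indepFun_past (W : IsDensityWalk P X h) (N : ℕ) :
    IndepFun (past X N) (X N) P := by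
  have h1 := W.indep.indepFun_finset (Finset.range N) {N} (by simp) W.meas
  have m1 : Measurable fun (z : ↥(Finset.range N) → ℝ) (i : ℕ) =>
      if hi : i ∈ Finset.range N then z ⟨i, hi⟩ else 0 := by
    refine measurable_pi_lambda _ fun i => ?_
    by_cases hi : i ∈ Finset.range N
    · simp only [hi, dite_true]; fun_prop
    · simp only [hi, dite_false]; fun_prop
  have m2 : Measurable fun (z : ↥({N} : Finset ℕ) → ℝ) => z ⟨N, Finset.mem_singleton_self N⟩ := by
    fun_prop
  have h2 := h1.comp m1 m2
  convert h2 using 1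
  · funext ω i
    simp only [past, Function.comp_apply, Finset.mem_range]
    split_ifs <;> rfl
  · rfl

/-- The Markov property: the increment `X N` is independent of the past and is integrated out by
Fubini. -/
lemma IsDensityWalk.lintegral_past_mul (W : IsDensityWalk P X h) (hh : Measurable h) (N : ℕ)
    {G : (ℕ → ℝ) → ℝ≥0∞} (hG : Measurable G) {ψ : ℝ → ℝ≥0∞} (hψ : Measurable ψ) (x : ℝ) :
    ∫⁻ ω, G (past X N ω) * ψ (walk X x (N + 1) ω) ∂P =
      ∫⁻ ω, G (past X N ω) * (∫⁻ y, ENNReal.ofReal (h (y - walk X x N ω)) * ψ y) ∂P := by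
  have hpast : Measurable (past X N) := by
    refine measurable_pi_lambda _ fun i => ?_
    unfold past
    by_cases hi : i < N
    · simp only [hi, if_true]; exact W.meas i
    · simp only [hi, if_false]; fun_prop
  set s : (ℕ → ℝ) → ℝ := fun z => x + ∑ i ∈ Finset.range N, z i with hs
  have hsm : Measurable s := by fun_prop
  have e1 : ∀ ω, G (past X N ω) * ψ (walk X x (N + 1) ω) =
      (fun p : (ℕ → ℝ) × ℝ => G p.1 * ψ (s p.1 + p.2)) (past X N ω, X N ω) := fun ω => by
    rw [walk_succ, walk_eq_past x le_rfl ω]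
  simp_rw [e1]
  have hF : Measurable fun p : (ℕ → ℝ) × ℝ => G p.1 * ψ (s p.1 + p.2) := by fun_prop
  rw [← lintegral_map hF (hpast.prodMk (W.meas N)),
    (indepFun_iff_map_prod_eq_prod_map_map hpast.aemeasurable (W.meas N).aemeasurable).1
      (W.indepFun_past N)]
  have := Measure.isProbabilityMeasure_map (μ := P) (W.meas N).aemeasurable
  rw [lintegral_prod _ hF.aemeasurable, lintegral_map (by fun_prop) hpast]
  refine lintegral_congr fun ω => ?_
  simp only
  rw [lintegral_const_mul _ (by fun_prop), W.law N,
    lintegral_withDensity_eq_lintegral_mul _ (by fun_prop) (by fun_prop)]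
  congr 1
  have e2 : s (past X N ω) = walk X x N ω := (walk_eq_past x le_rfl ω).symm
  rw [e2, ← lintegral_sub_right_eq_self _ (walk X x N ω)]
  simp

lemma IsDensityWalk.lintegral_prod_mul (W : IsDensityWalk P X h) (hh : Measurable h)
    {g g' : ℝ → ℝ≥0∞} (hg : Measurable g) (hg0 : ∀ y < 0, g y = 0) (hg' : Measurable g')
    {φ : ℝ → ℝ≥0∞} (hφ : Measurable φ) {x : ℝ} (hx : 0 ≤ x) (N : ℕ) :
    ∫⁻ ω, (∏ k ∈ Finset.range N, g (walk X x (k + 1) ω)) *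
        (g' (walk X x (N + 1) ω) * φ (walk X x (N + 1) ω)) ∂P =
      ∫⁻ ω, (∏ k ∈ Finset.range N, g (walk X x (k + 1) ω)) *
        (∫⁻ y, φ y ∂(stepKernel h g' (walk X x N ω))) ∂P := by
  have e : ∀ ω, ∏ k ∈ Finset.range N, g (walk X x (k + 1) ω) =
      (fun z : ℕ → ℝ => ∏ k ∈ Finset.range N, g (x + ∑ i ∈ Finset.range (k + 1), z i))
        (past X N ω) := fun ω => by
    refine Finset.prod_congr rfl fun k hk => ?_
    rw [walk_eq_past x (Nat.succ_le_of_lt (Finset.mem_range.1 hk))]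
  have hG : Measurable fun z : ℕ → ℝ =>
      ∏ k ∈ Finset.range N, g (x + ∑ i ∈ Finset.range (k + 1), z i) := by fun_prop
  simp_rw [e]
  rw [W.lintegral_past_mul hh N hG (ψ := fun y => g' y * φ y) (by fun_prop) x]
  refine lintegral_congr fun ω => ?_
  have e' := e ω
  simp only at e'
  rw [← e', lintegral_stepKernel hh hg' hφ]
  -- The kernel starts from the positive part of the current position. This is harmless: a negative
  -- position at time `N` forces `N ≥ 1`, and then the last factor of the product vanishes.
  by_cases hneg : walk X x N ω < 0
  · have hN : N ≠ 0 := by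
      rintro rfl
      simp [walk] at hneg
      linarith
    rw [Finset.prod_eq_zero (i := N - 1) (Finset.mem_range.2 (by omega)), zero_mul, zero_mul]
    rw [Nat.sub_add_cancel (by omega)]
    exact hg0 _ hneg
  · rw [max_eq_left (not_lt.1 hneg)]
    congr 1
    refine lintegral_congr fun y => ?_
    ring

/-- The Feynman-Kac formula for the killed and weighted walk. -/
lemma IsDensityWalk.lintegral_prod (W : IsDensityWalk P X h) (hh : Measurable h)
    {g : ℝ → ℝ≥0∞} (hg : Measurable g) (hg0 : ∀ y < 0, g y = 0)
    {φ : ℝ → ℝ≥0∞} (hφ : Measurable φ) {x : ℝ} (hx : 0 ≤ x) (N : ℕ) :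
    ∫⁻ ω, (∏ k ∈ Finset.range N, g (walk X x (k + 1) ω)) * φ (walk X x N ω) ∂P =
      ∫⁻ y, φ y ∂((stepKernel h g ^ N) x) := by
  induction N generalizing φ with
  | zero =>
    rw [lintegral_pow_zero _ _ hφ]
    simp [walk]
  | succ N ih =>
    simp_rw [Finset.prod_range_succ, mul_assoc]
    rw [W.lintegral_prod_mul hh hg hg0 hg hφ hx N, ih hφ.lintegral_kernel,
      lintegral_pow_add _ N 1 x hφ]
    simp_rw [lintegral_pow_one]

end Walk

/-- Weight of a step into the strip, with exponential discount `l`. -/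
noncomputable def gIn (a β l : ℝ) : ℝ → ℝ≥0∞ :=
  (Set.Icc 0 a).indicator fun _ => ENNReal.ofReal (Real.exp (β - l))

/-- Weight of a step above the strip, with exponential discount `l`. -/
noncomputable def gOut (a l : ℝ) : ℝ → ℝ≥0∞ :=
  (Set.Ioi a).indicator fun _ => ENNReal.ofReal (Real.exp (-l))

/-- Weight of a step of the wetting model, with exponential discount `l`. -/
noncomputable def gAll (a β l : ℝ) (y : ℝ) : ℝ≥0∞ := gIn a β l y + gOut a l y

lemma measurable_gIn (a β l : ℝ) : Measurable (gIn a β l) :=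
  measurable_const.indicator measurableSet_Icc

lemma measurable_gOut (a l : ℝ) : Measurable (gOut a l) :=
  measurable_const.indicator measurableSet_Ioi

lemma measurable_gAll (a β l : ℝ) : Measurable (gAll a β l) :=
  (measurable_gIn a β l).add (measurable_gOut a l)

lemma gIn_le (a β l y : ℝ) : gIn a β l y ≤ ENNReal.ofReal (Real.exp (β - l)) :=
  Set.indicator_le_self' (fun _ _ => zero_le) _

lemma gOut_le (a l y : ℝ) : gOut a l y ≤ ENNReal.ofReal (Real.exp (-l)) :=
  Set.indicator_le_self' (fun _ _ => zero_le) _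

lemma gAll_le (a β l y : ℝ) :
    gAll a β l y ≤ ENNReal.ofReal (Real.exp (β - l)) + ENNReal.ofReal (Real.exp (-l)) :=
  add_le_add (gIn_le a β l y) (gOut_le a l y)

lemma gIn_of_neg (a β l : ℝ) {y : ℝ} (hy : y < 0) : gIn a β l y = 0 :=
  Set.indicator_of_notMem (fun h => absurd h.1 (not_le.2 hy)) _

lemma gOut_of_neg {a : ℝ} (ha : 0 < a) (l : ℝ) {y : ℝ} (hy : y < 0) : gOut a l y = 0 :=
  Set.indicator_of_notMem (fun h => absurd (ha.trans h) (not_lt.2 hy.le)) _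

lemma gAll_of_neg {a : ℝ} (ha : 0 < a) (β l : ℝ) {y : ℝ} (hy : y < 0) : gAll a β l y = 0 := by
  rw [gAll, gIn_of_neg a β l hy, gOut_of_neg ha l hy, add_zero]

lemma gIn_eq_mul (a β l y : ℝ) : gIn a β l y = ENNReal.ofReal (Real.exp (-l)) * gIn a β 0 y := by
  unfold gIn
  by_cases hy : y ∈ Set.Icc 0 a
  · simp only [Set.indicator_of_mem hy]
    rw [← ENNReal.ofReal_mul (Real.exp_pos _).le, ← Real.exp_add]
    congr 2
    ring
  · simp [hy]

lemma gOut_eq_mul (a l y : ℝ) : gOut a l y = ENNReal.ofReal (Real.exp (-l)) * gOut a 0 y := by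
  unfold gOut
  by_cases hy : y ∈ Set.Ioi a
  · simp [Set.indicator_of_mem hy]
  · simp only [Set.indicator_of_notMem hy, mul_zero]

lemma gAll_eq_mul (a β l y : ℝ) :
    gAll a β l y = ENNReal.ofReal (Real.exp (-l)) * gAll a β 0 y := by
  unfold gAll
  rw [gIn_eq_mul, gOut_eq_mul, mul_add]

lemma gIn_eq_exp_mul (a β l y : ℝ) :
    gIn a β l y = ENNReal.ofReal (Real.exp β) * gIn a 0 l y := by
  unfold gIn
  by_cases hy : y ∈ Set.Icc 0 a
  · simp only [Set.indicator_of_mem hy]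
    rw [← ENNReal.ofReal_mul (Real.exp_pos _).le, ← Real.exp_add]
    congr 2
    ring
  · simp [hy]

/-! ### Splitting into strip and exterior steps, and extracting discounts -/

section Kernels

variable {h : ℝ → ℝ} {M η δ : ℝ}

lemma isFiniteKernel_gAll (H : IsStepDensity h M η δ) (a β l : ℝ) :
    IsFiniteKernel (stepKernel h (gAll a β l)) :=
  isFiniteKernel_stepKernel H (measurable_gAll a β l)
    (ENNReal.add_ne_top.2 ⟨ENNReal.ofReal_ne_top, ENNReal.ofReal_ne_top⟩) (gAll_le a β l)

lemma lintegral_gAll (H : IsStepDensity h M η δ) (a β l : ℝ) {φ : ℝ → ℝ≥0∞} (hφ : Measurable φ)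
    (x : ℝ) : ∫⁻ y, φ y ∂(stepKernel h (gAll a β l) x) =
      ∫⁻ y, φ y ∂(stepKernel h (gIn a β l) x) + ∫⁻ y, φ y ∂(stepKernel h (gOut a l) x) :=
  lintegral_stepKernel_add H.cont.measurable (measurable_gIn a β l) (measurable_gOut a l) hφ x

lemma lintegral_gAll_pow (H : IsStepDensity h M η δ) (a β l : ℝ) {φ : ℝ → ℝ≥0∞}
    (hφ : Measurable φ) (n : ℕ) (x : ℝ) :
    ∫⁻ y, φ y ∂((stepKernel h (gAll a β l) ^ n) x) =
      ENNReal.ofReal (Real.exp (-l)) ^ n * ∫⁻ y, φ y ∂((stepKernel h (gAll a β 0) ^ n) x) := by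
  rw [show gAll a β l = fun y => ENNReal.ofReal (Real.exp (-l)) * gAll a β 0 y from
    funext (gAll_eq_mul a β l)]
  exact lintegral_stepKernel_const_mul_pow H.cont.measurable (measurable_gAll a β 0) _ hφ n x

lemma lintegral_gOut_pow (H : IsStepDensity h M η δ) (a l : ℝ) {φ : ℝ → ℝ≥0∞}
    (hφ : Measurable φ) (n : ℕ) (x : ℝ) :
    ∫⁻ y, φ y ∂((stepKernel h (gOut a l) ^ n) x) =
      ENNReal.ofReal (Real.exp (-l)) ^ n * ∫⁻ y, φ y ∂((stepKernel h (gOut a 0) ^ n) x) := by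
  rw [show gOut a l = fun y => ENNReal.ofReal (Real.exp (-l)) * gOut a 0 y from
    funext (gOut_eq_mul a l)]
  exact lintegral_stepKernel_const_mul_pow H.cont.measurable (measurable_gOut a 0) _ hφ n x

lemma lintegral_gIn (H : IsStepDensity h M η δ) (a β l : ℝ) {φ : ℝ → ℝ≥0∞}
    (hφ : Measurable φ) (x : ℝ) :
    ∫⁻ y, φ y ∂(stepKernel h (gIn a β l) x) =
      ENNReal.ofReal (Real.exp (-l)) * ∫⁻ y, φ y ∂(stepKernel h (gIn a β 0) x) := by
  rw [show gIn a β l = fun y => ENNReal.ofReal (Real.exp (-l)) * gIn a β 0 y from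
    funext (gIn_eq_mul a β l)]
  exact lintegral_stepKernel_const_mul H.cont.measurable (measurable_gIn a β 0) _ hφ x

lemma lintegral_gIn_exp (H : IsStepDensity h M η δ) (a β l : ℝ) {φ : ℝ → ℝ≥0∞}
    (hφ : Measurable φ) (x : ℝ) :
    ∫⁻ y, φ y ∂(stepKernel h (gIn a β l) x) =
      ENNReal.ofReal (Real.exp β) * ∫⁻ y, φ y ∂(stepKernel h (gIn a 0 l) x) := by
  rw [show gIn a β l = fun y => ENNReal.ofReal (Real.exp β) * gIn a 0 l y from
    funext (gIn_eq_exp_mul a β l)]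
  exact lintegral_stepKernel_const_mul H.cont.measurable (measurable_gIn a 0 l) _ hφ x

lemma lintegral_gOut_pow_le (H : IsStepDensity h M η δ) (a l : ℝ) {φ : ℝ → ℝ≥0∞}
    (hφ : Measurable φ) {K : ℝ≥0∞} (hK : ∀ y, φ y ≤ K) (n : ℕ) (x : ℝ) :
    ∫⁻ y, φ y ∂((stepKernel h (gOut a l) ^ n) x) ≤ ENNReal.ofReal (Real.exp (-l)) ^ n * K := by
  induction n generalizing φ K with
  | zero => rw [lintegral_pow_zero _ _ hφ]; simpa using hK x
  | succ n ih =>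
    rw [lintegral_pow_add _ n 1 x hφ]
    simp_rw [lintegral_pow_one]
    refine (ih hφ.lintegral_kernel (K := ENNReal.ofReal (Real.exp (-l)) * K) fun y =>
      lintegral_stepKernel_le H (measurable_gOut a l) (gOut_le a l) hφ hK y).trans_eq ?_
    rw [pow_succ, mul_assoc]

end Kernels

/-! ### Partition functions and excursion laws as kernel integrals -/

section Model

variable {Ω : Type*} [MeasurableSpace Ω] {P : Measure Ω} [IsProbabilityMeasure P]
  {X : ℕ → Ω → ℝ} {h : ℝ → ℝ} {M η δ : ℝ} {a : ℝ}

omit [MeasurableSpace Ω] in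
lemma staysNonneg_succ (x : ℝ) (N : ℕ) (ω : Ω) :
    ω ∈ staysNonneg X x (N + 1) ↔ ω ∈ staysNonneg X x N ∧ 0 ≤ walk X x (N + 1) ω := by
  simp only [staysNonneg, Set.mem_ofPred_eq, Finset.mem_Icc]
  constructor
  · exact fun hk => ⟨fun k hk' => hk k ⟨hk'.1, by omega⟩, hk (N + 1) ⟨by omega, le_rfl⟩⟩
  · rintro ⟨h1, h2⟩ k ⟨hk1, hk2⟩
    rcases Nat.lt_or_ge k (N + 1) with hlt | hge
    · exact h1 k ⟨hk1, by omega⟩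
    · rwa [le_antisymm hk2 hge]

omit [MeasurableSpace Ω] in
-- The Boltzmann weight and the positivity constraint factor over time: a step contributes `e^β` in
-- the strip, `1` above it and `0` below it.
lemma ofReal_weight (ha : 0 < a) (β x : ℝ) (N : ℕ) (ω : Ω) :
    ENNReal.ofReal (weight X a β x N ω) =
      ∏ k ∈ Finset.range N, gAll a β 0 (walk X x (k + 1) ω) := by
  induction N with
  | zero => simp [weight, staysNonneg, contacts]
  | succ N ih =>
    rw [Finset.prod_range_succ, ← ih]
    by_cases h0 : 0 ≤ walk X x (N + 1) ω
    · by_cases hN : ω ∈ staysNonneg X x N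
      · have hN' := (staysNonneg_succ x N ω).2 ⟨hN, h0⟩
        rw [weight, weight, Set.indicator_of_mem hN', Set.indicator_of_mem hN, contacts,
          Finset.sum_Icc_succ_top (by omega), mul_add, Real.exp_add,
          ENNReal.ofReal_mul (Real.exp_pos _).le]
        congr 1
        by_cases hE : walk X x (N + 1) ω ∈ Set.Icc 0 a
        · have hE' : walk X x (N + 1) ω ∉ Set.Ioi a := not_lt.2 hE.2
          simp [gAll, gIn, gOut, Set.indicator_of_mem hE, Set.indicator_of_notMem hE']
        · have hE' : walk X x (N + 1) ω ∈ Set.Ioi a := by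
            by_contra hcon
            exact hE ⟨h0, not_lt.1 hcon⟩
          simp [gAll, gIn, gOut, Set.indicator_of_notMem hE, Set.indicator_of_mem hE']
      · have hN' : ω ∉ staysNonneg X x (N + 1) := fun hc => hN ((staysNonneg_succ x N ω).1 hc).1
        rw [weight, weight, Set.indicator_of_notMem hN', Set.indicator_of_notMem hN]
        simp
    · have hN' : ω ∉ staysNonneg X x (N + 1) := fun hc => h0 ((staysNonneg_succ x N ω).1 hc).2
      rw [weight, Set.indicator_of_notMem hN', gAll_of_neg ha β 0 (not_le.1 h0)]
      simp

omit [MeasurableSpace Ω] in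
lemma weight_nonneg (a β x : ℝ) (N : ℕ) (ω : Ω) : 0 ≤ weight X a β x N ω :=
  Set.indicator_nonneg (fun _ _ => (Real.exp_pos _).le) _

omit [IsProbabilityMeasure P] in
lemma measurable_ofReal_weight (W : IsDensityWalk P X h) (ha : 0 < a) (β x : ℝ) (N : ℕ) :
    Measurable fun ω => ENNReal.ofReal (weight X a β x N ω) := by
  simp_rw [ofReal_weight ha]
  have := measurable_walk W.meas x
  have := measurable_gAll a β 0
  fun_prop

omit [IsProbabilityMeasure P] in
lemma measurable_weight (W : IsDensityWalk P X h) (ha : 0 < a) (β x : ℝ) (N : ℕ) :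
    Measurable (weight X a β x N) := by
  have := (measurable_ofReal_weight W ha β x N).ennreal_toReal
  simpa only [ENNReal.toReal_ofReal (weight_nonneg a β x N _)] using this

lemma lintegral_weight_mul (W : IsDensityWalk P X h) (H : IsStepDensity h M η δ) (ha : 0 < a)
    (β : ℝ) {x : ℝ} (hx : 0 ≤ x) (N : ℕ) {φ : ℝ → ℝ≥0∞} (hφ : Measurable φ) :
    ∫⁻ ω, ENNReal.ofReal (weight X a β x N ω) * φ (walk X x N ω) ∂P =
      ∫⁻ y, φ y ∂((stepKernel h (gAll a β 0) ^ N) x) := by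
  simp_rw [ofReal_weight ha]
  exact W.lintegral_prod H.cont.measurable (measurable_gAll a β 0) (fun y => gAll_of_neg ha β 0)
    hφ hx N

lemma Zf_eq (W : IsDensityWalk P X h) (H : IsStepDensity h M η δ) (ha : 0 < a) (β : ℝ) (N : ℕ) :
    Zf P X a β N = ((stepKernel h (gAll a β 0) ^ N) 0).real Set.univ := by
  rw [Zf, integral_eq_lintegral_of_nonneg_ae (Eventually.of_forall (weight_nonneg a β 0 N))
    (measurable_weight W ha β 0 N).aestronglyMeasurable]
  have := lintegral_weight_mul W H ha β le_rfl N (φ := fun _ => 1) measurable_const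
  simp only [mul_one, lintegral_const, one_mul] at this
  rw [this, measureReal_def]

lemma Zc_eq (W : IsDensityWalk P X h) (H : IsStepDensity h M η δ) (ha : 0 < a) (β : ℝ) (N : ℕ) :
    Zc P X a β N = ((stepKernel h (gAll a β 0) ^ N) 0).real (Set.Icc 0 a) := by
  have hm : MeasurableSet (walk X 0 N ⁻¹' Set.Icc 0 a) :=
    measurable_walk W.meas 0 N measurableSet_Icc
  rw [Zc, integral_eq_lintegral_of_nonneg_ae
    (Eventually.of_forall (Set.indicator_nonneg fun _ _ => weight_nonneg a β 0 N _))
    ((measurable_weight W ha β 0 N).indicator hm).aestronglyMeasurable]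
  have := lintegral_weight_mul W H ha β le_rfl N (φ := (Set.Icc 0 a).indicator fun _ => 1)
    (measurable_const.indicator measurableSet_Icc)
  rw [lintegral_indicator measurableSet_Icc, setLIntegral_const, one_mul] at this
  rw [measureReal_def, ← this]
  congr 1
  refine lintegral_congr fun ω => ?_
  by_cases hω : walk X 0 N ω ∈ Set.Icc 0 a
  · have : ω ∈ walk X 0 N ⁻¹' Set.Icc 0 a := hω
    simp [Set.indicator_of_mem this, Set.indicator_of_mem hω]
  · have : ω ∉ walk X 0 N ⁻¹' Set.Icc 0 a := hω
    simp [Set.indicator_of_notMem this, Set.indicator_of_notMem hω]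

lemma ZcKer_apply (W : IsDensityWalk P X h) (H : IsStepDensity h M η δ) (ha : 0 < a) (β : ℝ)
    (N : ℕ) {x : ℝ} (hx : 0 ≤ x) {A : Set ℝ} (hA : MeasurableSet A) :
    ZcKer P X a β N x A = (stepKernel h (gAll a β 0) ^ N) x (A ∩ Set.Icc 0 a) := by
  have hA' := hA.inter (measurableSet_Icc (a := (0 : ℝ)) (b := a))
  have hm := measurable_walk W.meas x N
  rw [ZcKer, Measure.restrict_apply hA, Measure.map_apply hm hA', withDensity_apply _ (hm hA')]
  have := lintegral_weight_mul W H ha β hx N (φ := (A ∩ Set.Icc 0 a).indicator fun _ => 1)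
    (measurable_const.indicator hA')
  rw [lintegral_indicator hA', setLIntegral_const, one_mul] at this
  rw [← this, ← lintegral_indicator (hm hA')]
  refine lintegral_congr fun ω => ?_
  by_cases hω : walk X x N ω ∈ A ∩ Set.Icc 0 a
  · have : ω ∈ walk X x N ⁻¹' (A ∩ Set.Icc 0 a) := hω
    rw [Set.indicator_of_mem this, Set.indicator_of_mem hω, mul_one]
  · have : ω ∉ walk X x N ⁻¹' (A ∩ Set.Icc 0 a) := hω
    rw [Set.indicator_of_notMem this, Set.indicator_of_notMem hω, mul_zero]

omit [MeasurableSpace Ω] in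
lemma prod_gOut (x : ℝ) (n : ℕ) (ω : Ω) :
    ∏ k ∈ Finset.range n, gOut a 0 (walk X x (k + 1) ω) =
      {ω | ∀ k ∈ Finset.Ico 1 (n + 1), a < walk X x k ω}.indicator (fun _ => 1) ω := by
  by_cases hω : ω ∈ {ω | ∀ k ∈ Finset.Ico 1 (n + 1), a < walk X x k ω}
  · rw [Set.indicator_of_mem hω]
    refine Finset.prod_eq_one fun k hk => ?_
    have hk' := Finset.mem_range.1 hk
    have : walk X x (k + 1) ω ∈ Set.Ioi a := hω (k + 1) (Finset.mem_Ico.2 ⟨by omega, by omega⟩)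
    simp [gOut, Set.indicator_of_mem this]
  · rw [Set.indicator_of_notMem hω]
    simp only [Set.mem_ofPred_eq, not_forall, Finset.mem_Ico] at hω
    obtain ⟨k, ⟨hk1, hk2⟩, hk⟩ := hω
    refine Finset.prod_eq_zero (i := k - 1) (Finset.mem_range.2 (by omega)) ?_
    rw [Nat.sub_add_cancel hk1]
    exact Set.indicator_of_notMem hk _

/-- An excursion of length `n + 1` consists of `n` steps above the strip and one step into it, hence
the shift of the index. -/
lemma lintegral_excursionKer (W : IsDensityWalk P X h) (H : IsStepDensity h M η δ) (ha : 0 < a)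
    (n : ℕ) {x : ℝ} (hx : x ∈ Set.Icc 0 a) {φ : ℝ → ℝ≥0∞} (hφ : Measurable φ) :
    ∫⁻ y, φ y ∂(excursionKer P X a (n + 1) x) =
      ∫⁻ z, ∫⁻ y, φ y ∂(stepKernel h (gIn a 0 0) z) ∂((stepKernel h (gOut a 0) ^ n) x) := by
  have hm : ∀ k, Measurable (walk X x k) := measurable_walk W.meas x
  have hset : MeasurableSet {ω | ∀ k ∈ Finset.Ico 1 (n + 1), a < walk X x k ω} := by
    simp only [Set.ofPred_forall]
    exact MeasurableSet.iInter fun k => MeasurableSet.iInter fun _ =>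
      measurableSet_lt measurable_const (hm k)
  have hφE := hφ.indicator (measurableSet_Icc (a := (0 : ℝ)) (b := a))
  rw [excursionKer, if_pos hx, ← lintegral_indicator measurableSet_Icc,
    lintegral_map hφE (hm _), ← lintegral_indicator hset,
    ← W.lintegral_prod H.cont.measurable (measurable_gOut a 0) (fun y => gOut_of_neg ha 0)
      hφ.lintegral_kernel hx.1 n,
    ← W.lintegral_prod_mul H.cont.measurable (measurable_gOut a 0) (fun y => gOut_of_neg ha 0)
      (measurable_gIn a 0 0) hφ hx.1 n]
  refine lintegral_congr fun ω => ?_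
  rw [prod_gOut]
  have e : (Set.Icc 0 a).indicator φ (walk X x (n + 1) ω) =
      gIn a 0 0 (walk X x (n + 1) ω) * φ (walk X x (n + 1) ω) := by
    by_cases hE : walk X x (n + 1) ω ∈ Set.Icc 0 a
    · simp [gIn, Set.indicator_of_mem hE]
    · simp [gIn, Set.indicator_of_notMem hE]
  by_cases hω : ω ∈ {ω | ∀ k ∈ Finset.Ico 1 (n + 1), a < walk X x k ω}
  · rw [Set.indicator_of_mem hω, Set.indicator_of_mem hω, one_mul, e]
  · rw [Set.indicator_of_notMem hω, Set.indicator_of_notMem hω, zero_mul]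

/-- Discounted excursions in terms of the step kernels. -/
lemma exp_mul_lintegral_excursionKer (W : IsDensityWalk P X h) (H : IsStepDensity h M η δ)
    (ha : 0 < a) (β l : ℝ) (n : ℕ) {x : ℝ} (hx : x ∈ Set.Icc 0 a) {φ : ℝ → ℝ≥0∞}
    (hφ : Measurable φ) :
    ENNReal.ofReal (Real.exp β) * (ENNReal.ofReal (Real.exp (-l * ((n + 1 : ℕ) : ℝ))) *
        ∫⁻ y, φ y ∂(excursionKer P X a (n + 1) x)) =
      ∫⁻ z, ∫⁻ y, φ y ∂(stepKernel h (gIn a β l) z) ∂((stepKernel h (gOut a l) ^ n) x) := by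
  rw [lintegral_excursionKer W H ha n hx hφ, lintegral_gOut_pow H a l hφ.lintegral_kernel]
  simp_rw [lintegral_gIn_exp H a β l hφ, lintegral_gIn H a 0 l hφ]
  rw [lintegral_const_mul _ (hφ.lintegral_kernel.const_mul _),
    lintegral_const_mul _ hφ.lintegral_kernel]
  have : Real.exp (-l * ((n + 1 : ℕ) : ℝ)) = Real.exp (-l) ^ n * Real.exp (-l) := by
    rw [← pow_succ, ← Real.exp_nat_mul, mul_comm]
  rw [this, ENNReal.ofReal_mul (by positivity), ENNReal.ofReal_pow (Real.exp_pos _).le]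
  ring

/-- The potential of the walk killed on leaving `(a, ∞)`, with discount `l`. -/
noncomputable def potential (h : ℝ → ℝ) (a l : ℝ) (φ : ℝ → ℝ≥0∞) (x : ℝ) : ℝ≥0∞ :=
  ∑' n : ℕ, ∫⁻ y, φ y ∂((stepKernel h (gOut a l) ^ n) x)

lemma exp_mul_lintegral_laplaceKer (W : IsDensityWalk P X h) (H : IsStepDensity h M η δ)
    (ha : 0 < a) (β l : ℝ) {x : ℝ} (hx : x ∈ Set.Icc 0 a) {φ : ℝ → ℝ≥0∞} (hφ : Measurable φ) :
    ENNReal.ofReal (Real.exp β) * ∫⁻ y, φ y ∂(laplaceKer P X a l x) =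
      potential h a l (fun z => ∫⁻ y, φ y ∂(stepKernel h (gIn a β l) z)) x := by
  rw [laplaceKer, lintegral_sum_measure, ← ENNReal.tsum_mul_left, potential]
  refine tsum_congr fun n => ?_
  rw [lintegral_smul_measure, smul_eq_mul]
  exact exp_mul_lintegral_excursionKer W H ha β l n hx hφ

end Model

/-! ### Lower bounds for powers of the kernel on bounded sets -/

section Minorization

variable {h : ℝ → ℝ} {M η δ : ℝ}

lemma le_lintegral_stepKernel (H : IsStepDensity h M η δ) {g : ℝ → ℝ≥0∞} (hg : Measurable g)
    {s : Set ℝ} (hs : MeasurableSet s) {c : ℝ≥0∞} {x : ℝ} (hgc : ∀ y ∈ s, c ≤ g y)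
    (hsx : ∀ y ∈ s, |y - max x 0| ≤ 2 * δ) {φ : ℝ → ℝ≥0∞} (hφ : Measurable φ) :
    c * ENNReal.ofReal η * ∫⁻ y in s, φ y ≤ ∫⁻ y, φ y ∂(stepKernel h g x) := by
  rw [lintegral_stepKernel H.cont.measurable hg hφ, ← lintegral_const_mul _ hφ]
  refine le_trans (setLIntegral_mono' hs fun y hy => ?_) (setLIntegral_le_lintegral s _)
  gcongr
  · exact hgc y hy
  · exact H.lower _ (hsx y hy)

/-- The cells `[iδ, (i+1)δ]` covering the half-line. -/
def cell (δ : ℝ) (i : ℕ) : Set ℝ := Set.Icc (i * δ) ((i + 1) * δ)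

lemma volume_cell (δ : ℝ) (i : ℕ) : volume (cell δ i) = ENNReal.ofReal δ := by
  rw [cell, Real.volume_Icc]
  congr 1
  ring

/-- Points of neighbouring cells are at distance at most `2δ`, where `h ≥ η`. So `n + 1` steps
connect cells whose indices differ by at most `n + 1`, each intermediate step paying a factor `c η`
and the volume `δ` of a cell. -/
lemma cell_pow_le (H : IsStepDensity h M η δ) {g : ℝ → ℝ≥0∞} (hg : Measurable g) {c : ℝ≥0∞}
    (hgc : ∀ y, 0 ≤ y → c ≤ g y) {φ : ℝ → ℝ≥0∞} (hφ : Measurable φ) (n : ℕ) :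
    ∀ i j : ℕ, i ≤ j + (n + 1) → j ≤ i + (n + 1) → ∀ x, max x 0 ∈ cell δ i →
      c * ENNReal.ofReal η * (c * ENNReal.ofReal η * ENNReal.ofReal δ) ^ n * ∫⁻ y in cell δ j, φ y ≤
        ∫⁻ y, φ y ∂((stepKernel h g ^ (n + 1)) x) := by
  have hδ := H.δ_pos
  have step : ∀ {ψ : ℝ → ℝ≥0∞}, Measurable ψ → ∀ i j : ℕ, i ≤ j + 1 → j ≤ i + 1 →
      ∀ x, max x 0 ∈ cell δ i →
      c * ENNReal.ofReal η * ∫⁻ y in cell δ j, ψ y ≤ ∫⁻ y, ψ y ∂(stepKernel h g x) := by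
    intro ψ hψ i j hij hji x hx
    have h1 : (i : ℝ) ≤ j + 1 := by exact_mod_cast hij
    have h2 : (j : ℝ) ≤ i + 1 := by exact_mod_cast hji
    have h3 : (i : ℝ) * δ ≤ (j + 1) * δ := by gcongr
    have h4 : (j : ℝ) * δ ≤ (i + 1) * δ := by gcongr
    refine le_lintegral_stepKernel H hg measurableSet_Icc (fun y hy => hgc y ?_) (fun y hy => ?_) hψ
    · exact le_trans (by positivity) hy.1
    · rw [abs_le]
      constructor <;> linarith [hx.1, hx.2, hy.1, hy.2]
  induction n with
  | zero =>
    intro i j hij hji x hx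
    rw [zero_add, pow_one, pow_zero, mul_one]
    exact step hφ i j (by omega) (by omega) x hx
  | succ n ih =>
    intro i j hij hji x hx
    -- The first step moves one cell towards `j`, or stays put if `i = j`.
    obtain ⟨k, hk1, hk2, hk3, hk4⟩ : ∃ k, i ≤ k + 1 ∧ k ≤ i + 1 ∧ k ≤ j + (n + 1) ∧
        j ≤ k + (n + 1) := by
      rcases lt_trichotomy i j with hlt | rfl | hgt
      · exact ⟨i + 1, by omega, by omega, by omega, by omega⟩
      · exact ⟨i, by omega, by omega, by omega, by omega⟩
      · exact ⟨i - 1, by omega, by omega, by omega, by omega⟩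
    rw [add_comm (n + 1) 1, lintegral_pow_add _ 1 (n + 1) x hφ, lintegral_pow_one]
    refine le_trans ?_ (step hφ.lintegral_kernel i k hk1 hk2 x hx)
    calc c * ENNReal.ofReal η * (c * ENNReal.ofReal η * ENNReal.ofReal δ) ^ (n + 1) *
          ∫⁻ y in cell δ j, φ y
        = c * ENNReal.ofReal η * ∫⁻ _ in cell δ k, c * ENNReal.ofReal η *
          (c * ENNReal.ofReal η * ENNReal.ofReal δ) ^ n * ∫⁻ y in cell δ j, φ y := by
          rw [setLIntegral_const, volume_cell, pow_succ]
          ring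
      _ ≤ _ := by
          refine mul_le_mul_right (setLIntegral_mono' measurableSet_Icc fun z hz => ?_) _
          refine ih k j hk3 hk4 z ?_
          rwa [max_eq_left (le_trans (by positivity) hz.1)]

lemma exists_cell (hδ : 0 < δ) {k : ℕ} (hk : 1 ≤ k) {x : ℝ} (hx : 0 ≤ x) (hxk : x ≤ k * δ) :
    ∃ i < k, x ∈ cell δ i := by
  rcases hxk.lt_or_eq with hlt | heq
  · refine ⟨⌊x / δ⌋₊, ?_, ?_, ?_⟩
    · rw [Nat.floor_lt (by positivity), div_lt_iff₀ hδ]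
      exact hlt
    · rw [← le_div_iff₀ hδ]
      exact Nat.floor_le (by positivity)
    · rw [← div_le_iff₀ hδ]
      exact (Nat.lt_floor_add_one _).le
  · have e : ((k - 1 : ℕ) : ℝ) = k - 1 := by push_cast [hk]; ring
    refine ⟨k - 1, by omega, ?_, ?_⟩
    · rw [e, heq]; nlinarith
    · rw [e, heq]; linarith

/-- Some power of the kernel is bounded below on a bounded set. -/
lemma exists_minorization (H : IsStepDensity h M η δ) {g : ℝ → ℝ≥0∞} (hg : Measurable g)
    {c : ℝ≥0∞} (hc : c ≠ 0) (hct : c ≠ ∞) (hgc : ∀ y, 0 ≤ y → c ≤ g y) (L : ℝ) :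
    ∃ m : ℕ, 1 ≤ m ∧ ∃ c₀ : ℝ≥0∞, c₀ ≠ 0 ∧ c₀ ≠ ∞ ∧ ∀ φ : ℝ → ℝ≥0∞, Measurable φ → ∀ x ≤ L,
      c₀ * ∫⁻ y in Set.Icc 0 L, φ y ≤ ∫⁻ y, φ y ∂((stepKernel h g ^ m) x) := by
  have hδ := H.δ_pos
  have hη := H.η_pos
  obtain ⟨n, hn⟩ := exists_nat_ge (L / δ)
  have hL : L ≤ ((n + 1 : ℕ) : ℝ) * δ := by
    rw [div_le_iff₀ hδ] at hn
    push_cast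
    linarith
  set c₁ := c * ENNReal.ofReal η * (c * ENNReal.ofReal η * ENNReal.ofReal δ) ^ n with hc₁
  have hη' : ENNReal.ofReal η ≠ 0 := (ENNReal.ofReal_pos.2 hη).ne'
  have hδ' : ENNReal.ofReal δ ≠ 0 := (ENNReal.ofReal_pos.2 hδ).ne'
  have h0 : c₁ ≠ 0 := mul_ne_zero (mul_ne_zero hc hη')
    (pow_ne_zero _ (mul_ne_zero (mul_ne_zero hc hη') hδ'))
  have ht : c₁ ≠ ∞ := by
    have := ENNReal.mul_ne_top hct (ENNReal.ofReal_ne_top (r := η))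
    exact ENNReal.mul_ne_top this (ENNReal.pow_ne_top (ENNReal.mul_ne_top this
      ENNReal.ofReal_ne_top))
  have hk0 : ((n + 1 : ℕ) : ℝ≥0∞) ≠ 0 := by simp
  have hkt : ((n + 1 : ℕ) : ℝ≥0∞) ≠ ∞ := ENNReal.natCast_ne_top _
  -- The `n + 1` cells cover `[0, L]`. Each satisfies the bound with `c₁`, and summing over them
  -- costs the factor `n + 1`. A negative starting point is treated as `0` by the kernel.
  refine ⟨n + 1, by omega, ((n + 1 : ℕ) : ℝ≥0∞)⁻¹ * c₁,
    mul_ne_zero (ENNReal.inv_ne_zero.2 hkt) h0,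
    ENNReal.mul_ne_top (ENNReal.inv_ne_top.2 hk0) ht, fun φ hφ x hx => ?_⟩
  rcases le_or_gt 0 L with hL0 | hL0
  · obtain ⟨i, hi, hxi⟩ := exists_cell hδ (by omega : 1 ≤ n + 1) (le_max_right x 0)
      ((max_le hx hL0).trans hL)
    have hcov : Set.Icc 0 L ⊆ ⋃ j : Fin (n + 1), cell δ j := fun y hy => by
      obtain ⟨j, hj, hyj⟩ := exists_cell hδ (by omega : 1 ≤ n + 1) hy.1 (hy.2.trans hL)
      exact Set.mem_iUnion.2 ⟨⟨j, hj⟩, hyj⟩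
    rw [mul_assoc]
    calc ((n + 1 : ℕ) : ℝ≥0∞)⁻¹ * (c₁ * ∫⁻ y in Set.Icc 0 L, φ y)
        ≤ ((n + 1 : ℕ) : ℝ≥0∞)⁻¹ * (c₁ * ∑' j : Fin (n + 1), ∫⁻ y in cell δ j, φ y) := by
          gcongr
          exact (lintegral_mono_set hcov).trans (lintegral_iUnion_le _ _)
      _ = ((n + 1 : ℕ) : ℝ≥0∞)⁻¹ * ∑ j : Fin (n + 1), c₁ * ∫⁻ y in cell δ j, φ y := by
          rw [tsum_fintype, Finset.mul_sum]
      _ ≤ ((n + 1 : ℕ) : ℝ≥0∞)⁻¹ * ∑ _j : Fin (n + 1), ∫⁻ y, φ y ∂((stepKernel h g ^ (n + 1)) x) := by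
          gcongr with j _
          exact cell_pow_le H hg hgc hφ n i j (by omega) (by omega) x hxi
      _ = _ := by
          rw [Finset.sum_const, Finset.card_univ, Fintype.card_fin, nsmul_eq_mul, ← mul_assoc,
            ENNReal.inv_mul_cancel hk0 hkt, one_mul]
  · simp [Set.Icc_eq_empty (not_le.2 hL0)]

lemma gAll_ge (a β l : ℝ) {y : ℝ} (hy : 0 ≤ y) :
    min (ENNReal.ofReal (Real.exp (β - l))) (ENNReal.ofReal (Real.exp (-l))) ≤ gAll a β l y := by
  rcases le_or_gt y a with h | h
  · refine (min_le_left _ _).trans ?_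
    rw [gAll, gIn, Set.indicator_of_mem (show y ∈ Set.Icc 0 a from ⟨hy, h⟩)]
    exact le_self_add
  · refine (min_le_right _ _).trans ?_
    rw [gAll, gOut, Set.indicator_of_mem (show y ∈ Set.Ioi a from h)]
    exact le_add_self

lemma exists_minorization_gAll (H : IsStepDensity h M η δ) (a β l L : ℝ) :
    ∃ m : ℕ, 1 ≤ m ∧ ∃ c₀ : ℝ≥0∞, c₀ ≠ 0 ∧ c₀ ≠ ∞ ∧ ∀ φ : ℝ → ℝ≥0∞, Measurable φ → ∀ x ≤ L,
      c₀ * ∫⁻ y in Set.Icc 0 L, φ y ≤ ∫⁻ y, φ y ∂((stepKernel h (gAll a β l) ^ m) x) := by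
  refine exists_minorization H (measurable_gAll a β l) ?_ ?_ (fun y hy => gAll_ge a β l hy) L
  · exact (lt_min (ENNReal.ofReal_pos.2 (Real.exp_pos _))
      (ENNReal.ofReal_pos.2 (Real.exp_pos _))).ne'
  · exact ne_top_of_le_ne_top ENNReal.ofReal_ne_top (min_le_left _ _)

end Minorization

/-! ### A priori bounds on the free energy and its positivity above the critical point -/

section FreeEnergy

variable {Ω : Type*} [MeasurableSpace Ω] {P : Measure Ω} [IsProbabilityMeasure P]
  {X : ℕ → Ω → ℝ} {h : ℝ → ℝ} {M η δ : ℝ} {a : ℝ}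

/-- Restriction to the paths that stay in `[0, δ]`, which is contained in the strip: there every
step has weight `e^β` and density at least `η`. -/
lemma le_partition (H : IsStepDensity h M η δ) (hδa : δ ≤ a) (β : ℝ) (N : ℕ) :
    ∀ x ∈ Set.Icc 0 δ, ENNReal.ofReal (Real.exp β * η * δ) ^ N ≤
      (stepKernel h (gAll a β 0) ^ N) x Set.univ := by
  have hδ := H.δ_pos
  have hη := H.η_pos
  induction N with
  | zero =>
    intro x _
    have := lintegral_pow_zero (stepKernel h (gAll a β 0)) x (φ := fun _ => 1) measurable_const
    rw [lintegral_one] at this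
    rw [this, pow_zero]
  | succ N ih =>
    intro x hx
    have e := lintegral_pow_add (stepKernel h (gAll a β 0)) 1 N x (φ := fun _ => 1)
      measurable_const
    simp only [lintegral_one, lintegral_pow_one] at e
    rw [add_comm N 1, e]
    have hm : Measurable fun z => (stepKernel h (gAll a β 0) ^ N) z Set.univ :=
      Kernel.measurable_coe _ MeasurableSet.univ
    refine le_trans ?_ (le_lintegral_stepKernel H (measurable_gAll a β 0) measurableSet_Icc
      (s := Set.Icc 0 δ) (c := ENNReal.ofReal (Real.exp β)) (fun y hy => ?_) (fun y hy => ?_) hm)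
    · calc ENNReal.ofReal (Real.exp β * η * δ) ^ (1 + N)
          = ENNReal.ofReal (Real.exp β) * ENNReal.ofReal η * ∫⁻ _ in Set.Icc 0 δ,
            ENNReal.ofReal (Real.exp β * η * δ) ^ N := by
            rw [setLIntegral_const, Real.volume_Icc, sub_zero, add_comm, pow_succ]
            rw [ENNReal.ofReal_mul (p := Real.exp β * η) (by positivity),
              ENNReal.ofReal_mul (p := Real.exp β) (by positivity)]
            ring
        _ ≤ _ := by
            exact mul_le_mul_right (setLIntegral_mono' measurableSet_Icc fun z hz => ih z hz) _
    · rw [gAll, gIn, Set.indicator_of_mem (show y ∈ Set.Icc 0 a from ⟨hy.1, hy.2.trans hδa⟩),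
        sub_zero]
      exact le_self_add
    · rw [max_eq_left hx.1, abs_le]
      constructor <;> linarith [hx.1, hx.2, hy.1, hy.2]

lemma partition_le (H : IsStepDensity h M η δ) (β : ℝ) (N : ℕ) (x : ℝ) :
    (stepKernel h (gAll a β 0) ^ N) x Set.univ ≤ ENNReal.ofReal (Real.exp β + 1) ^ N := by
  induction N generalizing x with
  | zero =>
    have := lintegral_pow_zero (stepKernel h (gAll a β 0)) x (φ := fun _ => 1) measurable_const
    rw [lintegral_one] at this
    rw [this, pow_zero]
  | succ N ih =>
    have e := lintegral_pow_add (stepKernel h (gAll a β 0)) 1 N x (φ := fun _ => 1)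
      measurable_const
    simp only [lintegral_one, lintegral_pow_one] at e
    rw [add_comm N 1, e, pow_add, pow_one]
    refine lintegral_stepKernel_le H (measurable_gAll a β 0) (fun y => ?_)
      (Kernel.measurable_coe _ MeasurableSet.univ) ih x
    refine (gAll_le a β 0 y).trans_eq ?_
    rw [← ENNReal.ofReal_add (Real.exp_pos _).le (Real.exp_pos _).le]
    simp

lemma Zf_lower (W : IsDensityWalk P X h) (H : IsStepDensity h M η δ) (ha : 0 < a) (hδa : δ ≤ a)
    (β : ℝ) (N : ℕ) : (Real.exp β * η * δ) ^ N ≤ Zf P X a β N := by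
  have := isFiniteKernel_gAll H a β 0
  have := isFiniteKernel_pow (stepKernel h (gAll a β 0)) N
  have hη := H.η_pos
  have hδ := H.δ_pos
  rw [Zf_eq W H ha β N, measureReal_def, ← ENNReal.ofReal_le_iff_le_toReal (measure_ne_top _ _),
    ENNReal.ofReal_pow (by positivity)]
  exact le_partition H hδa β N 0 ⟨le_rfl, H.δ_pos.le⟩

lemma Zf_pos (W : IsDensityWalk P X h) (H : IsStepDensity h M η δ) (ha : 0 < a) (hδa : δ ≤ a)
    (β : ℝ) (N : ℕ) : 0 < Zf P X a β N := by
  refine lt_of_lt_of_le ?_ (Zf_lower W H ha hδa β N)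
  have hη := H.η_pos
  have hδ := H.δ_pos
  positivity

lemma Zf_upper (W : IsDensityWalk P X h) (H : IsStepDensity h M η δ) (ha : 0 < a)
    (β : ℝ) (N : ℕ) : Zf P X a β N ≤ (Real.exp β + 1) ^ N := by
  have hp := Real.exp_pos β
  rw [Zf_eq W H ha β N, measureReal_def]
  refine ENNReal.toReal_le_of_le_ofReal (by positivity) ?_
  rw [ENNReal.ofReal_pow (by positivity)]
  exact partition_le H β N 0

lemma le_logZf (W : IsDensityWalk P X h) (H : IsStepDensity h M η δ) (ha : 0 < a) (hδa : δ ≤ a)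
    (β : ℝ) : ∀ᶠ N : ℕ in atTop, Real.log (Real.exp β * η * δ) ≤
      1 / (N : ℝ) * Real.log (Zf P X a β N) := by
  have hη := H.η_pos
  have hδ := H.δ_pos
  filter_upwards [eventually_ge_atTop 1] with N hN
  have hN' : (0 : ℝ) < N := by exact_mod_cast hN
  have := Real.log_le_log (by positivity) (Zf_lower W H ha hδa β N)
  rw [Real.log_pow] at this
  rw [one_div_mul_eq_div, le_div_iff₀ hN']
  linarith

lemma logZf_le (W : IsDensityWalk P X h) (H : IsStepDensity h M η δ) (ha : 0 < a) (hδa : δ ≤ a)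
    (β : ℝ) : ∀ᶠ N : ℕ in atTop, 1 / (N : ℝ) * Real.log (Zf P X a β N) ≤
      Real.log (Real.exp β + 1) := by
  filter_upwards [eventually_ge_atTop 1] with N hN
  have hN' : (0 : ℝ) < N := by exact_mod_cast hN
  have := Real.log_le_log (Zf_pos W H ha hδa β N) (Zf_upper W H ha β N)
  rw [Real.log_pow] at this
  rw [one_div_mul_eq_div, div_le_iff₀ hN']
  linarith

lemma isBoundedUnder_le_logZf (W : IsDensityWalk P X h) (H : IsStepDensity h M η δ) (ha : 0 < a)
    (hδa : δ ≤ a) (β : ℝ) : IsBoundedUnder (· ≤ ·) atTop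
      fun N : ℕ => 1 / (N : ℝ) * Real.log (Zf P X a β N) :=
  isBoundedUnder_of_eventually_le (logZf_le W H ha hδa β)

lemma isCoboundedUnder_le_logZf (W : IsDensityWalk P X h) (H : IsStepDensity h M η δ) (ha : 0 < a)
    (hδa : δ ≤ a) (β : ℝ) : IsCoboundedUnder (· ≤ ·) atTop
      fun N : ℕ => 1 / (N : ℝ) * Real.log (Zf P X a β N) :=
  (isBoundedUnder_of_eventually_ge (le_logZf W H ha hδa β)).isCoboundedUnder_le

lemma Zf_mono (W : IsDensityWalk P X h) (H : IsStepDensity h M η δ) (ha : 0 < a)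
    {β β' : ℝ} (hβ : β ≤ β') (N : ℕ) : Zf P X a β N ≤ Zf P X a β' N := by
  have e : ∀ b, Zf P X a b N = (∫⁻ ω, ENNReal.ofReal (weight X a b 0 N ω) ∂P).toReal := fun b => by
    rw [Zf, integral_eq_lintegral_of_nonneg_ae (Eventually.of_forall (weight_nonneg a b 0 N))
      (measurable_weight W ha b 0 N).aestronglyMeasurable]
  rw [e, e]
  refine ENNReal.toReal_mono ?_ (lintegral_mono fun ω => ENNReal.ofReal_le_ofReal ?_)
  · have := lintegral_weight_mul W H ha β' le_rfl N (φ := fun _ => 1) measurable_const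
    simp only [mul_one, lintegral_const, one_mul] at this
    rw [this]
    have := isFiniteKernel_gAll H a β' 0
    have := isFiniteKernel_pow (stepKernel h (gAll a β' 0)) N
    exact measure_ne_top _ _
  · refine Set.indicator_le_indicator (Real.exp_le_exp.2 ?_)
    refine mul_le_mul_of_nonneg_right hβ ?_
    exact Finset.sum_nonneg fun k _ => Set.indicator_nonneg (fun _ _ => zero_le_one) _

lemma freeEnergy_mono (W : IsDensityWalk P X h) (H : IsStepDensity h M η δ) (ha : 0 < a)
    (hδa : δ ≤ a) {β β' : ℝ} (hβ : β ≤ β') : freeEnergy P X a β ≤ freeEnergy P X a β' := by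
  refine limsup_le_limsup (Eventually.of_forall fun N => ?_)
    (isCoboundedUnder_le_logZf W H ha hδa β) (isBoundedUnder_le_logZf W H ha hδa β')
  exact mul_le_mul_of_nonneg_left
    (Real.log_le_log (Zf_pos W H ha hδa β N) (Zf_mono W H ha hβ N)) (by positivity)

lemma freeEnergy_pos (W : IsDensityWalk P X h) (H : IsStepDensity h M η δ) (ha : 0 < a)
    (hδa : δ ≤ a) {β : ℝ} (hβ : criticalPoint P X a < β) : 0 < freeEnergy P X a β := by
  have hη := H.η_pos
  have hδ := H.δ_pos
  set s : Set ℝ := {β : ℝ | 0 < freeEnergy P X a β} with hs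
  have hne : s.Nonempty := by
    -- With this choice `e^b η δ = e`, so the lower bound on the partition function gives free
    -- energy at least `1`.
    set b := 1 - Real.log (η * δ) with hb
    refine ⟨b, ?_⟩
    have h1 : Real.log (Real.exp b * η * δ) = 1 := by
      rw [mul_assoc, Real.log_mul (Real.exp_pos _).ne' (by positivity), Real.log_exp, hb]
      ring
    have h2 : (1 : ℝ) ≤ freeEnergy P X a b := by
      refine le_limsup_of_frequently_le ?_ (isBoundedUnder_le_logZf W H ha hδa b)
      exact h1 ▸ (le_logZf W H ha hδa b).frequently
    exact lt_of_lt_of_le one_pos h2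
  obtain ⟨b, hbs, hb⟩ : ∃ b ∈ s, b < β := by
    -- If the set is not bounded below, its `sInf` carries no information, but then it has elements
    -- below any `β`.
    by_cases hbdd : BddBelow s
    · exact exists_lt_of_csInf_lt hne hβ
    · rw [not_bddBelow_iff] at hbdd
      exact hbdd β
  exact lt_of_lt_of_le hbs (freeEnergy_mono W H ha hδa hb.le)

lemma exists_partition_le_exp (W : IsDensityWalk P X h) (H : IsStepDensity h M η δ) (ha : 0 < a)
    (hδa : δ ≤ a) {β l : ℝ} (hl : freeEnergy P X a β < l) :
    ∃ C : ℝ, 0 < C ∧ ∀ N : ℕ, Zf P X a β N ≤ C * Real.exp (l * N) := by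
  have h1 := eventually_lt_of_limsup_lt hl (isBoundedUnder_le_logZf W H ha hδa β)
  obtain ⟨N₀, hN₀⟩ := eventually_atTop.1 h1
  have hterm : ∀ N : ℕ, 0 ≤ Zf P X a β N / Real.exp (l * N) := fun N =>
    div_nonneg (Zf_pos W H ha hδa β N).le (Real.exp_pos _).le
  -- The limit superior controls all large `N` with constant `1`. The sum absorbs the finitely many
  -- other terms.
  refine ⟨1 + ∑ N ∈ Finset.range (N₀ + 1), Zf P X a β N / Real.exp (l * N), ?_, fun N => ?_⟩
  · have := Finset.sum_nonneg fun N (_ : N ∈ Finset.range (N₀ + 1)) => hterm N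
    linarith
  · rw [← div_le_iff₀ (Real.exp_pos _)]
    by_cases hN : N < N₀ + 1
    · have := Finset.single_le_sum (fun N _ => hterm N) (Finset.mem_range.2 hN)
      linarith
    · have hs := Finset.sum_nonneg fun N (_ : N ∈ Finset.range (N₀ + 1)) => hterm N
      have hN' : (0 : ℝ) < N := by
        have : 0 < N := by omega
        exact_mod_cast this
      have := hN₀ N (by omega)
      rw [one_div_mul_eq_div, div_lt_iff₀ hN', Real.log_lt_iff_lt_exp (Zf_pos W H ha hδa β N)]
        at this
      have : Zf P X a β N / Real.exp (l * N) ≤ 1 := by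
        rw [div_le_one (Real.exp_pos _)]
        exact this.le
      linarith

lemma freeEnergy_le (W : IsDensityWalk P X h) (H : IsStepDensity h M η δ) (ha : 0 < a)
    (hδa : δ ≤ a) {β l C : ℝ} (hC : 0 < C) (hZ : ∀ N : ℕ, Zf P X a β N ≤ C * Real.exp (l * N)) :
    freeEnergy P X a β ≤ l := by
  have hlim : Tendsto (fun N : ℕ => 1 / (N : ℝ) * Real.log C + l) atTop (𝓝 l) := by
    simpa using (tendsto_one_div_atTop_nhds_zero_nat.mul_const (Real.log C)).add_const l
  rw [← hlim.limsup_eq]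
  refine limsup_le_limsup ?_ (isCoboundedUnder_le_logZf W H ha hδa β) hlim.isBoundedUnder_le
  filter_upwards [eventually_ge_atTop 1] with N hN
  have hN' : (0 : ℝ) < N := by exact_mod_cast hN
  have := Real.log_le_log (Zf_pos W H ha hδa β N) (hZ N)
  rw [Real.log_mul hC.ne' (Real.exp_pos _).ne', Real.log_exp] at this
  calc 1 / (N : ℝ) * Real.log (Zf P X a β N) ≤ 1 / (N : ℝ) * (Real.log C + l * N) := by gcongr
    _ = _ := by field_simp

end FreeEnergy

/-! ### Extraction of a pointwise convergent subsequence -/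

section Compactness

/-- A pointwise bounded equicontinuous sequence has a pointwise convergent subsequence. -/
lemma exists_subseq_tendsto {f : ℕ → ℝ → ℝ} (h01 : ∀ n x, f n x ∈ Set.Icc (0 : ℝ) 1)
    (heq : ∀ x, ∀ e > 0, ∀ᶠ x' in 𝓝 x, ∀ n, |f n x' - f n x| ≤ e) :
    ∃ s : ℕ → ℕ, StrictMono s ∧ ∃ V : ℝ → ℝ, ∀ x, Tendsto (fun n => f (s n) x) atTop (𝓝 (V x)) := by
  have hc : IsCompact (Set.univ.pi fun _ : ℚ => Set.Icc (0 : ℝ) 1) :=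
    isCompact_univ_pi fun _ => isCompact_Icc
  obtain ⟨b, -, s, hs, hlim⟩ := hc.tendsto_subseq (x := fun n (q : ℚ) => f n q)
    fun n q _ => h01 n q
  rw [tendsto_pi_nhds] at hlim
  refine ⟨s, hs, ?_⟩
  have hconv : ∀ x, ∃ L, Tendsto (fun n => f (s n) x) atTop (𝓝 L) := by
    intro x
    apply cauchySeq_tendsto_of_complete
    refine Metric.cauchySeq_iff'.2 fun e he => ?_
    -- Convergence holds at the rationals by a diagonal argument, here Tychonoff. Equicontinuity
    -- carries the Cauchy property from a nearby rational to `x`.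
    obtain ⟨U, hU, hUo, hxU⟩ := eventually_nhds_iff.1 (heq x (e / 5) (by positivity))
    obtain ⟨q, hq⟩ := Rat.denseRange_cast.exists_mem_open hUo ⟨x, hxU⟩
    have hq' := hU _ hq
    have hcq := (hlim q).cauchySeq
    obtain ⟨N, hN⟩ := Metric.cauchySeq_iff'.1 hcq (e / 5) (by positivity)
    refine ⟨N, fun n hn => ?_⟩
    have h1 := hN n hn
    have h2 := abs_le.1 (hq' (s n))
    have h3 := abs_le.1 (hq' (s N))
    rw [Real.dist_eq, abs_lt] at h1 ⊢
    simp only [Function.comp_apply] at h1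
    constructor <;> linarith [h1.1, h1.2, h2.1, h2.2, h3.1, h3.2]
  choose V hV using hconv
  exact ⟨V, hV⟩

end Compactness

/-! ### Continuity of translations in `L¹` and tails of the step law -/

section Translation

variable {h : ℝ → ℝ} {M η δ : ℝ}

/-- The `L¹` distance between two translates of `h`. -/
noncomputable def shiftDist (h : ℝ → ℝ) (x x' : ℝ) : ℝ≥0∞ :=
  ∫⁻ y, ENNReal.ofReal |h (y - max x 0) - h (y - max x' 0)|

lemma shiftDist_comm (h : ℝ → ℝ) (x x' : ℝ) : shiftDist h x x' = shiftDist h x' x := by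
  unfold shiftDist
  simp_rw [abs_sub_comm]

/-- Continuity of translations in `L¹`, by Scheffé's argument. -/
lemma tendsto_shiftDist (H : IsStepDensity h M η δ) (x : ℝ) :
    Tendsto (fun x' => shiftDist h x' x) (𝓝 x) (𝓝 0) := by
  have hm := H.cont.measurable
  -- Writing `|p - q|` as `p + q - 2 min p q` leaves only the integral of the minimum to control,
  -- and this is dominated by the fixed translate at `x`.
  have hpt : ∀ p q : ℝ, 0 ≤ p → 0 ≤ q → ENNReal.ofReal |p - q| =
      ENNReal.ofReal p + ENNReal.ofReal q - 2 * ENNReal.ofReal (min p q) := by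
    intro p q hp hq
    rw [← ENNReal.ofReal_add hp hq, ← ENNReal.ofReal_ofNat 2, ← ENNReal.ofReal_mul (by norm_num),
      ← ENNReal.ofReal_sub _ (by positivity)]
    congr 1
    rcases le_total p q with hpq | hpq
    · rw [min_eq_left hpq, abs_of_nonpos (by linarith)]; ring
    · rw [min_eq_right hpq, abs_of_nonneg (by linarith)]; ring
  have hmin : ∀ x', ∫⁻ y, ENNReal.ofReal (min (h (y - max x' 0)) (h (y - max x 0))) ≤ 1 := by
    intro x'
    rw [← H.lintegral_shift (max x 0)]
    exact lintegral_mono fun y => ENNReal.ofReal_le_ofReal (min_le_right _ _)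
  have e : ∀ x', shiftDist h x' x =
      2 - 2 * ∫⁻ y, ENNReal.ofReal (min (h (y - max x' 0)) (h (y - max x 0))) := by
    intro x'
    unfold shiftDist
    simp_rw [hpt _ _ (H.nonneg _) (H.nonneg _)]
    rw [lintegral_sub (by fun_prop), lintegral_add_left (by fun_prop),
      lintegral_const_mul _ (by fun_prop), H.lintegral_shift, H.lintegral_shift, one_add_one_eq_two]
    · rw [lintegral_const_mul _ (by fun_prop)]
      exact ENNReal.mul_ne_top (by norm_num) (ne_top_of_le_ne_top ENNReal.one_ne_top (hmin x'))
    · refine Eventually.of_forall fun y => ?_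
      dsimp only
      rw [← ENNReal.ofReal_add (H.nonneg _) (H.nonneg _), ← ENNReal.ofReal_ofNat 2,
        ← ENNReal.ofReal_mul (by norm_num)]
      apply ENNReal.ofReal_le_ofReal
      rcases le_total (h (y - max x' 0)) (h (y - max x 0)) with hpq | hpq
      · rw [min_eq_left hpq]; linarith
      · rw [min_eq_right hpq]; linarith
  have hlim : Tendsto (fun x' => ∫⁻ y, ENNReal.ofReal (min (h (y - max x' 0)) (h (y - max x 0))))
      (𝓝 x) (𝓝 1) := by
    rw [← H.lintegral_shift (max x 0)]
    refine tendsto_lintegral_filter_of_dominated_convergence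
      (fun y => ENNReal.ofReal (h (y - max x 0))) ?_ ?_ ?_ ?_
    · exact Eventually.of_forall fun x' => by fun_prop
    · exact Eventually.of_forall fun x' => Eventually.of_forall fun y =>
        ENNReal.ofReal_le_ofReal (min_le_right _ _)
    · rw [H.lintegral_shift]; exact ENNReal.one_ne_top
    · refine Eventually.of_forall fun y => ?_
      have hc : Continuous fun x' => ENNReal.ofReal (min (h (y - max x' 0)) (h (y - max x 0))) := by
        have := H.cont
        exact ENNReal.continuous_ofReal.comp (by fun_prop)
      have := hc.tendsto x
      simpa using this
  simp_rw [e]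
  have h2 := ENNReal.Tendsto.const_mul (a := 2) hlim (Or.inr (by norm_num))
  have h3 := ENNReal.Tendsto.sub (tendsto_const_nhds (x := (2 : ℝ≥0∞)) (f := 𝓝 x)) h2
    (Or.inl (by norm_num))
  simpa using h3

/-- The source of equicontinuity: the modulus depends on `h` and on the bound `c` only, not on `φ ≤
1`. -/
lemma lintegral_stepKernel_le_add_shiftDist (H : IsStepDensity h M η δ) {g : ℝ → ℝ≥0∞}
    (hg : Measurable g) {c : ℝ≥0∞} (hgc : ∀ y, g y ≤ c) {φ : ℝ → ℝ≥0∞} (hφ : Measurable φ)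
    (hφ1 : ∀ y, φ y ≤ 1) (x x' : ℝ) :
    ∫⁻ y, φ y ∂(stepKernel h g x) ≤ ∫⁻ y, φ y ∂(stepKernel h g x') + c * shiftDist h x x' := by
  have hm := H.cont.measurable
  rw [lintegral_stepKernel hm hg hφ, lintegral_stepKernel hm hg hφ, shiftDist,
    ← lintegral_const_mul _ (by fun_prop), ← lintegral_add_left (by fun_prop)]
  refine lintegral_mono fun y => ?_
  have h1 : ENNReal.ofReal (h (y - max x 0)) ≤ ENNReal.ofReal (h (y - max x' 0)) +
      ENNReal.ofReal |h (y - max x 0) - h (y - max x' 0)| := by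
    rw [← ENNReal.ofReal_add (H.nonneg _) (abs_nonneg _)]
    apply ENNReal.ofReal_le_ofReal
    linarith [le_abs_self (h (y - max x 0) - h (y - max x' 0))]
  calc g y * ENNReal.ofReal (h (y - max x 0)) * φ y
      ≤ g y * (ENNReal.ofReal (h (y - max x' 0)) +
        ENNReal.ofReal |h (y - max x 0) - h (y - max x' 0)|) * φ y := by gcongr
    _ = g y * ENNReal.ofReal (h (y - max x' 0)) * φ y +
        g y * ENNReal.ofReal |h (y - max x 0) - h (y - max x' 0)| * φ y := by ring
    _ ≤ g y * ENNReal.ofReal (h (y - max x' 0)) * φ y +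
        c * ENNReal.ofReal |h (y - max x 0) - h (y - max x' 0)| * 1 := by
        gcongr
        · exact hgc y
        · exact hφ1 y
    _ = _ := by rw [mul_one]

lemma tendsto_tail (H : IsStepDensity h M η δ) (L : ℝ) :
    Tendsto (fun x => ∫⁻ y in Set.Iic L, ENNReal.ofReal (h (y - x))) atTop (𝓝 0) := by
  have hm := H.cont.measurable
  have := tendsto_lintegral_filter_of_dominated_convergence (μ := volume) (l := atTop)
    (F := fun (x : ℝ) (t : ℝ) => (Set.Iic (L - x)).indicator (fun t => ENNReal.ofReal (h t)) t)
    (f := fun _ => 0) (fun t => ENNReal.ofReal (h t)) ?_ ?_ ?_ ?_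
  · rw [lintegral_zero] at this
    refine this.congr fun x => ?_
    rw [← lintegral_indicator measurableSet_Iic, ← lintegral_sub_right_eq_self _ x]
    refine lintegral_congr fun y => ?_
    simp only [Set.indicator_apply, Set.mem_Iic, sub_le_sub_iff_right]
  · exact Eventually.of_forall fun x => (by fun_prop : Measurable fun t =>
      ENNReal.ofReal (h t)).indicator measurableSet_Iic
  · exact Eventually.of_forall fun x => Eventually.of_forall fun t =>
      Set.indicator_le_self' (fun _ _ => zero_le) _
  · rw [H.lintegral_eq]; exact ENNReal.one_ne_top
  · refine Eventually.of_forall fun t => ?_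
    refine tendsto_const_nhds.congr' ?_
    filter_upwards [eventually_gt_atTop (L - t)] with x hx
    rw [Set.indicator_of_notMem]
    simp only [Set.mem_Iic, not_le]
    linarith

end Translation

/-! ### Generating function of the partition functions and supersolutions -/

section Green

variable {h : ℝ → ℝ} {M η δ : ℝ} {a : ℝ}

lemma pow_succ_univ (κ : Kernel ℝ ℝ) (N : ℕ) (x : ℝ) :
    (κ ^ (N + 1)) x Set.univ = ∫⁻ z, (κ ^ N) z Set.univ ∂(κ x) := by
  have e := lintegral_pow_add κ 1 N x (φ := fun _ => 1) measurable_const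
  simp only [lintegral_one, lintegral_pow_one] at e
  rw [add_comm N 1, e]

lemma pow_zero_univ (κ : Kernel ℝ ℝ) (x : ℝ) : (κ ^ 0) x Set.univ = 1 := by
  have := lintegral_pow_zero κ x (φ := fun _ => 1) measurable_const
  rwa [lintegral_one] at this

lemma measurable_pow_univ (κ : Kernel ℝ ℝ) (N : ℕ) : Measurable fun x => (κ ^ N) x Set.univ :=
  Kernel.measurable_coe _ MeasurableSet.univ

lemma gAll_pow_univ (H : IsStepDensity h M η δ) (a β l : ℝ) (N : ℕ) (x : ℝ) :
    (stepKernel h (gAll a β l) ^ N) x Set.univ =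
      ENNReal.ofReal (Real.exp (-l)) ^ N * (stepKernel h (gAll a β 0) ^ N) x Set.univ := by
  have := lintegral_gAll_pow H a β l (φ := fun _ => 1) measurable_const N x
  simpa only [lintegral_one] using this

lemma lintegral_gAll_le (H : IsStepDensity h M η δ) (a β l : ℝ) {φ : ℝ → ℝ≥0∞}
    (hφ : Measurable φ) {K : ℝ≥0∞} (hK : ∀ y, φ y ≤ K) (x : ℝ) :
    ∫⁻ y, φ y ∂(stepKernel h (gAll a β l) x) ≤
      ENNReal.ofReal (Real.exp (β - l)) * ENNReal.ofReal M * (∫⁻ y in Set.Icc 0 a, φ y) +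
        ENNReal.ofReal (Real.exp (-l)) * K := by
  rw [lintegral_gAll H a β l hφ]
  exact add_le_add (lintegral_stepKernel_indicator_le H measurableSet_Icc hφ x)
    (lintegral_stepKernel_le H (measurable_gOut a l) (gOut_le a l) hφ hK x)

/-- The source term `1` leaves room to lower the discount from `l` to `l'`: this multiplies the
integral of `u ≤ C` by `e^{l-l'}`, which adds at most `1/2`. Iterating the remaining inequality
bounds the partition functions at the smaller rate `l'`. -/
lemma partition_le_of_supersolution (H : IsStepDensity h M η δ) {β l l' C : ℝ}
    (hll : l' ≤ l) (hlC : (Real.exp (l - l') - 1) * C ≤ 1 / 2) {u : ℝ → ℝ≥0∞}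
    (hu : Measurable u)
    (huC : ∀ x, u x ≤ ENNReal.ofReal C)
    (hsup : ∀ x, 1 + ∫⁻ y, u y ∂(stepKernel h (gAll a β l) x) ≤ u x) (N : ℕ) (x : ℝ) :
    (stepKernel h (gAll a β 0) ^ N) x Set.univ ≤ ENNReal.ofReal (2 * C * Real.exp (l' * N)) := by
  have e1 : (1 : ℝ) ≤ Real.exp (l - l') := Real.one_le_exp (by linarith)
  have hscale : ∀ x, ∫⁻ y, u y ∂(stepKernel h (gAll a β l') x) =
      ENNReal.ofReal (Real.exp (l - l')) * ∫⁻ y, u y ∂(stepKernel h (gAll a β l) x) := by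
    intro x
    have h1 := lintegral_gAll_pow H a β l hu 1 x
    have h2 := lintegral_gAll_pow H a β l' hu 1 x
    rw [lintegral_pow_one, pow_one] at h1 h2
    rw [h1, h2, ← mul_assoc, ← ENNReal.ofReal_mul (Real.exp_pos _).le, ← Real.exp_add]
    congr 3
    ring
  have hhalf : ∀ x, ENNReal.ofReal (1 / 2) + ∫⁻ y, u y ∂(stepKernel h (gAll a β l') x) ≤ u x := by
    intro x
    refine le_trans ?_ (hsup x)
    rw [hscale]
    set w := ∫⁻ y, u y ∂(stepKernel h (gAll a β l) x)
    have hw : w ≤ ENNReal.ofReal C := le_trans (le_trans le_add_self (hsup x)) (huC x)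
    have e2 : ENNReal.ofReal (Real.exp (l - l')) = 1 + ENNReal.ofReal (Real.exp (l - l') - 1) := by
      rw [← ENNReal.ofReal_one, ← ENNReal.ofReal_add zero_le_one (by linarith)]
      congr 1
      ring
    have e3 : ENNReal.ofReal (Real.exp (l - l') - 1) * w ≤ ENNReal.ofReal (1 / 2) := by
      calc ENNReal.ofReal (Real.exp (l - l') - 1) * w
          ≤ ENNReal.ofReal (Real.exp (l - l') - 1) * ENNReal.ofReal C := by gcongr
        _ = ENNReal.ofReal ((Real.exp (l - l') - 1) * C) :=
            (ENNReal.ofReal_mul (by linarith)).symm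
        _ ≤ _ := ENNReal.ofReal_le_ofReal hlC
    have e4 : ENNReal.ofReal (1 / 2) + ENNReal.ofReal (1 / 2) = 1 := by
      rw [← ENNReal.ofReal_add (by norm_num) (by norm_num)]
      norm_num
    rw [e2, add_mul, one_mul, ← e4]
    calc ENNReal.ofReal (1 / 2) + (w + ENNReal.ofReal (Real.exp (l - l') - 1) * w)
        ≤ ENNReal.ofReal (1 / 2) + (w + ENNReal.ofReal (1 / 2)) := by gcongr
      _ = _ := by ring
  -- The function `u` dominates its image under the kernel with discount `l'` and dominates `1/2`,
  -- hence dominates every iterate of the constant `1/2`.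
  have hind : ∀ N x, ENNReal.ofReal (1 / 2) * (stepKernel h (gAll a β l') ^ N) x Set.univ ≤ u x := by
    intro N
    induction N with
    | zero =>
      intro x
      rw [pow_zero_univ, mul_one]
      exact le_trans le_self_add (hhalf x)
    | succ N ih =>
      intro x
      rw [pow_succ_univ, ← lintegral_const_mul _ (measurable_pow_univ _ N)]
      exact (lintegral_mono ih).trans (le_trans le_add_self (hhalf x))
  have h1 := (hind N x).trans (huC x)
  rw [gAll_pow_univ H] at h1
  have e5 : 2 * Real.exp (l' * N) * ((1 / 2) * Real.exp (-l') ^ N) = 1 := by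
    rw [← Real.exp_nat_mul]
    have : Real.exp (l' * N) * Real.exp (N * -l') = 1 := by
      rw [← Real.exp_add, ← Real.exp_zero]
      congr 1
      ring
    linarith
  calc (stepKernel h (gAll a β 0) ^ N) x Set.univ
      = ENNReal.ofReal (2 * Real.exp (l' * N)) * (ENNReal.ofReal (1 / 2) *
        (ENNReal.ofReal (Real.exp (-l')) ^ N * (stepKernel h (gAll a β 0) ^ N) x Set.univ)) := by
        rw [← ENNReal.ofReal_pow (Real.exp_pos _).le, ← mul_assoc, ← mul_assoc, mul_assoc
          (ENNReal.ofReal (2 * Real.exp (l' * N))), ← ENNReal.ofReal_mul (by norm_num),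
          ← ENNReal.ofReal_mul (by positivity), e5, ENNReal.ofReal_one, one_mul]
    _ ≤ ENNReal.ofReal (2 * Real.exp (l' * N)) * ENNReal.ofReal C := by gcongr
    _ = _ := by
        rw [← ENNReal.ofReal_mul (by positivity)]
        congr 1
        ring

/-- The generating function of the free partition functions. -/
noncomputable def green (h : ℝ → ℝ) (a β l : ℝ) (x : ℝ) : ℝ≥0∞ :=
  ∑' N : ℕ, (stepKernel h (gAll a β l) ^ N) x Set.univ

lemma measurable_green (h : ℝ → ℝ) (a β l : ℝ) : Measurable (green h a β l) :=
  Measurable.tsum fun N => measurable_pow_univ _ N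

/-- Peeling off the first step. In particular `green` is a supersolution, which is how it enters the
blow-up argument. -/
lemma green_eq (h : ℝ → ℝ) (a β l : ℝ) (x : ℝ) :
    green h a β l x = 1 + ∫⁻ y, green h a β l y ∂(stepKernel h (gAll a β l) x) := by
  unfold green
  rw [lintegral_tsum fun N => (measurable_pow_univ _ N).aemeasurable,
    tsum_eq_zero_add' ENNReal.summable, pow_zero_univ]
  simp_rw [pow_succ_univ]

end Green

/-! ### Finiteness above the free energy and blow-up at it -/

section Eigenfunction

variable {Ω : Type*} [MeasurableSpace Ω] {P : Measure Ω} [IsProbabilityMeasure P]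
  {X : ℕ → Ω → ℝ} {h : ℝ → ℝ} {M η δ : ℝ} {a : ℝ}

/-- The free energy only controls the walk started at `0`. Minorization transfers the bound to the
average over starting points in the strip. A step into the strip sees only this average, since `h`
is bounded, and a step above it has mass at most `1`, so induction over `N` gives all starting
points. -/
lemma exists_uniform_partition_le (W : IsDensityWalk P X h) (H : IsStepDensity h M η δ)
    (ha : 0 < a) (hδa : δ ≤ a) {β l : ℝ} (hl0 : 0 < l) (hl : freeEnergy P X a β < l) :
    ∃ D : ℝ, 0 < D ∧ ∀ (N : ℕ) (x : ℝ),
      (stepKernel h (gAll a β 0) ^ N) x Set.univ ≤ ENNReal.ofReal (D * Real.exp (l * N)) := by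
  obtain ⟨C, hC, hZ⟩ := exists_partition_le_exp W H ha hδa hl
  obtain ⟨m, hm, c, hc0, hct, hmin⟩ := exists_minorization_gAll H a β 0 a
  have hZ' : ∀ N : ℕ, (stepKernel h (gAll a β 0) ^ N) 0 Set.univ ≤
      ENNReal.ofReal (C * Real.exp (l * N)) := fun N => by
    have := isFiniteKernel_gAll H a β 0
    have := isFiniteKernel_pow (stepKernel h (gAll a β 0)) N
    have h1 := hZ N
    rw [Zf_eq W H ha β N, measureReal_def] at h1
    exact (ENNReal.le_ofReal_iff_toReal_le (measure_ne_top _ _) (by positivity)).2 h1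
  -- After `m` steps the walk from `0` has density at least `c` on the strip, so the average over
  -- the strip at time `N` is controlled by the partition function from `0` at time `m + N`.
  have hstrip : ∀ N : ℕ, ∫⁻ y in Set.Icc 0 a, (stepKernel h (gAll a β 0) ^ N) y Set.univ ≤
      ENNReal.ofReal (c⁻¹.toReal * (C * Real.exp (l * m)) * Real.exp (l * N)) := fun N => by
    have h1 := hmin _ (measurable_pow_univ (stepKernel h (gAll a β 0)) N) 0 ha.le
    have h2 := lintegral_pow_add (stepKernel h (gAll a β 0)) m N 0 (φ := fun _ => 1)
      measurable_const
    simp only [lintegral_one] at h2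
    rw [← h2] at h1
    have h3 := h1.trans (hZ' (m + N))
    calc ∫⁻ y in Set.Icc 0 a, (stepKernel h (gAll a β 0) ^ N) y Set.univ
        = c⁻¹ * (c * ∫⁻ y in Set.Icc 0 a, (stepKernel h (gAll a β 0) ^ N) y Set.univ) := by
          rw [← mul_assoc, ENNReal.inv_mul_cancel hc0 hct, one_mul]
      _ ≤ c⁻¹ * ENNReal.ofReal (C * Real.exp (l * (m + N : ℕ))) := by gcongr
      _ = _ := by
          rw [← ENNReal.ofReal_toReal (ENNReal.inv_ne_top.2 hc0),
            ← ENNReal.ofReal_mul ENNReal.toReal_nonneg]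
          congr 1
          push_cast
          rw [mul_add, Real.exp_add, ENNReal.ofReal_toReal (ENNReal.inv_ne_top.2 hc0)]
          ring
  set B := Real.exp β * M * (c⁻¹.toReal * (C * Real.exp (l * m))) with hB
  have hM := H.M_pos
  have hB0 : 0 ≤ B := by
    have := ENNReal.toReal_nonneg (a := c⁻¹)
    positivity
  have hel : 0 < Real.exp l - 1 := by linarith [Real.add_one_lt_exp hl0.ne']
  -- The induction needs `B + D ≤ D * exp l`, which can be solved because `l > 0`.
  set D := 1 + B / (Real.exp l - 1) with hD
  have hD0 : 0 < D := by positivity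
  have hDB : B ≤ D * (Real.exp l - 1) := by
    rw [hD, add_mul, div_mul_cancel₀ _ hel.ne']
    linarith
  refine ⟨D, hD0, fun N => ?_⟩
  induction N with
  | zero =>
    intro x
    rw [pow_zero_univ, ← ENNReal.ofReal_one]
    apply ENNReal.ofReal_le_ofReal
    have : 0 ≤ B / (Real.exp l - 1) := by positivity
    simp only [Nat.cast_zero, mul_zero, Real.exp_zero, mul_one]
    linarith
  | succ N ih =>
    intro x
    rw [pow_succ_univ]
    refine (lintegral_gAll_le H a β 0 (measurable_pow_univ _ N) ih x).trans ?_
    have h1 := hstrip N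
    simp only [sub_zero, neg_zero, Real.exp_zero, ENNReal.ofReal_one, one_mul]
    calc ENNReal.ofReal (Real.exp β) * ENNReal.ofReal M *
          (∫⁻ y in Set.Icc 0 a, (stepKernel h (gAll a β 0) ^ N) y Set.univ) +
          ENNReal.ofReal (D * Real.exp (l * N))
        ≤ ENNReal.ofReal (Real.exp β) * ENNReal.ofReal M *
          ENNReal.ofReal (c⁻¹.toReal * (C * Real.exp (l * m)) * Real.exp (l * N)) +
          ENNReal.ofReal (D * Real.exp (l * N)) := by gcongr
      _ = ENNReal.ofReal (B * Real.exp (l * N) + D * Real.exp (l * N)) := by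
          rw [← ENNReal.ofReal_mul (by positivity), ← ENNReal.ofReal_mul (by positivity),
            ← ENNReal.ofReal_add _ (by positivity)]
          · congr 2
            rw [hB]; ring
          · have := ENNReal.toReal_nonneg (a := c⁻¹)
            positivity
      _ ≤ _ := by
          apply ENNReal.ofReal_le_ofReal
          push_cast
          rw [mul_add, mul_one, Real.exp_add]
          nlinarith [Real.exp_pos (l * N)]

/-- With a rate `l'` strictly between the free energy and `l`, the series is dominated by a
geometric one. -/
lemma exists_green_le (W : IsDensityWalk P X h) (H : IsStepDensity h M η δ)
    (ha : 0 < a) (hδa : δ ≤ a) {β l : ℝ} (hl0 : 0 < freeEnergy P X a β)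
    (hl : freeEnergy P X a β < l) : ∃ C : ℝ, ∀ x, green h a β l x ≤ ENNReal.ofReal C := by
  obtain ⟨l', hl1, hl2⟩ := exists_between hl
  obtain ⟨D, hD, hb⟩ := exists_uniform_partition_le W H ha hδa (hl0.trans hl1) hl1
  have hr : Real.exp (l' - l) < 1 := Real.exp_lt_one_iff.2 (by linarith)
  refine ⟨D * (1 - Real.exp (l' - l))⁻¹, fun x => ?_⟩
  have hs : HasSum (fun N : ℕ => D * Real.exp (l' - l) ^ N) (D * (1 - Real.exp (l' - l))⁻¹) :=
    (hasSum_geometric_of_lt_one (Real.exp_pos _).le hr).mul_left D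
  rw [← hs.tsum_eq, ENNReal.ofReal_tsum_of_nonneg (fun N => by positivity) hs.summable]
  refine ENNReal.tsum_le_tsum fun N => ?_
  rw [gAll_pow_univ H, ← ENNReal.ofReal_pow (Real.exp_pos _).le]
  calc ENNReal.ofReal (Real.exp (-l) ^ N) * (stepKernel h (gAll a β 0) ^ N) x Set.univ
      ≤ ENNReal.ofReal (Real.exp (-l) ^ N) * ENNReal.ofReal (D * Real.exp (l' * N)) := by
        gcongr
        exact hb N x
    _ = _ := by
        rw [← ENNReal.ofReal_mul (by positivity)]
        congr 1
        rw [sub_eq_add_neg, Real.exp_add, mul_pow, ← Real.exp_nat_mul l', mul_comm (N : ℝ) l']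
        ring

/-- The generating function blows up at the free energy. -/
lemma green_blowup (W : IsDensityWalk P X h) (H : IsStepDensity h M η δ)
    (ha : 0 < a) (hδa : δ ≤ a) (β C : ℝ) (hC : 0 < C) :
    ∃ l₀ > freeEnergy P X a β, ∀ l < l₀, freeEnergy P X a β < l →
      ∃ x, ENNReal.ofReal C < green h a β l x := by
  set F := freeEnergy P X a β with hF
  -- The width `d` is chosen such that a bound `C` on the generating function at some `l < F + d`
  -- would allow the discount to be lowered to `F - d`, a drop of less than `2 * d`. This
  -- contradicts the definition of `F`.
  have hcont : Tendsto (fun d : ℝ => (Real.exp (2 * d) - 1) * C) (𝓝[>] 0) (𝓝 0) := by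
    have : Continuous fun d : ℝ => (Real.exp (2 * d) - 1) * C := by fun_prop
    have h1 := this.tendsto 0
    simp only [mul_zero, Real.exp_zero, sub_self, zero_mul] at h1
    exact h1.mono_left nhdsWithin_le_nhds
  obtain ⟨d, hd1, hd2⟩ := ((hcont.eventually_lt_const (by norm_num : (0 : ℝ) < 1 / 2)).and
    self_mem_nhdsWithin).exists
  have hd0 : 0 < d := hd2
  refine ⟨F + d, by linarith, fun l hl hFl => ?_⟩
  by_contra hcon
  push Not at hcon
  have hexp : Real.exp (l - (F - d)) ≤ Real.exp (2 * d) := Real.exp_le_exp.2 (by linarith)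
  have hZ := partition_le_of_supersolution H (a := a) (β := β) (l := l) (l' := F - d)
    (by linarith) (by nlinarith) (measurable_green h a β l) hcon (fun x => (green_eq h a β l x).ge)
  have h1 := freeEnergy_le W H ha hδa (β := β) (l := F - d) (C := 2 * C) (by positivity) fun N => by
    rw [Zf_eq W H ha β N, measureReal_def]
    exact ENNReal.toReal_le_of_le_ofReal (by positivity) (hZ N 0)
  rw [← hF] at h1
  linarith

end Eigenfunction

/-! ### Construction of a bounded harmonic function at the free energy -/

section Eigenfunction

variable {Ω : Type*} [MeasurableSpace Ω] {P : Measure Ω} [IsProbabilityMeasure P]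
  {X : ℕ → Ω → ℝ} {h : ℝ → ℝ} {M η δ : ℝ} {a : ℝ}

/-- Normalized generating functions are approximate harmonic functions. -/
lemma exists_approx_harmonic (W : IsDensityWalk P X h) (H : IsStepDensity h M η δ)
    (ha : 0 < a) (hδa : δ ≤ a) {β : ℝ} (hF : 0 < freeEnergy P X a β) (n : ℕ) :
    ∃ (l : ℝ) (τ : ℝ≥0∞) (u : ℝ → ℝ≥0∞), freeEnergy P X a β < l ∧
      l < freeEnergy P X a β + 1 / ((n : ℝ) + 1) ∧ τ ≤ ((n : ℝ≥0∞) + 1)⁻¹ ∧ Measurable u ∧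
      (∀ x, u x ≤ 1) ∧ (∀ x, u x = τ + ∫⁻ y, u y ∂(stepKernel h (gAll a β l) x)) ∧
      1 ≤ τ + (ENNReal.ofReal (Real.exp (β - freeEnergy P X a β)) * ENNReal.ofReal M *
        (∫⁻ y in Set.Icc 0 a, u y) + ENNReal.ofReal (Real.exp (-freeEnergy P X a β))) := by
  set F := freeEnergy P X a β with hFdef
  obtain ⟨l₀, hl₀, hblow⟩ := green_blowup W H ha hδa β ((n : ℝ) + 1) (by positivity)
  have hpos : (0 : ℝ) < 1 / ((n : ℝ) + 1) := by positivity
  obtain ⟨l, hl1, hl2⟩ := exists_between (lt_min hl₀ (by linarith : F < F + 1 / ((n : ℝ) + 1)))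
  obtain ⟨x₁, hx₁⟩ := hblow l (hl2.trans_le (min_le_left _ _)) hl1
  obtain ⟨C, hC⟩ := exists_green_le W H ha hδa hF hl1
  -- Dividing by the supremum turns the source term `1` into `s⁻¹ ≤ (n + 1)⁻¹`, which disappears in
  -- the limit.
  set s := ⨆ x, green h a β l x with hs
  have hst : s ≠ ∞ := ne_top_of_le_ne_top ENNReal.ofReal_ne_top (iSup_le hC)
  have hle : ∀ x, green h a β l x ≤ s := fun x => le_iSup (green h a β l) x
  have hsn : (n : ℝ≥0∞) + 1 ≤ s := by
    have h1 := (hx₁.le).trans (hle x₁)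
    rwa [ENNReal.ofReal_add (by positivity) zero_le_one, ENNReal.ofReal_natCast,
      ENNReal.ofReal_one] at h1
  have hs0 : s ≠ 0 := fun h0 => by simp [h0] at hsn
  have hm := measurable_green h a β l
  have hgs : ∀ x, s⁻¹ * green h a β l x =
      s⁻¹ + ∫⁻ y, s⁻¹ * green h a β l y ∂(stepKernel h (gAll a β l) x) := fun x => by
    rw [lintegral_const_mul _ hm]
    nth_rewrite 1 [green_eq]
    rw [mul_add, mul_one]
  have hg1 : ∀ x, s⁻¹ * green h a β l x ≤ 1 := fun x => by
    calc s⁻¹ * green h a β l x ≤ s⁻¹ * s := by gcongr; exact hle x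
      _ = 1 := ENNReal.inv_mul_cancel hs0 hst
  refine ⟨l, s⁻¹, fun x => s⁻¹ * green h a β l x, hl1, hl2.trans_le (min_le_right _ _),
    ENNReal.inv_le_inv.2 hsn, hm.const_mul _, hg1, hgs, ?_⟩
  -- The normalized function has supremum `1`. Bounding it by its first-step decomposition shows
  -- that its integral over the strip cannot be small unless `e^{-F}` is close to `1`.
  have hsup : (⨆ x, s⁻¹ * green h a β l x) = 1 := by
    rw [← ENNReal.mul_iSup, ← hs, ENNReal.inv_mul_cancel hs0 hst]
  rw [← hsup]
  refine iSup_le fun x => ?_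
  rw [hgs x]
  refine add_le_add le_rfl ((lintegral_gAll_le H a β l (hm.const_mul _) hg1 x).trans ?_)
  rw [mul_one]
  gcongr

/-- Existence of a bounded harmonic function for the discounted model. -/
lemma exists_harmonic (W : IsDensityWalk P X h) (H : IsStepDensity h M η δ)
    (ha : 0 < a) (hδa : δ ≤ a) {β : ℝ} (hF : 0 < freeEnergy P X a β) :
    ∃ V : ℝ → ℝ≥0∞, Measurable V ∧ (∀ x, V x ≤ 1) ∧
      (∀ x, V x = ∫⁻ y, V y ∂(stepKernel h (gAll a β (freeEnergy P X a β)) x)) ∧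
      ∫⁻ y in Set.Icc 0 a, V y ≠ 0 := by
  choose l τ u hl1 hl2 hτ hum hu1 hu hnorm using exists_approx_harmonic W H ha hδa hF
  set F := freeEnergy P X a β with hFdef
  have hut : ∀ n x, u n x ≠ ∞ := fun n x => ne_top_of_le_ne_top ENNReal.one_ne_top (hu1 n x)
  have hτlim : Tendsto τ atTop (𝓝 0) := by
    have h1 : Tendsto (fun n : ℕ => ((n : ℝ≥0∞) + 1)⁻¹) atTop (𝓝 0) := by
      have := ENNReal.tendsto_inv_nat_nhds_zero.comp (tendsto_add_atTop_nat 1)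
      refine this.congr fun n => ?_
      simp
    exact tendsto_of_tendsto_of_tendsto_of_le_of_le tendsto_const_nhds h1 (fun _ => zero_le) hτ
  have hllim : Tendsto l atTop (𝓝 F) := by
    have h1 : Tendsto (fun n : ℕ => F + 1 / ((n : ℝ) + 1)) atTop (𝓝 F) := by
      simpa using tendsto_one_div_add_atTop_nhds_zero_nat.const_add F
    exact tendsto_of_tendsto_of_tendsto_of_le_of_le tendsto_const_nhds h1
      (fun n => (hl1 n).le) (fun n => (hl2 n).le)
  set G : ℝ≥0∞ := ENNReal.ofReal (Real.exp β) + 1 with hG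
  have hGt : G ≠ ∞ := ENNReal.add_ne_top.2 ⟨ENNReal.ofReal_ne_top, ENNReal.one_ne_top⟩
  have hgG : ∀ n y, gAll a β (l n) y ≤ G := fun n y => by
    have h0 : 0 < l n := hF.trans (hl1 n)
    refine (gAll_le a β (l n) y).trans (add_le_add ?_ ?_)
    · exact ENNReal.ofReal_le_ofReal (Real.exp_le_exp.2 (by linarith))
    · rw [← ENNReal.ofReal_one]
      exact ENNReal.ofReal_le_ofReal (Real.exp_le_one_iff.2 (by linarith))
  -- The modulus of continuity does not depend on `n`: it is that of the translates of `h`,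
  -- multiplied by the uniform weight bound `G`.
  have hequi : ∀ n x x', u n x ≤ u n x' + G * shiftDist h x x' := fun n x x' => by
    rw [hu n x, hu n x', add_assoc]
    gcongr
    exact lintegral_stepKernel_le_add_shiftDist H (measurable_gAll a β (l n)) (hgG n) (hum n)
      (hu1 n) x x'
  have hshift : ∀ x, ∀ e > (0 : ℝ), ∀ᶠ x' in 𝓝 x, G * shiftDist h x' x ≤ ENNReal.ofReal e := by
    intro x e he
    have h1 := ENNReal.Tendsto.const_mul (a := G) (tendsto_shiftDist H x) (Or.inr hGt)
    rw [mul_zero] at h1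
    exact (h1.eventually_lt_const (ENNReal.ofReal_pos.2 he)).mono fun _ hx => hx.le
  have hreal : ∀ n x x' e, 0 < e → G * shiftDist h x x' ≤ ENNReal.ofReal e →
      (u n x).toReal ≤ (u n x').toReal + e := by
    intro n x x' e he hG
    rw [← ENNReal.toReal_ofReal he.le, ← ENNReal.toReal_add (hut n x') ENNReal.ofReal_ne_top]
    refine ENNReal.toReal_mono (ENNReal.add_ne_top.2 ⟨hut n x', ENNReal.ofReal_ne_top⟩) ?_
    refine (hequi n x x').trans ?_
    gcongr
  obtain ⟨s, hs, V, hV⟩ := exists_subseq_tendsto (f := fun n x => (u n x).toReal)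
    (fun n x => ⟨ENNReal.toReal_nonneg,
      ENNReal.toReal_le_of_le_ofReal zero_le_one (by simpa using hu1 n x)⟩)
    (fun x e he => by
      filter_upwards [hshift x e he] with x' hx' n
      have h1 := hreal n x' x e he hx'
      have h2 := hreal n x x' e he (by rwa [shiftDist_comm])
      rw [abs_le]
      constructor <;> linarith)
  have hVlim : ∀ x, Tendsto (fun n => u (s n) x) atTop (𝓝 (ENNReal.ofReal (V x))) := fun x => by
    refine (ENNReal.tendsto_ofReal (hV x)).congr fun n => ?_
    exact ENNReal.ofReal_toReal (hut _ x)
  have hVm : Measurable fun x => ENNReal.ofReal (V x) :=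
    measurable_of_tendsto_metrizable (fun n => hum (s n)) (tendsto_pi_nhds.2 hVlim)
  have hDCT : ∀ (μ : Measure ℝ) [IsFiniteMeasure μ],
      Tendsto (fun n => ∫⁻ y, u (s n) y ∂μ) atTop (𝓝 (∫⁻ y, ENNReal.ofReal (V y) ∂μ)) := by
    intro μ _
    refine tendsto_lintegral_of_dominated_convergence (fun _ => 1) (fun n => hum (s n))
      (fun n => Eventually.of_forall (hu1 (s n))) (by simp)
      (Eventually.of_forall fun y => hVlim y)
  refine ⟨fun x => ENNReal.ofReal (V x), hVm, fun x => le_of_tendsto' (hVlim x) fun n => hu1 _ x,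
    fun x => ?_, fun h0 => ?_⟩
  · refine tendsto_nhds_unique (hVlim x) ?_
    have := isFiniteKernel_gAll H a β 0
    have hone : ∀ l, ∀ φ : ℝ → ℝ≥0∞, Measurable φ → ∫⁻ y, φ y ∂(stepKernel h (gAll a β l) x) =
        ENNReal.ofReal (Real.exp (-l)) * ∫⁻ y, φ y ∂(stepKernel h (gAll a β 0) x) := by
      intro l φ hφ
      have h1 := lintegral_gAll_pow H a β l hφ 1 x
      rwa [lintegral_pow_one, pow_one, lintegral_pow_one] at h1
    have h2 : Tendsto (fun n => ENNReal.ofReal (Real.exp (-l (s n)))) atTop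
        (𝓝 (ENNReal.ofReal (Real.exp (-F)))) :=
      ENNReal.tendsto_ofReal ((Real.continuous_exp.tendsto _).comp
        (hllim.comp hs.tendsto_atTop).neg)
    have h3 := ENNReal.Tendsto.mul h2 (Or.inr (ne_top_of_le_ne_top
      (measure_ne_top (stepKernel h (gAll a β 0) x) Set.univ) ?_)) (hDCT (stepKernel h (gAll a β 0) x))
      (Or.inr ENNReal.ofReal_ne_top)
    · have h4 := (hτlim.comp hs.tendsto_atTop).add h3
      rw [zero_add, ← hone F _ hVm] at h4
      refine h4.congr fun n => ?_
      rw [hu (s n) x, hone (l (s n)) _ (hum _), Function.comp_apply]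
    · calc ∫⁻ y, ENNReal.ofReal (V y) ∂(stepKernel h (gAll a β 0) x)
          ≤ ∫⁻ _, 1 ∂(stepKernel h (gAll a β 0) x) :=
            lintegral_mono fun y => le_of_tendsto' (hVlim y) fun n => hu1 _ y
        _ = _ := lintegral_one
  -- If the limit vanished almost everywhere on the strip, the normalization would pass to the limit
  -- as `1 ≤ e^{-F}`, which contradicts `F > 0`.
  · have h1 := hDCT (volume.restrict (Set.Icc 0 a))
    rw [h0] at h1
    have hcc : ENNReal.ofReal (Real.exp (β - F)) * ENNReal.ofReal M ≠ ∞ :=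
      ENNReal.mul_ne_top ENNReal.ofReal_ne_top ENNReal.ofReal_ne_top
    have h2 := (hτlim.comp hs.tendsto_atTop).add
      ((ENNReal.Tendsto.const_mul h1 (Or.inr hcc)).add_const (ENNReal.ofReal (Real.exp (-F))))
    rw [mul_zero, zero_add, zero_add] at h2
    have h3 := ge_of_tendsto' h2 fun n => hnorm (s n)
    rw [← ENNReal.ofReal_one, ENNReal.ofReal_le_ofReal_iff (Real.exp_pos _).le] at h3
    have : Real.exp (-F) < 1 := Real.exp_lt_one_iff.2 (by linarith)
    linarith

end Eigenfunction

/-! ### Lower bound and decay of the harmonic function, and the convergence theorem -/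

section Harmonic

variable {h : ℝ → ℝ} {M η δ : ℝ} {a : ℝ}

lemma harmonic_pow {κ : Kernel ℝ ℝ} {V : ℝ → ℝ≥0∞} (hVm : Measurable V)
    (hV : ∀ x, V x = ∫⁻ y, V y ∂(κ x)) (n : ℕ) (x : ℝ) :
    ∫⁻ y, V y ∂((κ ^ n) x) = V x := by
  induction n with
  | zero => exact lintegral_pow_zero κ x hVm
  | succ n ih =>
    rw [lintegral_pow_add κ n 1 x hVm, ← ih]
    exact lintegral_congr fun z => by rw [lintegral_pow_one, ← hV]

/-- `V` is its own integral under a power of the kernel, and that power dominates Lebesgue measure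
on a bounded set containing the strip. -/
lemma harmonic_lower (H : IsStepDensity h M η δ) {β l : ℝ} {V : ℝ → ℝ≥0∞} (hVm : Measurable V)
    (hV : ∀ x, V x = ∫⁻ y, V y ∂(stepKernel h (gAll a β l) x))
    (hV0 : ∫⁻ y in Set.Icc 0 a, V y ≠ 0) (L : ℝ) :
    ∃ c : ℝ≥0∞, c ≠ 0 ∧ ∀ x ≤ L, c ≤ V x := by
  obtain ⟨m, -, c, hc0, hct, hmin⟩ := exists_minorization_gAll H a β l (max L a)
  refine ⟨c * ∫⁻ y in Set.Icc 0 a, V y, mul_ne_zero hc0 hV0, fun x hx => ?_⟩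
  rw [← harmonic_pow hVm hV m x]
  refine le_trans ?_ (hmin V hVm x (hx.trans (le_max_left _ _)))
  gcongr
  exact le_max_right L a

/-- From far away, a step either stays high, at the cost of the factor `α = e^{-l} < 1`, or falls
below a fixed level, which has small probability. Hence a bound `γ ^ k` near infinity improves to `γ
^ (k + 1)` further out, for a fixed `γ` between `α` and `1`. -/
lemma harmonic_decay (H : IsStepDensity h M η δ) {β l : ℝ} (hl : 0 < l) {V : ℝ → ℝ≥0∞}
    (hVm : Measurable V) (hV1 : ∀ x, V x ≤ 1)
    (hV : ∀ x, V x = ∫⁻ y, V y ∂(stepKernel h (gAll a β l) x)) {e : ℝ} (he : 0 < e) :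
    ∃ L, ∀ x, L < x → V x ≤ ENNReal.ofReal e := by
  set α := Real.exp (-l) with hα
  have hα0 : 0 < α := Real.exp_pos _
  have hα1 : α < 1 := Real.exp_lt_one_iff.2 (by linarith)
  set γ := (1 + α) / 2 with hγ
  have hγ1 : γ < 1 := by rw [hγ]; linarith
  have hγα : α < γ := by rw [hγ]; linarith
  have hγ0 : 0 < γ := hα0.trans hγα
  have key : ∀ k : ℕ, ∃ L, ∀ x, L < x → V x ≤ ENNReal.ofReal (γ ^ k) := by
    intro k
    induction k with
    | zero => exact ⟨0, fun x _ => by simpa using hV1 x⟩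
    | succ k ih =>
      obtain ⟨L₀, hL₀⟩ := ih
      set L := max L₀ a with hL
      set c : ℝ≥0∞ := ENNReal.ofReal (Real.exp (β - l)) + ENNReal.ofReal (Real.exp (-l)) with hc
      have hct : c ≠ ∞ := ENNReal.add_ne_top.2 ⟨ENNReal.ofReal_ne_top, ENNReal.ofReal_ne_top⟩
      have hlim := ENNReal.Tendsto.const_mul (a := c) (tendsto_tail H L) (Or.inr hct)
      rw [mul_zero] at hlim
      have hgap : 0 < γ ^ k * (γ - α) := mul_pos (pow_pos hγ0 k) (by linarith)
      obtain ⟨L₁, hL₁⟩ := eventually_atTop.1 (hlim.eventually_lt_const (ENNReal.ofReal_pos.2 hgap))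
      refine ⟨max L₁ 0, fun x hx => ?_⟩
      have hx0 : 0 ≤ x := ((le_max_right _ _).trans_lt hx).le
      have hx1 : L₁ ≤ x := ((le_max_left _ _).trans_lt hx).le
      rw [hV x, lintegral_stepKernel H.cont.measurable (measurable_gAll a β l) hVm,
        max_eq_left hx0]
      have hm := H.cont.measurable
      calc ∫⁻ y, gAll a β l y * ENNReal.ofReal (h (y - x)) * V y
          ≤ ∫⁻ y, (ENNReal.ofReal (α * γ ^ k) * ENNReal.ofReal (h (y - x)) +
            (Set.Iic L).indicator (fun y => c * ENNReal.ofReal (h (y - x))) y) := by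
            refine lintegral_mono fun y => ?_
            dsimp only
            rcases le_or_gt y L with hy | hy
            · rw [Set.indicator_of_mem (show y ∈ Set.Iic L from hy)]
              refine le_trans ?_ le_add_self
              calc gAll a β l y * ENNReal.ofReal (h (y - x)) * V y
                  ≤ c * ENNReal.ofReal (h (y - x)) * 1 := by
                    gcongr
                    · exact gAll_le a β l y
                    · exact hV1 y
                _ = _ := mul_one _
            · refine le_trans ?_ le_self_add
              have hya : a < y := (le_max_right _ _).trans_lt hy
              have e1 : gAll a β l y = ENNReal.ofReal α := by
                rw [gAll, gIn, gOut, Set.indicator_of_notMem (fun hE => absurd hE.2 (not_le.2 hya)),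
                  Set.indicator_of_mem (show y ∈ Set.Ioi a from hya), zero_add]
              rw [e1, ENNReal.ofReal_mul hα0.le]
              calc ENNReal.ofReal α * ENNReal.ofReal (h (y - x)) * V y
                  ≤ ENNReal.ofReal α * ENNReal.ofReal (h (y - x)) * ENNReal.ofReal (γ ^ k) := by
                    gcongr
                    exact hL₀ y ((le_max_left _ _).trans_lt hy)
                _ = _ := by ring
        _ = ENNReal.ofReal (α * γ ^ k) + c * ∫⁻ y in Set.Iic L, ENNReal.ofReal (h (y - x)) := by
            rw [lintegral_add_left (by fun_prop), lintegral_const_mul _ (by fun_prop),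
              H.lintegral_shift, mul_one, lintegral_indicator measurableSet_Iic,
              lintegral_const_mul _ (by fun_prop)]
        _ ≤ ENNReal.ofReal (α * γ ^ k) + ENNReal.ofReal (γ ^ k * (γ - α)) := by
            gcongr
            exact (hL₁ x hx1).le
        _ = ENNReal.ofReal (γ ^ (k + 1)) := by
            rw [← ENNReal.ofReal_add (by positivity) hgap.le]
            congr 1
            ring
  obtain ⟨k, hk⟩ := exists_pow_lt_of_lt_one he hγ1
  obtain ⟨L, hL⟩ := key k
  exact ⟨L, fun x hx => (hL x hx).trans (ENNReal.ofReal_le_ofReal hk.le)⟩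

/-- A bounded harmonic function turns the discounted model into a uniformly ergodic chain. -/
theorem exists_rankOneLimit_of_harmonic (H : IsStepDensity h M η δ) {β l : ℝ}
    (hl : 0 < l) {V : ℝ → ℝ≥0∞} (hVm : Measurable V) (hV1 : ∀ x, V x ≤ 1)
    (hV : ∀ x, V x = ∫⁻ y, V y ∂(stepKernel h (gAll a β l) x))
    (hV0 : ∫⁻ y in Set.Icc 0 a, V y ≠ 0) :
    ∃ Λ ε, RankOneLimit (stepKernel h (gAll a β l)) V Λ ε := by
  have := isFiniteKernel_gAll H a β l
  set κ := stepKernel h (gAll a β l) with hκ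
  have hVt : ∀ x, V x ≠ ∞ := fun x => ne_top_of_le_ne_top ENNReal.one_ne_top (hV1 x)
  have hVpos : ∀ x, 0 < (V x).toReal := fun x => by
    obtain ⟨c, hc0, hc⟩ := harmonic_lower H hVm hV hV0 x
    exact ENNReal.toReal_pos (fun h0 => hc0 (le_antisymm ((hc x le_rfl).trans h0.le) zero_le)) (hVt x)
  have hint : ∀ μ : Measure ℝ, ∫ y, (V y).toReal ∂μ = (∫⁻ y, V y ∂μ).toReal := fun μ =>
    integral_toReal hVm.aemeasurable (Eventually.of_forall fun y => (hVt y).lt_top)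
  obtain ⟨c, hc0, hc⟩ := harmonic_lower H hVm hV hV0 a
  have hct : c ≠ ∞ := ne_top_of_le_ne_top (hVt a) (hc a le_rfl)
  -- For the drift, steps above the strip have mass at most `e^{-l}`, and steps into the strip have
  -- mass at most `c⁻¹ * V x` because `V ≥ c` there.
  have hHarris : HarrisStep κ (fun x => (V x).toReal) (Real.exp (-l)) c⁻¹.toReal := by
    refine ⟨hVm.ennreal_toReal, hVpos, fun x => ?_, fun x => ?_, (Real.exp_pos _).le,
      Real.exp_lt_one_iff.2 (by linarith), ENNReal.toReal_nonneg, fun x => ?_⟩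
    · exact ENNReal.toReal_le_of_le_ofReal zero_le_one (by simpa using hV1 x)
    · rw [hint, ← hV x]
    · have h1 : κ x Set.univ ≤ ENNReal.ofReal (Real.exp (-l)) + c⁻¹ * V x := by
        have h2 := lintegral_gAll H a β l (φ := fun _ => 1) measurable_const x
        simp only [lintegral_one] at h2
        rw [hκ, h2, add_comm]
        refine add_le_add (stepKernel_univ_le H (measurable_gOut a l) (gOut_le a l) x) ?_
        have h3 : c * stepKernel h (gIn a β l) x Set.univ ≤ V x := by
          rw [hV x, lintegral_gAll H a β l hVm, ← lintegral_one, ← lintegral_const_mul _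
            measurable_const]
          refine le_trans ?_ le_self_add
          rw [lintegral_stepKernel H.cont.measurable (measurable_gIn a β l) (by fun_prop),
            lintegral_stepKernel H.cont.measurable (measurable_gIn a β l) hVm]
          refine lintegral_mono fun y => ?_
          by_cases hy : y ∈ Set.Icc 0 a
          · dsimp only
            gcongr
            rw [mul_one]
            exact hc y hy.2
          · simp [gIn, hy]
        calc stepKernel h (gIn a β l) x Set.univ
            = c⁻¹ * (c * stepKernel h (gIn a β l) x Set.univ) := by
              rw [← mul_assoc, ENNReal.inv_mul_cancel hc0 hct, one_mul]
          _ ≤ _ := by gcongr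
      have ht : c⁻¹ * V x ≠ ∞ := ENNReal.mul_ne_top (ENNReal.inv_ne_top.2 hc0) (hVt x)
      have h4 := ENNReal.toReal_mono (ENNReal.add_ne_top.2 ⟨ENNReal.ofReal_ne_top, ht⟩) h1
      rwa [ENNReal.toReal_add ENNReal.ofReal_ne_top ht, ENNReal.toReal_mul,
        ENNReal.toReal_ofReal (Real.exp_pos _).le] at h4
  obtain ⟨Λ, ε, hΛ⟩ := hHarris.exists_rankOneLimit (κ := κ) (fun R => by
    -- The threshold is such that `1 ≤ R * V x` fails beyond `L₀`. So the condition confines `x` to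
    -- `x ≤ L`, where minorization holds.
    obtain ⟨L₀, hL₀⟩ := harmonic_decay H hl hVm hV1 hV (e := 1 / (2 * (|R| + 1))) (by positivity)
    set L := max L₀ a with hL
    obtain ⟨m, hm, c₀, hc₀, hct₀, hmin⟩ := exists_minorization_gAll H a β l L
    refine ⟨m, c₀ • volume.restrict (Set.Icc 0 L), hm, ?_, ?_, fun x hx => ?_⟩
    · exact Measure.smul_finite _ hct₀
    · rw [hint, lintegral_smul_measure, smul_eq_mul]
      refine ENNReal.toReal_pos (mul_ne_zero hc₀ fun h0 => hV0 ?_) (ENNReal.mul_ne_top hct₀ ?_)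
      · refine le_antisymm (le_trans (lintegral_mono_set ?_) h0.le) zero_le
        exact Set.Icc_subset_Icc le_rfl (le_max_right _ _)
      · refine ne_top_of_le_ne_top (b := ∫⁻ _ in Set.Icc 0 L, 1) ?_ (lintegral_mono hV1)
        rw [lintegral_one]
        exact measure_ne_top _ _
    · have hxL : x ≤ L := by
        by_contra hcon
        push Not at hcon
        have h1 := ENNReal.toReal_le_of_le_ofReal (by positivity)
          (hL₀ x ((le_max_left _ _).trans_lt hcon))
        have h2 : R * (V x).toReal ≤ |R| * (1 / (2 * (|R| + 1))) :=
          mul_le_mul (le_abs_self R) h1 (hVpos x).le (abs_nonneg _)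
        have h3 : |R| * (1 / (2 * (|R| + 1))) < 1 := by
          rw [mul_one_div, div_lt_one (by positivity)]
          linarith [abs_nonneg R]
        linarith
      refine Measure.le_intro fun s hs _ => ?_
      have := hmin (s.indicator fun _ => 1) (measurable_const.indicator hs) x hxL
      rw [lintegral_indicator_const hs, lintegral_indicator_const hs, one_mul, one_mul] at this
      simpa using this)
  refine ⟨Λ, ε, ?_⟩
  simpa only [ENNReal.ofReal_toReal (hVt _)] using hΛ

end Harmonic

/-! ### Integral operators on `L²` of the strip and their spectral radius -/

section Spectral

variable {a : ℝ} {K : Kernel ℝ ℝ} {D : ℝ≥0∞}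

lemma absolutelyContinuous_of_le_smul (hKD : ∀ x, K x ≤ D • volume.restrict (Set.Icc 0 a)) (x : ℝ) :
    K x ≪ volume.restrict (Set.Icc 0 a) :=
  Measure.absolutelyContinuous_of_le_smul (hKD x)

lemma isFiniteKernel_of_le_smul (hD : D ≠ ∞)
    (hKD : ∀ x, K x ≤ D • volume.restrict (Set.Icc 0 a)) : IsFiniteKernel K := by
  refine ⟨D * ENNReal.ofReal a, ENNReal.mul_lt_top hD.lt_top ENNReal.ofReal_lt_top, fun x => ?_⟩
  refine (hKD x Set.univ).trans_eq ?_
  rw [Measure.smul_apply, Measure.restrict_apply_univ, Real.volume_Icc, sub_zero, smul_eq_mul]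

lemma integrable_Lp (f : L2Strip a) : Integrable f (volume.restrict (Set.Icc 0 a)) :=
  (Lp.memLp f).integrable (by norm_num)

lemma integrable_Lp_kernel (hD : D ≠ ∞) (hKD : ∀ x, K x ≤ D • volume.restrict (Set.Icc 0 a))
    (f : L2Strip a) (x : ℝ) : Integrable f (K x) :=
  (integrable_Lp f).of_measure_le_smul hD (hKD x)

/-- Domination by Lebesgue measure on a bounded interval and Cauchy-Schwarz: the kernel maps `L²`
boundedly into bounded functions, uniformly at every point. -/
lemma norm_integral_kernel_le (hD : D ≠ ∞)
    (hKD : ∀ x, K x ≤ D • volume.restrict (Set.Icc 0 a)) :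
    ∃ C : ℝ, 0 ≤ C ∧ ∀ (f : L2Strip a) (x : ℝ), ‖∫ y, f y ∂(K x)‖ ≤ C * ‖f‖ := by
  set μ := volume.restrict (Set.Icc 0 a) with hμ
  set c : ℝ≥0∞ := D * (μ Set.univ) ^ (1 / 2 : ℝ) with hc
  have hct : c ≠ ∞ := ENNReal.mul_ne_top hD
    (ENNReal.rpow_ne_top_of_nonneg (by norm_num) (measure_ne_top _ _))
  refine ⟨c.toReal, ENNReal.toReal_nonneg, fun f x => ?_⟩
  have h1 : ‖∫ y, f y ∂(K x)‖ₑ ≤ c * ‖f‖ₑ := by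
    calc ‖∫ y, f y ∂(K x)‖ₑ ≤ ∫⁻ y, ‖f y‖ₑ ∂(K x) := enorm_integral_le_lintegral_enorm _
      _ ≤ ∫⁻ y, ‖f y‖ₑ ∂(D • μ) := lintegral_mono' (hKD x) le_rfl
      _ = D * eLpNorm f 1 μ := by
          rw [lintegral_smul_measure, smul_eq_mul, eLpNorm_one_eq_lintegral_enorm]
      _ ≤ D * (eLpNorm f 2 μ * (μ Set.univ) ^ (1 / 2 : ℝ)) := by
          gcongr
          have := eLpNorm_le_eLpNorm_mul_rpow_measure_univ (μ := μ) (f := f) (p := 1) (q := 2)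
            (by norm_num) (Lp.memLp f).aestronglyMeasurable
          have e : 1 / ENNReal.toReal 1 - 1 / ENNReal.toReal 2 = (1 / 2 : ℝ) := by norm_num
          rwa [e] at this
      _ = c * ‖f‖ₑ := by
          rw [Lp.enorm_def, hc]
          ring
  have h2 := ENNReal.toReal_mono (ENNReal.mul_ne_top hct enorm_ne_top) h1
  rwa [ENNReal.toReal_mul, toReal_enorm, toReal_enorm] at h2

lemma stronglyMeasurable_integral_kernel [IsSFiniteKernel K] (f : L2Strip a) :
    StronglyMeasurable fun x => ∫ y, f y ∂(K x) :=
  (Lp.stronglyMeasurable f).integral_kernel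

/-- Needed because `kernelSpectralRadius` is a supremum over such operators and would be `0` if
there were none. -/
lemma exists_integralOperator (hD : D ≠ ∞)
    (hKD : ∀ x, K x ≤ D • volume.restrict (Set.Icc 0 a)) :
    ∃ T : L2Strip a →L[ℂ] L2Strip a, IsIntegralOperator a K T := by
  have := isFiniteKernel_of_le_smul hD hKD
  obtain ⟨C, hC, hb⟩ := norm_integral_kernel_le hD hKD
  set μ := volume.restrict (Set.Icc 0 a) with hμ
  have hmem : ∀ f : L2Strip a, MemLp (fun x => ∫ y, f y ∂(K x)) 2 μ := fun f =>
    MemLp.of_bound (stronglyMeasurable_integral_kernel f).aestronglyMeasurable (C * ‖f‖)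
      (Eventually.of_forall (hb f))
  let T₀ : L2Strip a →ₗ[ℂ] L2Strip a :=
    { toFun := fun f => (hmem f).toLp _
      map_add' := fun f g => by
        rw [← MemLp.toLp_add]
        congr 1
        funext x
        rw [Pi.add_apply, ← integral_add (integrable_Lp_kernel hD hKD f x)
          (integrable_Lp_kernel hD hKD g x)]
        exact integral_congr_ae
          ((absolutelyContinuous_of_le_smul hKD x).ae_le (Lp.coeFn_add f g))
      map_smul' := fun c f => by
        rw [RingHom.id_apply, ← MemLp.toLp_const_smul]
        congr 1
        funext x
        rw [Pi.smul_apply, ← integral_smul]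
        exact integral_congr_ae
          ((absolutelyContinuous_of_le_smul hKD x).ae_le (Lp.coeFn_smul c f)) }
  refine ⟨T₀.mkContinuous (μ.real Set.univ ^ ((2 : ℝ≥0∞).toReal)⁻¹ * C) fun f => ?_, fun f => ?_⟩
  · rw [mul_assoc]
    refine Lp.norm_le_of_ae_bound (by positivity) ?_
    filter_upwards [(hmem f).coeFn_toLp] with x hx
    change ‖((hmem f).toLp _ : ℝ → ℂ) x‖ ≤ _
    rw [hx]
    exact hb f x
  · exact (hmem f).coeFn_toLp

variable {κ : ℝ → Measure ℝ}

lemma IsIntegralOperator.congr (hκ : ∀ x ∈ Set.Icc 0 a, κ x = K x)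
    {T : L2Strip a →L[ℂ] L2Strip a} : IsIntegralOperator a κ T ↔ IsIntegralOperator a K T := by
  refine forall_congr' fun f => ?_
  have : (fun x => ∫ y, f y ∂(κ x)) =ᵐ[volume.restrict (Set.Icc (0 : ℝ) a)]
      fun x => ∫ y, f y ∂(K x) := by
    filter_upwards [ae_restrict_mem measurableSet_Icc] with x hx
    rw [hκ x hx]
  exact ⟨fun h => h.trans this, fun h => h.trans this.symm⟩

/-- A kernel with a bounded eigenfunction that is bounded away from zero has the corresponding
eigenvalue as spectral radius. -/
theorem kernelSpectralRadius_eq (ha : 0 < a) (hκ : ∀ x ∈ Set.Icc 0 a, κ x = K x) (hD : D ≠ ∞)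
    (hKD : ∀ x, K x ≤ D • volume.restrict (Set.Icc 0 a)) {v : ℝ → ℝ} (hv : Measurable v)
    {c C r : ℝ} (hc : 0 < c) (hr : 0 < r) (hcv : ∀ x ∈ Set.Icc 0 a, c ≤ v x)
    (hvC : ∀ x ∈ Set.Icc 0 a, v x ≤ C)
    (heig : ∀ x ∈ Set.Icc 0 a, ∫⁻ y, ENNReal.ofReal (v y) ∂(K x) = ENNReal.ofReal (r * v x)) :
    kernelSpectralRadius a κ = ENNReal.ofReal r := by
  have := isFiniteKernel_of_le_smul hD hKD
  set μ := volume.restrict (Set.Icc 0 a) with hμ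
  have hμ0 : μ ≠ 0 := by
    rw [hμ, Ne, Measure.restrict_eq_zero, Real.volume_Icc, sub_zero]
    exact (ENNReal.ofReal_pos.2 ha).ne'
  have hmemE : ∀ᵐ x ∂μ, x ∈ Set.Icc 0 a := ae_restrict_mem measurableSet_Icc
  have hKae : ∀ x, ∀ᵐ y ∂(K x), y ∈ Set.Icc 0 a := fun x =>
    (absolutelyContinuous_of_le_smul hKD x).ae_le hmemE
  have hvint : ∀ x, Integrable v (K x) := fun x => by
    refine Integrable.of_bound hv.aestronglyMeasurable C ?_
    filter_upwards [hKae x] with y hy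
    rw [Real.norm_eq_abs, abs_of_pos (hc.trans_le (hcv y hy))]
    exact hvC y hy
  have hveig : ∀ x ∈ Set.Icc 0 a, ∫ y, v y ∂(K x) = r * v x := fun x hx => by
    rw [integral_eq_lintegral_of_nonneg_ae ?_ hv.aestronglyMeasurable, heig x hx,
      ENNReal.toReal_ofReal (mul_nonneg hr.le (hc.le.trans (hcv x hx)))]
    filter_upwards [hKae x] with y hy
    exact hc.le.trans (hcv y hy)
  have hone : ∀ T : L2Strip a →L[ℂ] L2Strip a, IsIntegralOperator a K T →
      spectralRadius ℂ T = ENNReal.ofReal r := by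
    intro T hT
    obtain ⟨B, hB, hb⟩ := norm_integral_kernel_le hD hKD
    -- After one application the function is bounded, hence dominated by a multiple of `v ≥ c`. Each
    -- further application multiplies this majorant by `r`.
    have hpow : ∀ n (f : L2Strip a), ∀ᵐ x ∂μ,
        ‖(T ^ (n + 1)) f x‖ ≤ (B / c * ‖f‖) * r ^ n * v x := by
      intro n f
      induction n with
      | zero =>
        rw [zero_add, pow_one, pow_zero, mul_one]
        filter_upwards [hT f, hmemE] with x hx hxE
        rw [hx]
        refine (hb f x).trans ?_
        have h1 : B * ‖f‖ * c ≤ B * ‖f‖ * v x := by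
          gcongr
          exact hcv x hxE
        calc B * ‖f‖ = B * ‖f‖ * c / c := by field_simp
          _ ≤ B * ‖f‖ * v x / c := by gcongr
          _ = _ := by ring
      | succ n ih =>
        set g := (T ^ (n + 1)) f with hg
        have e : (T ^ (n + 1 + 1)) f = T g := by
          rw [pow_succ' T (n + 1), mul_apply_eq_comp]
        rw [e]
        filter_upwards [hT g, hmemE] with x hx hxE
        rw [hx]
        calc ‖∫ y, g y ∂(K x)‖ ≤ ∫ y, (B / c * ‖f‖) * r ^ n * v y ∂(K x) := by
              refine norm_integral_le_of_norm_le ((hvint x).const_mul _) ?_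
              exact (absolutelyContinuous_of_le_smul hKD x).ae_le ih
          _ = _ := by
              rw [integral_const_mul, hveig x hxE]
              ring
    set Q := μ.real Set.univ ^ ((2 : ℝ≥0∞).toReal)⁻¹ * (B / c * C) with hQ
    have hC0 : 0 < C := hc.trans_le ((hcv 0 ⟨le_rfl, ha.le⟩).trans (hvC 0 ⟨le_rfl, ha.le⟩))
    have hQ0 : 0 ≤ Q := by positivity
    have hnorm : ∀ n, ‖T ^ (n + 1)‖ ≤ Q * r ^ n := by
      intro n
      refine ContinuousLinearMap.opNorm_le_bound _ (by positivity) fun f => ?_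
      have h1 : ‖(T ^ (n + 1)) f‖ ≤ μ.real Set.univ ^ ((2 : ℝ≥0∞).toReal)⁻¹ *
          ((B / c * ‖f‖) * r ^ n * C) := by
        refine Lp.norm_le_of_ae_bound (by positivity) ?_
        filter_upwards [hpow n f, hmemE] with x hx hxE
        refine hx.trans ?_
        gcongr
        exact hvC x hxE
      refine h1.trans_eq ?_
      rw [hQ]
      ring
    apply le_antisymm
    · refine iSup₂_le fun k hk => ?_
      rw [← ENNReal.ofReal_coe_nnreal, coe_nnnorm]
      apply ENNReal.ofReal_le_ofReal
      by_contra hcon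
      push Not at hcon
      have hk0 : 0 < ‖k‖ := hr.trans hcon
      -- Powers of a spectral value lie in the spectrum of the powers of `T`, so `‖k‖ ^ (n + 1)` is
      -- at most a constant times `r ^ n`. This excludes `‖k‖ > r`.
      have hbound : ∀ n : ℕ, (‖k‖ / r) ^ n ≤
          Q * ‖(1 : L2Strip a →L[ℂ] L2Strip a)‖ / ‖k‖ := by
        intro n
        have h1 := spectrum.norm_le_norm_mul_of_mem (spectrum.pow_mem_pow T (n + 1) hk)
        rw [norm_pow] at h1
        have h2 : ‖k‖ ^ (n + 1) ≤ Q * r ^ n * ‖(1 : L2Strip a →L[ℂ] L2Strip a)‖ :=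
          h1.trans (by gcongr; exact hnorm n)
        rw [div_pow, div_le_div_iff₀ (pow_pos hr n) hk0, ← pow_succ]
        linarith
      have h3 := tendsto_pow_atTop_atTop_of_one_lt ((one_lt_div hr).2 hcon)
      obtain ⟨n, hn⟩ := (h3.eventually_gt_atTop
        (Q * ‖(1 : L2Strip a →L[ℂ] L2Strip a)‖ / ‖k‖)).exists
      exact absurd (hbound n) (not_le.2 hn)
    -- For the reverse inequality, `v` itself is an eigenvector, so `r` is a point of the spectrum.
    · have hvL : MemLp (fun x => (v x : ℂ)) 2 μ := by
        refine MemLp.of_bound (Complex.measurable_ofReal.comp hv).aestronglyMeasurable C ?_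
        filter_upwards [hmemE] with x hx
        rw [Complex.norm_real, Real.norm_eq_abs, abs_of_pos (hc.trans_le (hcv x hx))]
        exact hvC x hx
      set φ : L2Strip a := hvL.toLp _ with hφ
      have hφ0 : φ ≠ 0 := by
        intro h0
        have h1 : (fun x => (v x : ℂ)) =ᵐ[μ] 0 := by
          have h2 := hvL.coeFn_toLp
          rw [← hφ, h0] at h2
          exact h2.symm.trans (Lp.coeFn_zero _ _ _)
        have h2 : ∀ᵐ x ∂μ, False := by
          filter_upwards [h1, hmemE] with x hx hxE
          have h3 := hc.trans_le (hcv x hxE)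
          simp only [Pi.zero_apply, Complex.ofReal_eq_zero] at hx
          exact h3.ne' hx
        exact hμ0 (by simpa using h2)
      have hTφ : T φ = (r : ℂ) • φ := by
        apply Lp.ext
        filter_upwards [hT φ, hmemE, Lp.coeFn_smul (r : ℂ) φ, hvL.coeFn_toLp] with x h1 h2 h3 h4
        rw [h1, h3, Pi.smul_apply, h4, smul_eq_mul, ← Complex.ofReal_mul, ← hveig x h2,
          ← integral_complex_ofReal]
        exact integral_congr_ae ((absolutelyContinuous_of_le_smul hKD x).ae_le hvL.coeFn_toLp)
      have hmem : (r : ℂ) ∈ spectrum ℂ T := by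
        rw [spectrum.mem_iff]
        intro hu
        obtain ⟨u, hu⟩ := hu
        apply hφ0
        have h1 : (u : L2Strip a →L[ℂ] L2Strip a) φ = 0 := by
          rw [hu, sub_apply, hTφ, Algebra.algebraMap_eq_smul_one,
            smul_apply, one_apply_eq_self, sub_self]
        have h2 : ((↑u⁻¹ : L2Strip a →L[ℂ] L2Strip a) * ↑u) φ = φ := by
          rw [Units.inv_mul, one_apply_eq_self]
        rw [← h2, mul_apply_eq_comp, h1, map_zero]
      refine le_trans ?_ (le_iSup₂ (α := ℝ≥0∞) (r : ℂ) hmem)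
      rw [← ENNReal.ofReal_coe_nnreal, coe_nnnorm, Complex.norm_real, Real.norm_eq_abs,
        abs_of_pos hr]
  obtain ⟨T₁, hT₁⟩ := exists_integralOperator hD hKD
  apply le_antisymm
  · exact iSup₂_le fun T hT => (hone T ((IsIntegralOperator.congr hκ).1 hT)).le
  · exact (hone T₁ hT₁).ge.trans (le_iSup₂ (α := ℝ≥0∞) (f := fun T
      (_ : IsIntegralOperator a κ T) => spectralRadius ℂ T) T₁ ((IsIntegralOperator.congr hκ).2 hT₁))

end Spectral

/-! ### The potential above the strip and the return operator -/

section Potential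

variable {h : ℝ → ℝ} {M η δ : ℝ} {a β l : ℝ}

lemma measurable_potential (h : ℝ → ℝ) (a l : ℝ) {φ : ℝ → ℝ≥0∞} (hφ : Measurable φ) :
    Measurable (potential h a l φ) :=
  Measurable.tsum fun _ => hφ.lintegral_kernel

/-- The total mass bound of the discounted potential. -/
noncomputable def potentialBound (l : ℝ) : ℝ≥0∞ := (1 - ENNReal.ofReal (Real.exp (-l)))⁻¹

lemma ofReal_exp_neg_lt_one (hl : 0 < l) : ENNReal.ofReal (Real.exp (-l)) < 1 := by
  rw [ENNReal.ofReal_lt_one]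
  exact Real.exp_lt_one_iff.2 (by linarith)

lemma potentialBound_ne_top (hl : 0 < l) : potentialBound l ≠ ∞ :=
  ENNReal.inv_ne_top.2 (tsub_pos_of_lt (ofReal_exp_neg_lt_one hl)).ne'

lemma potential_le (H : IsStepDensity h M η δ) {φ : ℝ → ℝ≥0∞} (hφ : Measurable φ) {K : ℝ≥0∞}
    (hK : ∀ y, φ y ≤ K) (x : ℝ) : potential h a l φ x ≤ potentialBound l * K := by
  rw [potentialBound, ← ENNReal.tsum_geometric, ← ENNReal.tsum_mul_right]
  exact ENNReal.tsum_le_tsum fun n => lintegral_gOut_pow_le H a l hφ hK n x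

lemma potential_eq_add (h : ℝ → ℝ) (a l : ℝ) {φ : ℝ → ℝ≥0∞} (hφ : Measurable φ) (x : ℝ) :
    potential h a l φ x = φ x + ∫⁻ y, potential h a l φ y ∂(stepKernel h (gOut a l) x) := by
  unfold potential
  rw [lintegral_tsum fun N => hφ.lintegral_kernel.aemeasurable,
    tsum_eq_zero_add' ENNReal.summable, lintegral_pow_zero _ _ hφ]
  congr 1
  refine tsum_congr fun n => ?_
  rw [add_comm n 1, lintegral_pow_add _ 1 n x hφ, lintegral_pow_one]

/-- Here the last step is peeled off, whereas `potential_eq_add` peels off the first. -/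
lemma potential_eq_add' (h : ℝ → ℝ) (a l : ℝ) {φ : ℝ → ℝ≥0∞} (hφ : Measurable φ) (x : ℝ) :
    potential h a l φ x =
      φ x + potential h a l (fun z => ∫⁻ y, φ y ∂(stepKernel h (gOut a l) z)) x := by
  unfold potential
  rw [tsum_eq_zero_add' ENNReal.summable, lintegral_pow_zero _ _ hφ]
  congr 1
  refine tsum_congr fun n => ?_
  rw [lintegral_pow_add _ n 1 x hφ]
  simp_rw [lintegral_pow_one]

lemma potential_add (h : ℝ → ℝ) (a l : ℝ) {φ ψ : ℝ → ℝ≥0∞} (hφ : Measurable φ) (x : ℝ) :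
    potential h a l (fun y => φ y + ψ y) x = potential h a l φ x + potential h a l ψ x := by
  unfold potential
  rw [← ENNReal.tsum_add]
  exact tsum_congr fun n => lintegral_add_left hφ ψ

lemma potential_congr_of_forall {φ ψ : ℝ → ℝ≥0∞} (e : ∀ y, φ y = ψ y) (x : ℝ) :
    potential h a l φ x = potential h a l ψ x := by
  rw [show φ = ψ from funext e]

/-- A path of `n` steps can be cut into two in `n + 1` ways. This is what turns the potential of an
eigenfunction into a mean return time. -/
lemma potential_potential (h : ℝ → ℝ) (a l : ℝ) {φ : ℝ → ℝ≥0∞} (hφ : Measurable φ) (x : ℝ) :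
    potential h a l (potential h a l φ) x =
      ∑' n : ℕ, ((n + 1 : ℕ) : ℝ≥0∞) * ∫⁻ y, φ y ∂((stepKernel h (gOut a l) ^ n) x) := by
  have e1 : potential h a l (potential h a l φ) x =
      ∑' p : ℕ × ℕ, ∫⁻ y, φ y ∂((stepKernel h (gOut a l) ^ (p.1 + p.2)) x) := by
    rw [ENNReal.tsum_prod']
    unfold potential
    refine tsum_congr fun i => ?_
    rw [lintegral_tsum fun N => hφ.lintegral_kernel.aemeasurable]
    exact tsum_congr fun j => (lintegral_pow_add _ i j x hφ).symm
  rw [e1, ← Finset.HasAntidiagonal.sigmaAntidiagonalEquivProd.tsum_eq, ENNReal.tsum_sigma']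
  refine tsum_congr fun n => ?_
  rw [tsum_fintype]
  have : ∀ p : ↥(Finset.HasAntidiagonal.antidiagonal n),
      ∫⁻ y, φ y ∂((stepKernel h (gOut a l) ^
        ((Finset.HasAntidiagonal.sigmaAntidiagonalEquivProd ⟨n, p⟩).1 +
          (Finset.HasAntidiagonal.sigmaAntidiagonalEquivProd ⟨n, p⟩).2)) x) =
      ∫⁻ y, φ y ∂((stepKernel h (gOut a l) ^ n) x) := by
    intro p
    have := Finset.HasAntidiagonal.mem_antidiagonal.1 p.2
    rw [Finset.HasAntidiagonal.sigmaAntidiagonalEquivProd_apply, this]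
  rw [Finset.sum_congr rfl fun p _ => this p, Finset.sum_const, Finset.card_univ,
    Fintype.card_coe, Finset.Nat.card_antidiagonal, nsmul_eq_mul]

/-- The discounted return operator to the strip. -/
noncomputable def returnOp (h : ℝ → ℝ) (a β l : ℝ) (φ : ℝ → ℝ≥0∞) : ℝ → ℝ≥0∞ :=
  potential h a l fun z => ∫⁻ y, φ y ∂(stepKernel h (gIn a β l) z)

lemma measurable_returnOp (h : ℝ → ℝ) (a β l : ℝ) {φ : ℝ → ℝ≥0∞} (hφ : Measurable φ) :
    Measurable (returnOp h a β l φ) :=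
  measurable_potential h a l hφ.lintegral_kernel

lemma lintegral_gIn_le (H : IsStepDensity h M η δ) {φ : ℝ → ℝ≥0∞} (hφ : Measurable φ) (x : ℝ) :
    ∫⁻ y, φ y ∂(stepKernel h (gIn a β l) x) ≤
      ENNReal.ofReal (Real.exp (β - l)) * ENNReal.ofReal M * ∫⁻ y in Set.Icc 0 a, φ y :=
  lintegral_stepKernel_indicator_le H measurableSet_Icc hφ x

lemma returnOp_le (H : IsStepDensity h M η δ) {φ : ℝ → ℝ≥0∞} (hφ : Measurable φ) (x : ℝ) :
    returnOp h a β l φ x ≤ potentialBound l *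
      (ENNReal.ofReal (Real.exp (β - l)) * ENNReal.ofReal M * ∫⁻ y in Set.Icc 0 a, φ y) :=
  potential_le H hφ.lintegral_kernel (lintegral_gIn_le H hφ) x

lemma lintegral_stepKernel_congr (H : IsStepDensity h M η δ) {s : Set ℝ} (hs : MeasurableSet s)
    {c : ℝ≥0∞} {φ ψ : ℝ → ℝ≥0∞} (hφ : Measurable φ) (hψ : Measurable ψ)
    (e : ∀ᵐ y ∂(volume.restrict s), φ y = ψ y) (x : ℝ) :
    ∫⁻ y, φ y ∂(stepKernel h (s.indicator fun _ => c) x) =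
      ∫⁻ y, ψ y ∂(stepKernel h (s.indicator fun _ => c) x) := by
  have hm := H.cont.measurable
  have hg : Measurable (s.indicator fun _ : ℝ => c) := measurable_const.indicator hs
  rw [lintegral_stepKernel hm hg hφ, lintegral_stepKernel hm hg hψ]
  rw [ae_restrict_iff' hs] at e
  refine lintegral_congr_ae ?_
  filter_upwards [e] with y hy
  by_cases hys : y ∈ s
  · rw [hy hys]
  · simp [hys]

lemma lintegral_gIn_congr (H : IsStepDensity h M η δ) {φ ψ : ℝ → ℝ≥0∞} (hφ : Measurable φ)
    (hψ : Measurable ψ) (e : ∀ᵐ y ∂(volume.restrict (Set.Icc 0 a)), φ y = ψ y) (x : ℝ) :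
    ∫⁻ y, φ y ∂(stepKernel h (gIn a β l) x) = ∫⁻ y, ψ y ∂(stepKernel h (gIn a β l) x) :=
  lintegral_stepKernel_congr H measurableSet_Icc hφ hψ e x

lemma lintegral_gOut_congr (H : IsStepDensity h M η δ) {φ ψ : ℝ → ℝ≥0∞} (hφ : Measurable φ)
    (hψ : Measurable ψ) (e : ∀ y, a < y → φ y = ψ y) (x : ℝ) :
    ∫⁻ y, φ y ∂(stepKernel h (gOut a l) x) = ∫⁻ y, ψ y ∂(stepKernel h (gOut a l) x) := by
  refine lintegral_stepKernel_congr H measurableSet_Ioi hφ hψ ?_ x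
  filter_upwards [ae_restrict_mem measurableSet_Ioi] with y hy using e y hy

lemma returnOp_congr (H : IsStepDensity h M η δ) {φ ψ : ℝ → ℝ≥0∞} (hφ : Measurable φ)
    (hψ : Measurable ψ) (e : ∀ᵐ y ∂(volume.restrict (Set.Icc 0 a)), φ y = ψ y) (x : ℝ) :
    returnOp h a β l φ x = returnOp h a β l ψ x :=
  potential_congr_of_forall (fun z => lintegral_gIn_congr H hφ hψ e z) x

lemma returnOp_eq_add (h : ℝ → ℝ) (a β l : ℝ) {φ : ℝ → ℝ≥0∞} (hφ : Measurable φ) (x : ℝ) :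
    returnOp h a β l φ x = ∫⁻ y, φ y ∂(stepKernel h (gIn a β l) x) +
      ∫⁻ y, returnOp h a β l φ y ∂(stepKernel h (gOut a l) x) :=
  potential_eq_add h a l hφ.lintegral_kernel x

/-- A fixed point of the return operator is harmonic. -/
lemma harmonic_of_returnOp_eq (H : IsStepDensity h M η δ) {φ : ℝ → ℝ≥0∞} (hφ : Measurable φ)
    (e : ∀ x, returnOp h a β l φ x = φ x) (x : ℝ) :
    ∫⁻ y, φ y ∂(stepKernel h (gAll a β l) x) = φ x := by
  rw [lintegral_gAll H a β l hφ]
  conv_rhs => rw [← e x, returnOp_eq_add h a β l hφ]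
  simp_rw [e]

/-- A bounded harmonic function is a fixed point of the return operator. -/
lemma returnOp_eq_of_harmonic (H : IsStepDensity h M η δ) (hl : 0 < l) {φ : ℝ → ℝ≥0∞}
    (hφ : Measurable φ) {K : ℝ≥0∞} (hKt : K ≠ ∞) (hK : ∀ y, φ y ≤ K)
    (e : ∀ x, ∫⁻ y, φ y ∂(stepKernel h (gAll a β l) x) = φ x) (x : ℝ) :
    returnOp h a β l φ x = φ x := by
  have h1 := potential_eq_add' h a l hφ x
  -- Applying the potential to `φ = κ^in φ + κ^out φ` and comparing with the last-step decomposition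
  -- in `h1`. The common term is finite and cancels.
  have h2 : potential h a l φ x = returnOp h a β l φ x +
      potential h a l (fun z => ∫⁻ y, φ y ∂(stepKernel h (gOut a l) z)) x := by
    rw [returnOp, ← potential_add h a l hφ.lintegral_kernel]
    refine potential_congr_of_forall (fun z => ?_) x
    rw [← lintegral_gAll H a β l hφ, e]
  rw [h1] at h2
  refine ((ENNReal.add_left_inj ?_).1 h2).symm
  refine ne_top_of_le_ne_top (ENNReal.mul_ne_top (potentialBound_ne_top hl)
    (ENNReal.mul_ne_top ENNReal.ofReal_ne_top hKt)) (potential_le H hφ.lintegral_kernel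
      (fun y => lintegral_stepKernel_le H (measurable_gOut a l) (gOut_le a l) hφ hK y) x)

/-- The kernel of discounted returns to the strip. -/
noncomputable def returnKernel (h : ℝ → ℝ) (a l : ℝ) : Kernel ℝ ℝ :=
  Kernel.sum fun n : ℕ => stepKernel h (gIn a 0 l) ∘ₖ (stepKernel h (gOut a l) ^ n)

lemma exp_mul_lintegral_returnKernel (H : IsStepDensity h M η δ) {φ : ℝ → ℝ≥0∞}
    (hφ : Measurable φ) (x : ℝ) :
    ENNReal.ofReal (Real.exp β) * ∫⁻ y, φ y ∂(returnKernel h a l x) =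
      returnOp h a β l φ x := by
  rw [returnKernel, Kernel.sum_apply, lintegral_sum_measure, ← ENNReal.tsum_mul_left, returnOp,
    potential]
  refine tsum_congr fun n => ?_
  rw [Kernel.lintegral_comp _ _ _ hφ, ← lintegral_const_mul _ hφ.lintegral_kernel]
  exact lintegral_congr fun z => (lintegral_gIn_exp H a β l hφ z).symm

lemma lintegral_returnKernel (H : IsStepDensity h M η δ) {φ : ℝ → ℝ≥0∞}
    (hφ : Measurable φ) (x : ℝ) :
    ∫⁻ y, φ y ∂(returnKernel h a l x) =
      ENNReal.ofReal (Real.exp (-β)) * returnOp h a β l φ x := by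
  rw [← exp_mul_lintegral_returnKernel H hφ x, ← mul_assoc,
    ← ENNReal.ofReal_mul (Real.exp_pos _).le, ← Real.exp_add]
  simp

/-- A bound for the density of the return kernel. -/
noncomputable def returnBound (M l : ℝ) : ℝ≥0∞ :=
  potentialBound l * (ENNReal.ofReal (Real.exp (-l)) * ENNReal.ofReal M)

lemma returnBound_ne_top (M : ℝ) (hl : 0 < l) : returnBound M l ≠ ∞ :=
  ENNReal.mul_ne_top (potentialBound_ne_top hl)
    (ENNReal.mul_ne_top ENNReal.ofReal_ne_top ENNReal.ofReal_ne_top)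

lemma returnKernel_le (H : IsStepDensity h M η δ) (x : ℝ) :
    returnKernel h a l x ≤ returnBound M l • volume.restrict (Set.Icc 0 a) := by
  refine Measure.le_intro fun s hs _ => ?_
  have h1 := exp_mul_lintegral_returnKernel (a := a) (l := l) (β := 0) H
    (φ := s.indicator fun _ => 1) (measurable_const.indicator hs) x
  rw [Real.exp_zero, ENNReal.ofReal_one, one_mul, lintegral_indicator_const hs, one_mul] at h1
  have h2 := returnOp_le (a := a) (l := l) (β := 0) H (φ := s.indicator fun _ => 1)
    (measurable_const.indicator hs) x
  rw [← h1, lintegral_indicator_const hs, one_mul, zero_sub] at h2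
  rw [Measure.smul_apply, smul_eq_mul, returnBound, mul_assoc]
  exact h2

variable {Ω : Type*} [MeasurableSpace Ω] {P : Measure Ω} [IsProbabilityMeasure P]
  {X : ℕ → Ω → ℝ}

/-- Restricted to the strip because `laplaceKer` vanishes at other starting points, while
`returnKernel` is defined on the whole line and allows functions to be extended beyond the strip. -/
lemma laplaceKer_eq (W : IsDensityWalk P X h) (H : IsStepDensity h M η δ) (ha : 0 < a) {x : ℝ}
    (hx : x ∈ Set.Icc 0 a) : laplaceKer P X a l x = returnKernel h a l x := by
  refine Measure.ext fun s hs => ?_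
  have h1 := exp_mul_lintegral_laplaceKer W H ha 0 l hx (φ := s.indicator fun _ => 1)
    (measurable_const.indicator hs)
  have h2 := exp_mul_lintegral_returnKernel (a := a) (l := l) (β := 0) H
    (φ := s.indicator fun _ => 1) (measurable_const.indicator hs) x
  rw [Real.exp_zero, ENNReal.ofReal_one, one_mul, lintegral_indicator_const hs, one_mul] at h1 h2
  rw [h1, h2, returnOp]

end Potential

/-! ### Eigenfunctions as harmonic functions and invariant measures -/

section Identification

variable {h : ℝ → ℝ} {M η δ : ℝ} {a β l : ℝ}
  {V : ℝ → ℝ≥0∞} {Λ : (ℝ → ℝ≥0∞) → ℝ≥0∞} {ε : ℕ → ℝ≥0∞}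

lemma setLIntegral_Icc_ne_zero (ha : 0 < a) {φ : ℝ → ℝ≥0∞} (hφ : Measurable φ)
    (h0 : ∀ x, φ x ≠ 0) : ∫⁻ y in Set.Icc 0 a, φ y ≠ 0 := by
  intro hz
  rw [lintegral_eq_zero_iff hφ] at hz
  have : ∀ᵐ x ∂(volume.restrict (Set.Icc 0 a)), False := hz.mono fun x hx => h0 x hx
  have hv : volume.restrict (Set.Icc 0 a) = 0 :=
    ae_eq_bot.1 (Filter.eventually_false_iff_eq_bot.1 this)
  rw [Measure.restrict_eq_zero, Real.volume_Icc, sub_zero] at hv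
  exact (ENNReal.ofReal_pos.2 ha).ne' hv

lemma RankOneLimit.exists_lower (H : IsStepDensity h M η δ) (ha : 0 < a)
    (R : RankOneLimit (stepKernel h (gAll a β l)) V Λ ε) (L : ℝ) :
    ∃ c : ℝ≥0∞, c ≠ 0 ∧ ∀ x ≤ L, c ≤ V x :=
  harmonic_lower H R.V_meas (fun x => (R.harmonic x).symm)
    (setLIntegral_Icc_ne_zero ha R.V_meas R.V_ne_zero) L

variable {Ω : Type*} [MeasurableSpace Ω] {P : Measure Ω} [IsProbabilityMeasure P]
  {X : ℕ → Ω → ℝ}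

/-- `V` is a fixed point of the return operator, that is, of `e^β` times the kernel. So it is an
eigenfunction for `e^{-β}`, and it is bounded above and bounded away from `0` on the strip. -/
lemma kernelSpectralRadius_laplaceKer (W : IsDensityWalk P X h) (H : IsStepDensity h M η δ)
    (ha : 0 < a) (hl : 0 < l) (R : RankOneLimit (stepKernel h (gAll a β l)) V Λ ε) :
    kernelSpectralRadius a (laplaceKer P X a l) = ENNReal.ofReal (Real.exp (-β)) := by
  obtain ⟨c, hc0, hc⟩ := R.exists_lower H ha a
  have hct : c ≠ ∞ := ne_top_of_le_ne_top (R.V_ne_top a) (hc a le_rfl)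
  refine kernelSpectralRadius_eq ha (K := returnKernel h a l) (v := fun x => (V x).toReal)
    (c := c.toReal) (C := 1) (fun x hx => laplaceKer_eq W H ha hx) (returnBound_ne_top M hl)
    (returnKernel_le H) R.V_meas.ennreal_toReal (ENNReal.toReal_pos hc0 hct) (Real.exp_pos _)
    (fun x hx => ENNReal.toReal_mono (R.V_ne_top x) (hc x hx.2))
    (fun x _ => ENNReal.toReal_le_of_le_ofReal zero_le_one (by simpa using R.V_le x))
    (fun x _ => ?_)
  simp_rw [ENNReal.ofReal_toReal (R.V_ne_top _)]
  rw [lintegral_returnKernel (β := β) H R.V_meas, returnOp_eq_of_harmonic H hl R.V_meas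
    ENNReal.one_ne_top R.V_le R.harmonic, ENNReal.ofReal_mul (Real.exp_pos _).le,
    ENNReal.ofReal_toReal (R.V_ne_top x)]

/-- A right eigenfunction extends to a bounded fixed point of the return operator. -/
lemma IsRightPF.exists_extension (W : IsDensityWalk P X h) (H : IsStepDensity h M η δ)
    (ha : 0 < a) (hl : 0 < l) (hρ : kernelSpectralRadius a (laplaceKer P X a l) =
      ENNReal.ofReal (Real.exp (-β))) {v : ℝ → ℝ} (hv : IsRightPF a (laplaceKer P X a l) v) :
    ∃ (u : ℝ → ℝ≥0∞) (K : ℝ≥0∞), Measurable u ∧ K ≠ ∞ ∧ (∀ x, u x ≤ K) ∧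
      (∀ x ∈ Set.Icc 0 a, u x = ENNReal.ofReal (v x)) ∧ ∀ x, returnOp h a β l u x = u x := by
  -- `v` is only almost everywhere measurable. The kernels are absolutely continuous, so the
  -- eigenvalue equation still holds at every point of the strip for a measurable version `f`. The
  -- image of `f` under the return operator is then the extension sought.
  have hae : AEMeasurable (fun x => ENNReal.ofReal (v x)) (volume.restrict (Set.Icc 0 a)) :=
    hv.memLp.aestronglyMeasurable.aemeasurable.ennreal_ofReal
  set f := hae.mk with hf
  have hfm : Measurable f := hae.measurable_mk
  have hfe : ∀ᵐ x ∂(volume.restrict (Set.Icc 0 a)), ENNReal.ofReal (v x) = f x := hae.ae_eq_mk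
  have hE : ∀ x ∈ Set.Icc 0 a, returnOp h a β l f x = ENNReal.ofReal (v x) := by
    intro x hx
    have h1 := hv.eigen x hx
    rw [hρ, laplaceKer_eq W H ha hx, lintegral_congr_ae
      ((absolutelyContinuous_of_le_smul (returnKernel_le H) x).ae_le hfe)] at h1
    rw [← exp_mul_lintegral_returnKernel H hfm x, h1, ← mul_assoc,
      ← ENNReal.ofReal_mul (Real.exp_pos _).le, ← Real.exp_add]
    simp
  refine ⟨returnOp h a β l f, potentialBound l * (ENNReal.ofReal (Real.exp (β - l)) *
    ENNReal.ofReal M * ∫⁻ y in Set.Icc 0 a, f y), measurable_returnOp h a β l hfm, ?_,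
    returnOp_le H hfm, hE, fun x => ?_⟩
  · refine ENNReal.mul_ne_top (potentialBound_ne_top hl) (ENNReal.mul_ne_top
      (ENNReal.mul_ne_top ENNReal.ofReal_ne_top ENNReal.ofReal_ne_top) ?_)
    rw [← lintegral_congr_ae hfe]
    have hint : Integrable v (volume.restrict (Set.Icc 0 a)) := hv.memLp.integrable (by norm_num)
    refine ne_top_of_le_ne_top hint.hasFiniteIntegral.ne (lintegral_mono fun x => ?_)
    exact Real.ofReal_le_enorm (v x)
  · refine returnOp_congr H (measurable_returnOp h a β l hfm) hfm ?_ x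
    filter_upwards [hfe, ae_restrict_mem measurableSet_Icc] with y hy hyE
    rw [hE y hyE, hy]

/-- The measure with density `w` on the strip. -/
noncomputable def leftMeasure (a : ℝ) (w : ℝ → ℝ) : Measure ℝ :=
  (volume.restrict (Set.Icc 0 a)).withDensity fun x => ENNReal.ofReal (w x)

lemma IsLeftPF.aemeasurable {κ : ℝ → Measure ℝ} {w : ℝ → ℝ} (hw : IsLeftPF a κ w) :
    AEMeasurable (fun x => ENNReal.ofReal (w x)) (volume.restrict (Set.Icc 0 a)) :=
  hw.memLp.aestronglyMeasurable.aemeasurable.ennreal_ofReal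

lemma IsLeftPF.isFiniteMeasure {κ : ℝ → Measure ℝ} {w : ℝ → ℝ} (hw : IsLeftPF a κ w) :
    IsFiniteMeasure (leftMeasure a w) := by
  have hint : Integrable w (volume.restrict (Set.Icc 0 a)) := hw.memLp.integrable (by norm_num)
  refine isFiniteMeasure_withDensity (ne_top_of_le_ne_top hint.hasFiniteIntegral.ne
    (lintegral_mono fun x => ?_))
  exact Real.ofReal_le_enorm (w x)

lemma IsLeftPF.lintegral_leftMeasure {κ : ℝ → Measure ℝ} {w : ℝ → ℝ} (hw : IsLeftPF a κ w)
    {φ : ℝ → ℝ≥0∞} (hφ : AEMeasurable φ (volume.restrict (Set.Icc 0 a))) :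
    ∫⁻ x, φ x ∂(leftMeasure a w) = ∫⁻ x in Set.Icc 0 a, ENNReal.ofReal (w x) * φ x := by
  rw [leftMeasure, lintegral_withDensity_eq_lintegral_mul₀ hw.aemeasurable hφ]
  rfl

/-- A left eigenfunction is invariant under the return operator. -/
lemma IsLeftPF.lintegral_returnOp (W : IsDensityWalk P X h) (H : IsStepDensity h M η δ)
    (ha : 0 < a) (hρ : kernelSpectralRadius a (laplaceKer P X a l) =
      ENNReal.ofReal (Real.exp (-β))) {w : ℝ → ℝ} (hw : IsLeftPF a (laplaceKer P X a l) w)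
    {φ : ℝ → ℝ≥0∞} (hφ : Measurable φ) :
    ∫⁻ x, returnOp h a β l φ x ∂(leftMeasure a w) = ∫⁻ x, φ x ∂(leftMeasure a w) := by
  -- The left eigenvalue equation as an identity of measures. It is assumed for subsets of the strip
  -- only, which suffices because the return kernel charges nothing else.
  have hbind : (leftMeasure a w).bind (returnKernel h a l) =
      ENNReal.ofReal (Real.exp (-β)) • leftMeasure a w := by
    refine Measure.ext fun s hs => ?_
    have hsE := hs.inter (measurableSet_Icc (a := (0 : ℝ)) (b := a))
    rw [Measure.bind_apply hs (Kernel.aemeasurable _), hw.lintegral_leftMeasure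
      (Kernel.measurable_coe _ hs).aemeasurable, Measure.smul_apply, smul_eq_mul]
    have h1 := hw.eigen _ hsE Set.inter_subset_right
    rw [hρ] at h1
    rw [leftMeasure, withDensity_apply _ hs, Measure.restrict_restrict hs, ← h1]
    refine setLIntegral_congr_fun measurableSet_Icc fun x hx => ?_
    rw [laplaceKer_eq W H ha hx]
    congr 1
    refine measure_congr ?_
    have hac := absolutelyContinuous_of_le_smul (returnKernel_le (a := a) (l := l) H) x
    filter_upwards [hac.ae_le (ae_restrict_mem measurableSet_Icc)] with y hy
    exact propext ⟨fun hs' => ⟨hs', hy⟩, fun hs' => hs'.1⟩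
  have h1 := Measure.lintegral_bind (m := leftMeasure a w) (μ := returnKernel h a l) (f := φ)
    (Kernel.aemeasurable _) hφ.aemeasurable
  rw [hbind, lintegral_smul_measure, smul_eq_mul] at h1
  simp_rw [lintegral_returnKernel (β := β) H hφ] at h1
  rw [lintegral_const_mul _ (measurable_returnOp h a β l hφ)] at h1
  exact ((ENNReal.mul_right_inj (ENNReal.ofReal_pos.2 (Real.exp_pos _)).ne'
    ENNReal.ofReal_ne_top).1 h1).symm

/-- The potential as a kernel. -/
noncomputable def potentialKernel (h : ℝ → ℝ) (a l : ℝ) : Kernel ℝ ℝ :=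
  Kernel.sum fun n : ℕ => stepKernel h (gOut a l) ^ n

lemma lintegral_potentialKernel (x : ℝ) (φ : ℝ → ℝ≥0∞) :
    ∫⁻ y, φ y ∂(potentialKernel h a l x) = potential h a l φ x := by
  rw [potentialKernel, Kernel.sum_apply, lintegral_sum_measure, potential]

lemma lintegral_bind_potentialKernel (μ : Measure ℝ) {φ : ℝ → ℝ≥0∞} (hφ : Measurable φ) :
    ∫⁻ x, φ x ∂(μ.bind (potentialKernel h a l)) = ∫⁻ x, potential h a l φ x ∂μ := by
  rw [Measure.lintegral_bind (Kernel.aemeasurable _) hφ.aemeasurable]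
  simp_rw [lintegral_potentialKernel]

lemma isFiniteMeasure_bind_potentialKernel (H : IsStepDensity h M η δ) (hl : 0 < l)
    (μ : Measure ℝ) [IsFiniteMeasure μ] : IsFiniteMeasure (μ.bind (potentialKernel h a l)) := by
  refine ⟨?_⟩
  rw [← lintegral_one, lintegral_bind_potentialKernel μ measurable_const]
  calc ∫⁻ x, potential h a l (fun _ => 1) x ∂μ ≤ ∫⁻ _, potentialBound l * 1 ∂μ :=
        lintegral_mono fun x => potential_le H measurable_const (fun _ => le_rfl) x
    _ < ∞ := by
        rw [lintegral_const, mul_one]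
        exact ENNReal.mul_lt_top (potentialBound_ne_top hl).lt_top (measure_lt_top _ _)

/-- If `μ G κ^in = μ`, then `μ G (κ^in + κ^out) = μ + μ G κ^out = μ G`: invariance at the visits to
the strip becomes invariance at all times. -/
lemma lintegral_gAll_bind (H : IsStepDensity h M η δ) {μ : Measure ℝ}
    (hμ : ∀ φ : ℝ → ℝ≥0∞, Measurable φ → ∫⁻ x, returnOp h a β l φ x ∂μ = ∫⁻ x, φ x ∂μ) (n : ℕ)
    {φ : ℝ → ℝ≥0∞} (hφ : Measurable φ) :
    ∫⁻ x, ∫⁻ y, φ y ∂((stepKernel h (gAll a β l) ^ n) x) ∂(μ.bind (potentialKernel h a l)) =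
      ∫⁻ x, φ x ∂(μ.bind (potentialKernel h a l)) := by
  have hone : ∀ φ : ℝ → ℝ≥0∞, Measurable φ →
      ∫⁻ x, ∫⁻ y, φ y ∂(stepKernel h (gAll a β l) x) ∂(μ.bind (potentialKernel h a l)) =
      ∫⁻ x, φ x ∂(μ.bind (potentialKernel h a l)) := by
    intro φ hφ
    rw [lintegral_bind_potentialKernel μ hφ.lintegral_kernel, lintegral_bind_potentialKernel μ hφ]
    simp_rw [lintegral_gAll H a β l hφ]
    simp_rw [potential_add h a l hφ.lintegral_kernel]
    simp_rw [potential_eq_add' h a l hφ]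
    have h1 := hμ φ hφ
    unfold returnOp at h1
    rw [lintegral_add_left (measurable_potential h a l hφ.lintegral_kernel), h1,
      lintegral_add_left hφ]
  induction n generalizing φ with
  | zero => simp_rw [lintegral_pow_zero _ _ hφ]
  | succ n ih =>
    simp_rw [lintegral_pow_add _ n 1 _ hφ, lintegral_pow_one]
    rw [ih hφ.lintegral_kernel, hone φ hφ]

/-- Filling in the excursions puts no additional mass at or below level `a`: every term of the
potential but the first ends with a step above `a`. -/
lemma lintegral_bind_of_strip (H : IsStepDensity h M η δ) (μ : Measure ℝ) {φ : ℝ → ℝ≥0∞}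
    (hφ : Measurable φ) (h0 : ∀ x, a < x → φ x = 0) :
    ∫⁻ x, φ x ∂(μ.bind (potentialKernel h a l)) = ∫⁻ x, φ x ∂μ := by
  rw [lintegral_bind_potentialKernel μ hφ]
  refine lintegral_congr fun x => ?_
  rw [potential_eq_add' h a l hφ]
  have : ∀ z, ∫⁻ y, φ y ∂(stepKernel h (gOut a l) z) = 0 := fun z => by
    rw [lintegral_gOut_congr H hφ measurable_const h0 z, lintegral_zero]
  simp_rw [this]
  simp [potential]

/-- The rank one limit in terms of an eigenfunction and an invariant measure. -/
lemma RankOneLimit.mul_eq (H : IsStepDensity h M η δ) (hl : 0 < l)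
    (R : RankOneLimit (stepKernel h (gAll a β l)) V Λ ε) {μ : Measure ℝ} [IsFiniteMeasure μ]
    (hμ : ∀ φ : ℝ → ℝ≥0∞, Measurable φ → ∫⁻ x, returnOp h a β l φ x ∂μ = ∫⁻ x, φ x ∂μ)
    {u : ℝ → ℝ≥0∞} (hum : Measurable u) {K : ℝ≥0∞} (hK : K ≠ ∞) (huK : ∀ x, u x ≤ K)
    (hu : ∀ x, returnOp h a β l u x = u x)
    {φ : ℝ → ℝ≥0∞} (hφ : Measurable φ) (hφ1 : ∀ x, φ x ≤ 1) (h0 : ∀ x, a < x → φ x = 0) (x : ℝ) :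
    Λ φ * V x * (∫⁻ y, potential h a l u y ∂μ) = u x * ∫⁻ y, φ y ∂μ := by
  have := isFiniteMeasure_bind_potentialKernel (a := a) H hl μ
  rw [← lintegral_bind_potentialKernel μ hum, ← lintegral_bind_of_strip (a := a) (l := l) H μ hφ h0,
    R.functional_eq hum hK huK fun n => lintegral_gAll_bind H hμ n hum,
    R.functional_eq hφ ENNReal.one_ne_top hφ1 fun n => lintegral_gAll_bind H hμ n hφ,
    R.eq_mul_of_harmonic hum hK huK (harmonic_of_returnOp_eq H hum hu) x]
  ring

/-- The mean return time in terms of the potential. -/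
lemma IsPFPair.meanReturn_eq (W : IsDensityWalk P X h) (H : IsStepDensity h M η δ) (ha : 0 < a)
    {v w : ℝ → ℝ} (hvw : IsPFPair P X a β v w) {u : ℝ → ℝ≥0∞} (hum : Measurable u)
    (huv : ∀ x ∈ Set.Icc 0 a, u x = ENNReal.ofReal (v x))
    (hu : ∀ x, returnOp h a β (freeEnergy P X a β) u x = u x) :
    meanReturn P X a β v w =
      ∫⁻ x, potential h a (freeEnergy P X a β) u x ∂(leftMeasure a w) := by
  set l := freeEnergy P X a β with hl
  have hren : ∀ (k : ℕ), ∀ x ∈ Set.Icc 0 a, renewalKer P X a β v (k + 1) x Set.univ =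
      ENNReal.ofReal (v x)⁻¹ * ∫⁻ z, ∫⁻ y, u y ∂(stepKernel h (gIn a β l) z)
        ∂((stepKernel h (gOut a l) ^ k) x) := by
    intro k x hx
    rw [renewalKer, withDensity_apply _ MeasurableSet.univ, Measure.restrict_univ,
      ← exp_mul_lintegral_excursionKer W H ha β l k hx hum]
    have e : ∀ y ∈ Set.Icc 0 a, ENNReal.ofReal (Real.exp β * Real.exp (-l * ((k + 1 : ℕ) : ℝ)) *
        (v y / v x)) = ENNReal.ofReal (v x)⁻¹ * (ENNReal.ofReal (Real.exp β) *
          (ENNReal.ofReal (Real.exp (-l * ((k + 1 : ℕ) : ℝ))) * u y)) := by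
      intro y hy
      have hvx := hvw.right.pos x hx
      rw [huv y hy, ← ENNReal.ofReal_mul (Real.exp_pos _).le,
        ← ENNReal.ofReal_mul (Real.exp_pos _).le, ← ENNReal.ofReal_mul (inv_pos.2 hvx).le]
      congr 1
      field_simp
    rw [excursionKer, if_pos hx, setLIntegral_congr_fun measurableSet_Icc e,
      lintegral_const_mul' _ _ ENNReal.ofReal_ne_top, lintegral_const_mul' _ _ ENNReal.ofReal_ne_top,
      lintegral_const_mul' _ _ ENNReal.ofReal_ne_top]
  have hsum : ∀ x ∈ Set.Icc 0 a,
      ∑' k : ℕ, ((k + 1 : ℕ) : ℝ≥0∞) * renewalKer P X a β v (k + 1) x Set.univ =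
        ENNReal.ofReal (v x)⁻¹ * potential h a l u x := by
    intro x hx
    -- Substituting `u = G κ^in u` produces a double potential, whose coefficients `k + 1` are
    -- exactly the excursion lengths.
    have e : potential h a l u x = potential h a l (returnOp h a β l u) x :=
      potential_congr_of_forall (fun y => (hu y).symm) x
    rw [e, returnOp, potential_potential h a l hum.lintegral_kernel, ← ENNReal.tsum_mul_left]
    refine tsum_congr fun k => ?_
    rw [hren k x hx]
    ring
  have hvm : AEMeasurable v (volume.restrict (Set.Icc 0 a)) :=
    hvw.right.memLp.aestronglyMeasurable.aemeasurable
  have hwm : AEMeasurable w (volume.restrict (Set.Icc 0 a)) :=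
    hvw.left.memLp.aestronglyMeasurable.aemeasurable
  have hpm := measurable_potential h a l hum
  have hae : (fun x => ∑' k : ℕ, ((k + 1 : ℕ) : ℝ≥0∞) *
      renewalKer P X a β v (k + 1) x Set.univ) =ᵐ[volume.restrict (Set.Icc 0 a)]
        fun x => ENNReal.ofReal (v x)⁻¹ * potential h a l u x := by
    filter_upwards [ae_restrict_mem measurableSet_Icc] with x hx using hsum x hx
  rw [meanReturn, invMeasure, lintegral_withDensity_eq_lintegral_mul₀
    (show AEMeasurable (fun x => ENNReal.ofReal (v x * w x)) (volume.restrict (Set.Icc 0 a)) from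
      (hvm.mul hwm).ennreal_ofReal) ((hvm.inv.ennreal_ofReal.mul hpm.aemeasurable).congr hae.symm),
    hvw.left.lintegral_leftMeasure hpm.aemeasurable]
  refine lintegral_congr_ae ?_
  filter_upwards [hae, ae_restrict_mem measurableSet_Icc] with x hx hxE
  have hvx := hvw.right.pos x hxE
  rw [Pi.mul_apply, hx, ← mul_assoc, mul_comm (v x), ENNReal.ofReal_mul' hvx.le, mul_assoc
    (ENNReal.ofReal (w x)), ← ENNReal.ofReal_mul hvx.le, mul_inv_cancel₀ hvx.ne',
    ENNReal.ofReal_one, mul_one]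

omit [IsProbabilityMeasure P] in
lemma IsPFPair.lintegral_eq_one {v w : ℝ → ℝ} (hvw : IsPFPair P X a β v w) {u : ℝ → ℝ≥0∞}
    (hum : Measurable u) (huv : ∀ x ∈ Set.Icc 0 a, u x = ENNReal.ofReal (v x)) :
    ∫⁻ x, u x ∂(leftMeasure a w) = 1 := by
  rw [hvw.left.lintegral_leftMeasure hum.aemeasurable, ← ENNReal.ofReal_one, ← hvw.normalized,
    ofReal_integral_eq_lintegral_ofReal]
  · refine setLIntegral_congr_fun measurableSet_Icc fun x hx => ?_
    rw [huv x hx, mul_comm (v x), ENNReal.ofReal_mul' (hvw.right.pos x hx).le]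
  · by_contra hcon
    have := hvw.normalized
    rw [integral_undef hcon] at this
    exact zero_ne_one this
  · filter_upwards [hvw.left.pos, ae_restrict_mem measurableSet_Icc] with x hw hx
    exact mul_nonneg (hvw.right.pos x hx).le hw.le

end Identification

/-! ### Existence of the Perron-Frobenius pair -/

section Eigenfunctions

variable {h : ℝ → ℝ} {M η δ : ℝ} {a β l : ℝ}
  {V : ℝ → ℝ≥0∞} {Λ : (ℝ → ℝ≥0∞) → ℝ≥0∞} {ε : ℕ → ℝ≥0∞}

/-- A bound for the total mass of a step of the wetting model. -/
noncomputable def stepBound (β l : ℝ) : ℝ≥0∞ :=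
  ENNReal.ofReal (Real.exp (β - l)) + ENNReal.ofReal (Real.exp (-l))

lemma stepBound_ne_top (β l : ℝ) : stepBound β l ≠ ∞ :=
  ENNReal.add_ne_top.2 ⟨ENNReal.ofReal_ne_top, ENNReal.ofReal_ne_top⟩

lemma RankOneLimit.map_gAll (H : IsStepDensity h M η δ)
    (R : RankOneLimit (stepKernel h (gAll a β l)) V Λ ε) {φ : ℝ → ℝ≥0∞} (hφ : Measurable φ)
    {K : ℝ≥0∞} (hK : K ≠ ∞) (hφK : ∀ x, φ x ≤ K) :
    Λ (fun x => ∫⁻ y, φ y ∂(stepKernel h (gAll a β l) x)) = Λ φ := by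
  refine R.map_kernel hφ (K := K + stepBound β l * K)
    (ENNReal.add_ne_top.2 ⟨hK, ENNReal.mul_ne_top (stepBound_ne_top β l) hK⟩)
    (fun x => (hφK x).trans le_self_add) fun x => ?_
  exact (lintegral_stepKernel_le H (measurable_gAll a β l) (gAll_le a β l) hφ hφK x).trans
    le_add_self

/-- On functions supported in the strip, the limit functional has a bounded density. -/
lemma RankOneLimit.exists_density (H : IsStepDensity h M η δ)
    (R : RankOneLimit (stepKernel h (gAll a β l)) V Λ ε) :
    ∃ w : ℝ → ℝ≥0∞, Measurable w ∧ (∃ C : ℝ≥0∞, C ≠ ∞ ∧ ∀ y, w y ≤ C) ∧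
      ∀ φ : ℝ → ℝ≥0∞, Measurable φ → ∀ K ≠ ∞, (∀ x, φ x ≤ K) → (∀ x ∉ Set.Icc 0 a, φ x = 0) →
        Λ φ = ∫⁻ y, w y * φ y := by
  have hfin := isFiniteKernel_gAll H a β l
  set κ := stepKernel h (gAll a β l) with hκ
  have hh := H.cont.measurable
  have hg := measurable_gAll a β l
  have hpm : Measurable (Function.uncurry fun z y =>
      gAll a β l y * ENNReal.ofReal (h (y - max z 0))) := measurable_stepDensity hh hg
  have hpm' : ∀ y, Measurable fun z => gAll a β l y * ENNReal.ofReal (h (y - max z 0)) :=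
    fun y => hpm.comp (measurable_id.prodMk measurable_const)
  set D : ℝ≥0∞ := stepBound β l * ENNReal.ofReal M with hD
  have hDt : D ≠ ∞ := ENNReal.mul_ne_top (stepBound_ne_top β l) ENNReal.ofReal_ne_top
  have hpD : ∀ y z, gAll a β l y * ENNReal.ofReal (h (y - max z 0)) ≤ D := fun y z =>
    mul_le_mul' (gAll_le a β l y) (ENNReal.ofReal_le_ofReal (H.le _))
  set q : ℕ → ℝ → ℝ≥0∞ := fun N y =>
    ∫⁻ z, gAll a β l y * ENNReal.ofReal (h (y - max z 0)) ∂((κ ^ N) 0) with hq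
  have hqm : ∀ N, Measurable (q N) := fun N => by
    have := isFiniteKernel_pow κ N
    exact Measurable.lintegral_prod_left' hpm
  -- The density at `y` is the limit functional applied to the transition density into `y`.
  -- Measurability in `y` comes from writing it as a pointwise limit of the `q N`.
  set w : ℝ → ℝ≥0∞ := fun y => Λ fun z => gAll a β l y * ENNReal.ofReal (h (y - max z 0)) with hw
  have hqw : ∀ y, Tendsto (fun N => q N y) atTop (𝓝 (w y * V 0)) := fun y =>
    R.tendsto (hpm' y) hDt (hpD y) 0
  have hwm : Measurable w := by
    have h1 : Measurable fun y => w y * V 0 :=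
      measurable_of_tendsto_metrizable hqm (tendsto_pi_nhds.2 hqw)
    have h2 := h1.mul_const (V 0)⁻¹
    simpa only [mul_assoc, ENNReal.mul_inv_cancel (R.V_ne_zero 0) (R.V_ne_top 0), mul_one] using h2
  refine ⟨w, hwm, ⟨Λ fun _ => D, R.ne_top _ measurable_const D hDt fun _ => le_rfl, fun y =>
    R.map_mono (hpm' y) measurable_const hDt (fun _ => le_rfl) (hpD y)⟩, ?_⟩
  intro φ hφ K hK hφK hφE
  have hone := R.tendsto (φ := fun _ => 1) measurable_const ENNReal.one_ne_top (fun _ => le_rfl) 0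
  set B := Λ (fun _ => 1) * V 0 with hB
  have hBt : B ≠ ∞ := ENNReal.mul_ne_top
    (R.ne_top _ measurable_const 1 ENNReal.one_ne_top fun _ => le_rfl) (R.V_ne_top 0)
  have hev : ∀ᶠ N in atTop, (κ ^ N) 0 Set.univ ≤ B + 1 := by
    simp only [lintegral_one] at hone
    exact (hone.eventually_lt_const (ENNReal.lt_add_right hBt one_ne_zero)).mono
      fun N hN => hN.le
  have hstep : ∀ N, ∫⁻ y, φ y ∂((κ ^ (N + 1)) 0) = ∫⁻ y, q N y * φ y := fun N => by
    have := isFiniteKernel_pow κ N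
    rw [lintegral_pow_add κ N 1 0 hφ]
    simp_rw [lintegral_pow_one, hκ, lintegral_stepKernel hh hg hφ]
    rw [lintegral_lintegral_swap]
    · refine lintegral_congr fun y => ?_
      rw [lintegral_mul_const _ (hpm' y)]
    · exact (hpm.mul (hφ.comp measurable_snd)).aemeasurable
  have hlim1 := ((R.tendsto hφ hK hφK 0).comp (tendsto_add_atTop_nat 1)).congr hstep
  -- The support of `φ` in the bounded strip provides an integrable majorant, and the masses of the
  -- powers are eventually bounded because they converge.
  have hlim2 : Tendsto (fun N => ∫⁻ y, q N y * φ y) atTop (𝓝 (∫⁻ y, w y * V 0 * φ y)) := by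
    refine tendsto_lintegral_filter_of_dominated_convergence
      ((Set.Icc 0 a).indicator fun _ => D * (B + 1) * K)
      (Eventually.of_forall fun N => (hqm N).mul hφ) ?_ ?_ ?_
    · filter_upwards [hev] with N hN
      refine Eventually.of_forall fun y => ?_
      by_cases hy : y ∈ Set.Icc 0 a
      · rw [Set.indicator_of_mem hy]
        refine mul_le_mul' ?_ (hφK y)
        calc q N y ≤ ∫⁻ _, D ∂((κ ^ N) 0) := lintegral_mono fun z => hpD y z
          _ = D * (κ ^ N) 0 Set.univ := lintegral_const _
          _ ≤ D * (B + 1) := by gcongr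
      · simp [hφE y hy]
    · rw [lintegral_indicator_const measurableSet_Icc]
      refine ENNReal.mul_ne_top (ENNReal.mul_ne_top (ENNReal.mul_ne_top hDt
        (ENNReal.add_ne_top.2 ⟨hBt, ENNReal.one_ne_top⟩)) hK) ?_
      rw [Real.volume_Icc]
      exact ENNReal.ofReal_ne_top
    · refine Eventually.of_forall fun y => ?_
      exact ENNReal.Tendsto.mul_const (hqw y) (Or.inr (ne_top_of_le_ne_top hK (hφK y)))
  have h1 := tendsto_nhds_unique hlim1 hlim2
  have h2 : ∫⁻ y, w y * V 0 * φ y = (∫⁻ y, w y * φ y) * V 0 := by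
    rw [← lintegral_mul_const _ (show Measurable fun y => w y * φ y from hwm.mul hφ)]
    exact lintegral_congr fun y => by ring
  rw [h2] at h1
  exact (ENNReal.mul_left_inj (R.V_ne_zero 0) (R.V_ne_top 0)).1 h1

lemma exists_returnOp_le (H : IsStepDensity h M η δ) (hl : 0 < l) {φ : ℝ → ℝ≥0∞}
    (hφ : Measurable φ) {K : ℝ≥0∞} (hK : K ≠ ∞) (hφK : ∀ x, φ x ≤ K) :
    ∃ D : ℝ≥0∞, D ≠ ∞ ∧ ∀ x, returnOp h a β l φ x ≤ D := by
  refine ⟨_, ENNReal.mul_ne_top (potentialBound_ne_top hl) (ENNReal.mul_ne_top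
      (ENNReal.mul_ne_top ENNReal.ofReal_ne_top ENNReal.ofReal_ne_top) ?_), returnOp_le H hφ⟩
  refine ne_top_of_le_ne_top ?_ (lintegral_mono hφK)
  rw [setLIntegral_const, Real.volume_Icc]
  exact ENNReal.mul_ne_top hK ENNReal.ofReal_ne_top

/-- The limit functional restricted to the strip is invariant under the return operator. -/
lemma RankOneLimit.map_returnOp (H : IsStepDensity h M η δ) (hl : 0 < l)
    (R : RankOneLimit (stepKernel h (gAll a β l)) V Λ ε) {φ : ℝ → ℝ≥0∞} (hφ : Measurable φ)
    {K : ℝ≥0∞} (hK : K ≠ ∞) (hφK : ∀ x, φ x ≤ K) (hφE : ∀ x ∉ Set.Icc 0 a, φ x = 0) :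
    Λ ((Set.Icc 0 a).indicator (returnOp h a β l φ)) = Λ φ := by
  set E := Set.Icc (0 : ℝ) a with hE
  have hEm : MeasurableSet E := measurableSet_Icc
  set u := returnOp h a β l φ with hu
  have hum : Measurable u := measurable_returnOp h a β l hφ
  obtain ⟨D, hDt, huD⟩ := exists_returnOp_le (a := a) (β := β) H hl hφ hK hφK
  have hin : ∀ x, E.indicator u x ≤ D := fun x => (Set.indicator_le_self' (fun _ _ => zero_le) x).trans
    (huD x)
  have hout : ∀ x, Eᶜ.indicator u x ≤ D := fun x =>
    (Set.indicator_le_self' (fun _ _ => zero_le) x).trans (huD x)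
  have e1 : ∀ x, ∫⁻ y, φ y ∂(stepKernel h (gIn a β l) x) =
      ∫⁻ y, φ y ∂(stepKernel h (gAll a β l) x) := fun x => by
    rw [lintegral_gAll H a β l hφ, lintegral_gOut_congr H hφ (ψ := fun _ => 0) measurable_const
      (fun y hy => hφE y fun hyE => absurd hyE.2 (not_le.2 hy)), lintegral_zero, add_zero]
  -- The full kernel charges only `[0, ∞)`, where the complement of the strip is `(a, ∞)`.
  have e2 : ∀ x, ∫⁻ y, u y ∂(stepKernel h (gOut a l) x) =
      ∫⁻ y, Eᶜ.indicator u y ∂(stepKernel h (gAll a β l) x) := fun x => by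
    have hm := hum.indicator hEm.compl
    rw [lintegral_gAll H a β l hm, lintegral_gIn_congr H hm (ψ := fun _ => 0) measurable_const,
      lintegral_zero, zero_add]
    · refine lintegral_gOut_congr H hum hm (fun y hy => ?_) x
      have : y ∈ Eᶜ := fun hyE => absurd hyE.2 (not_le.2 hy)
      rw [Set.indicator_of_mem this]
    · filter_upwards [ae_restrict_mem measurableSet_Icc] with y hy
      exact Set.indicator_of_notMem (Set.notMem_compl_iff.2 hy) _
  have e3 : u = fun x => ∫⁻ y, φ y ∂(stepKernel h (gAll a β l) x) +
      ∫⁻ y, Eᶜ.indicator u y ∂(stepKernel h (gAll a β l) x) := by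
    funext x
    rw [← e1, ← e2]
    exact returnOp_eq_add h a β l hφ x
  have hb : ∀ x, ∫⁻ y, φ y ∂(stepKernel h (gAll a β l) x) ≤ D := fun x =>
    le_self_add.trans ((congrFun e3 x).symm.le.trans (huD x))
  have hb' : ∀ x, ∫⁻ y, Eᶜ.indicator u y ∂(stepKernel h (gAll a β l) x) ≤ D := fun x =>
    le_add_self.trans ((congrFun e3 x).symm.le.trans (huD x))
  -- `Λ` is invariant under the full kernel, so both decompositions of `Λ u` contain the exterior
  -- part, which is finite and cancels.
  have h1 : Λ u = Λ φ + Λ (Eᶜ.indicator u) := by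
    conv_lhs => rw [e3]
    rw [R.map_add hφ.lintegral_kernel (hum.indicator hEm.compl).lintegral_kernel hDt hb hb',
      R.map_gAll H hφ hK hφK, R.map_gAll H (hum.indicator hEm.compl) hDt hout]
  have h2 : Λ u = Λ (E.indicator u) + Λ (Eᶜ.indicator u) := by
    rw [← R.map_add (hum.indicator hEm) (hum.indicator hEm.compl) hDt hin hout]
    congr 1
    exact (Set.indicator_self_add_compl E u).symm
  rw [h1] at h2
  exact ((ENNReal.add_left_inj (R.ne_top _ (hum.indicator hEm.compl) D hDt hout)).1 h2).symm

/-- If the strip had no limiting mass, one more step would multiply the total limiting mass by at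
most `e^{-l} < 1`, although that mass is invariant, positive and finite. -/
lemma RankOneLimit.map_strip_ne_zero (H : IsStepDensity h M η δ) (hl : 0 < l)
    (R : RankOneLimit (stepKernel h (gAll a β l)) V Λ ε) :
    Λ ((Set.Icc 0 a).indicator fun _ => 1) ≠ 0 := by
  intro hz
  have hEm : MeasurableSet (Set.Icc (0 : ℝ) a) := measurableSet_Icc
  have h1m : Measurable ((Set.Icc (0 : ℝ) a).indicator fun _ => (1 : ℝ≥0∞)) :=
    measurable_const.indicator hEm
  have h11 : ∀ x, (Set.Icc (0 : ℝ) a).indicator (fun _ => (1 : ℝ≥0∞)) x ≤ 1 := fun x =>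
    Set.indicator_le_self' (fun _ _ => zero_le) x
  set T := Λ fun _ => 1 with hT
  have hTt : T ≠ ∞ := R.ne_top _ measurable_const 1 ENNReal.one_ne_top fun _ => le_rfl
  have hT1 : 1 ≤ T := R.one_le_map_one
  have hs : ENNReal.ofReal (Real.exp (-l)) ≤ 1 := (ofReal_exp_neg_lt_one hl).le
  set K := stepBound β l + 1 with hK
  have hKt : K ≠ ∞ := ENNReal.add_ne_top.2 ⟨stepBound_ne_top β l, ENNReal.one_ne_top⟩
  have hle : ∀ x, ∫⁻ _, 1 ∂(stepKernel h (gAll a β l) x) ≤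
      ∫⁻ y, (Set.Icc 0 a).indicator (fun _ => 1) y ∂(stepKernel h (gAll a β l) x) +
        ENNReal.ofReal (Real.exp (-l)) * 1 := fun x => by
    rw [lintegral_gAll H a β l measurable_const, lintegral_gAll H a β l h1m]
    refine add_le_add ?_ (lintegral_stepKernel_le H (measurable_gOut a l) (gOut_le a l)
      measurable_const (fun _ => le_rfl) x)
    refine le_trans (le_of_eq ?_) le_self_add
    refine lintegral_gIn_congr H measurable_const h1m ?_ x
    filter_upwards [ae_restrict_mem measurableSet_Icc] with y hy
    rw [Set.indicator_of_mem hy]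
  have hb : ∀ x, ∫⁻ y, (Set.Icc 0 a).indicator (fun _ => 1) y ∂(stepKernel h (gAll a β l) x) ≤ K :=
    fun x => (lintegral_stepKernel_le H (measurable_gAll a β l) (gAll_le a β l) h1m h11 x).trans
      (by rw [mul_one]; exact le_self_add)
  have hc : ∀ _ : ℝ, ENNReal.ofReal (Real.exp (-l)) * 1 ≤ K := fun _ => by
    rw [mul_one]; exact hs.trans le_add_self
  have hfin : T ≤ ENNReal.ofReal (Real.exp (-l)) * T := by
    calc T = Λ fun x => ∫⁻ _, 1 ∂(stepKernel h (gAll a β l) x) :=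
          (R.map_gAll H measurable_const ENNReal.one_ne_top fun _ => le_rfl).symm
      _ ≤ _ := R.map_mono (measurable_const.lintegral_kernel)
          (show Measurable fun x => ∫⁻ y, (Set.Icc 0 a).indicator (fun _ => 1) y
            ∂(stepKernel h (gAll a β l) x) + ENNReal.ofReal (Real.exp (-l)) * 1 from
            h1m.lintegral_kernel.add measurable_const) (ENNReal.add_ne_top.2 ⟨hKt, hKt⟩)
          (fun x => add_le_add (hb x) (hc x)) hle
      _ = ENNReal.ofReal (Real.exp (-l)) * T := by
          rw [R.map_add h1m.lintegral_kernel measurable_const hKt hb hc,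
            R.map_gAll H h1m ENNReal.one_ne_top h11, hz, zero_add,
            R.map_const_mul measurable_const ENNReal.one_ne_top (fun _ => le_rfl)
              ENNReal.ofReal_ne_top]
  have : ENNReal.ofReal (Real.exp (-l)) * T < 1 * T :=
    ENNReal.mul_lt_mul_left (one_pos.trans_le hT1).ne' hTt (ofReal_exp_neg_lt_one hl)
  rw [one_mul] at this
  exact absurd hfin (not_le.2 this)

/-- From any point of the strip, `m` further steps reach `A` with mass at least `c` times its
volume, so the limiting mass of `A` is at least `c * volume A` times that of the strip. This gives
both the positivity of the left eigenfunction and the degenerate case of the asymptotics. -/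
lemma RankOneLimit.volume_eq_zero (H : IsStepDensity h M η δ) (hl : 0 < l)
    (R : RankOneLimit (stepKernel h (gAll a β l)) V Λ ε) {A : Set ℝ} (hA : MeasurableSet A)
    (hAE : A ⊆ Set.Icc 0 a) (h0 : Λ (A.indicator fun _ => 1) = 0) : volume A = 0 := by
  obtain ⟨m, -, c, hc0, hct, hmin⟩ := exists_minorization_gAll H a β l a
  set κ := stepKernel h (gAll a β l) with hκ
  have hEm : MeasurableSet (Set.Icc (0 : ℝ) a) := measurableSet_Icc
  have hm : ∀ {s : Set ℝ}, MeasurableSet s → Measurable (s.indicator fun _ => (1 : ℝ≥0∞)) :=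
    fun hs => measurable_const.indicator hs
  have h1 : ∀ (s : Set ℝ) x, s.indicator (fun _ => (1 : ℝ≥0∞)) x ≤ 1 := fun s x =>
    Set.indicator_le_self' (fun _ _ => zero_le) x
  have hAt : volume A ≠ ∞ := by
    refine ne_top_of_le_ne_top ?_ (measure_mono hAE)
    rw [Real.volume_Icc]
    exact ENNReal.ofReal_ne_top
  have hle : ∀ n, c * volume A * ∫⁻ y, (Set.Icc 0 a).indicator (fun _ => 1) y ∂((κ ^ n) 0) ≤
      ∫⁻ y, A.indicator (fun _ => 1) y ∂((κ ^ (n + m)) 0) := fun n => by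
    rw [lintegral_pow_add κ n m 0 (hm hA), ← lintegral_const_mul _ (hm hEm)]
    refine lintegral_mono fun z => ?_
    by_cases hz : z ∈ Set.Icc 0 a
    · have := hmin _ (hm hA) z hz.2
      rw [lintegral_indicator_const hA, Measure.restrict_apply hA, one_mul,
        Set.inter_eq_left.2 hAE] at this
      simpa [Set.indicator_of_mem hz] using this
    · simp [Set.indicator_of_notMem hz]
  have t1 := ENNReal.Tendsto.const_mul (a := c * volume A)
    (R.tendsto (hm hEm) ENNReal.one_ne_top (h1 _) 0) (Or.inr (ENNReal.mul_ne_top hct hAt))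
  have t2 := (R.tendsto (hm hA) ENNReal.one_ne_top (h1 _) 0).comp (tendsto_add_atTop_nat m)
  have h2 := le_of_tendsto_of_tendsto' t1 t2 hle
  rw [h0, zero_mul, nonpos_iff_eq_zero, mul_eq_zero, mul_eq_zero, mul_eq_zero] at h2
  rcases h2 with (h2 | h2) | h2 | h2
  · exact absurd h2 hc0
  · exact h2
  · exact absurd h2 (R.map_strip_ne_zero H hl)
  · exact absurd h2 (R.V_ne_zero 0)

variable {Ω : Type*} [MeasurableSpace Ω] {P : Measure Ω} [IsProbabilityMeasure P]
  {X : ℕ → Ω → ℝ}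

/-- The left eigenfunction is the density of `Λ` on the strip, the right one is `V` divided by `Z =
Λ (1_E V)`, which gives the normalization. -/
lemma RankOneLimit.exists_isPFPair (W : IsDensityWalk P X h) (H : IsStepDensity h M η δ)
    (ha : 0 < a) (hl : 0 < freeEnergy P X a β)
    (R : RankOneLimit (stepKernel h (gAll a β (freeEnergy P X a β))) V Λ ε) :
    ∃ v w : ℝ → ℝ, IsPFPair P X a β v w := by
  set l := freeEnergy P X a β with hldef
  have hρ := kernelSpectralRadius_laplaceKer W H ha hl R
  set E := Set.Icc (0 : ℝ) a with hE
  have hEm : MeasurableSet E := measurableSet_Icc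
  obtain ⟨w, hwm, ⟨C, hCt, hwC⟩, hw⟩ := R.exists_density H
  have hwt : ∀ y, w y ≠ ∞ := fun y => ne_top_of_le_ne_top hCt (hwC y)
  have h1 : ∀ (s : Set ℝ) x, s.indicator (fun _ => (1 : ℝ≥0∞)) x ≤ 1 := fun s x =>
    Set.indicator_le_self' (fun _ _ => zero_le) x
  have hwA : ∀ A, MeasurableSet A → A ⊆ E → Λ (A.indicator fun _ => 1) = ∫⁻ y in A, w y := by
    intro A hA hAE
    rw [hw _ (measurable_const.indicator hA) 1 ENNReal.one_ne_top (h1 A)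
      fun x hx => Set.indicator_of_notMem (fun hc => hx (hAE hc)) _, ← lintegral_indicator hA]
    refine lintegral_congr fun y => ?_
    by_cases hy : y ∈ A <;> simp [hy]
  have hVE : ∀ x, E.indicator V x ≤ 1 := fun x =>
    (Set.indicator_le_self' (fun _ _ => zero_le) x).trans (R.V_le x)
  have hVEm := R.V_meas.indicator hEm
  set Z := Λ (E.indicator V) with hZ
  have hZt : Z ≠ ∞ := R.ne_top _ hVEm 1 ENNReal.one_ne_top hVE
  obtain ⟨c, hc0, hc⟩ := R.exists_lower H ha a
  have hct : c ≠ ∞ := ne_top_of_le_ne_top (R.V_ne_top a) (hc a le_rfl)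
  have hZ0 : Z ≠ 0 := by
    have : c * Λ (E.indicator fun _ => 1) ≤ Z := by
      rw [← R.map_const_mul (measurable_const.indicator hEm) ENNReal.one_ne_top (h1 E) hct]
      refine R.map_mono ((measurable_const.indicator hEm).const_mul c) hVEm ENNReal.one_ne_top hVE
        fun x => ?_
      by_cases hx : x ∈ E
      · simpa [hx] using hc x hx.2
      · simp [hx]
    exact ((ENNReal.mul_pos hc0 (R.map_strip_ne_zero H hl)).trans_le this).ne'
  have hZr : 0 < Z.toReal := ENNReal.toReal_pos hZ0 hZt
  have hVr : ∀ x, 0 < (V x).toReal := fun x => ENNReal.toReal_pos (R.V_ne_zero x) (R.V_ne_top x)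
  have hv : ∀ x, ENNReal.ofReal ((V x).toReal / Z.toReal) = Z⁻¹ * V x := fun x => by
    rw [ENNReal.ofReal_div_of_pos hZr, ENNReal.ofReal_toReal (R.V_ne_top x),
      ENNReal.ofReal_toReal hZt, div_eq_mul_inv, mul_comm]
  refine ⟨fun x => (V x).toReal / Z.toReal, fun x => (w x).toReal, ⟨?_, ?_, ?_⟩, ⟨?_, ?_, ?_⟩, ?_⟩
  · refine MemLp.of_bound (R.V_meas.ennreal_toReal.div_const _).aestronglyMeasurable
      (1 / Z.toReal) (Eventually.of_forall fun x => ?_)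
    rw [Real.norm_of_nonneg (div_nonneg (hVr x).le hZr.le)]
    have : (V x).toReal ≤ 1 := ENNReal.toReal_le_of_le_ofReal zero_le_one (by simpa using R.V_le x)
    gcongr
  · exact fun x _ => div_pos (hVr x) hZr
  · intro x hx
    simp_rw [hv]
    rw [laplaceKer_eq W H ha hx, lintegral_const_mul _ R.V_meas, lintegral_returnKernel (β := β) H
      R.V_meas, returnOp_eq_of_harmonic H hl R.V_meas ENNReal.one_ne_top R.V_le R.harmonic, hρ]
    ring
  · refine MemLp.of_bound hwm.ennreal_toReal.aestronglyMeasurable C.toReal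
      (Eventually.of_forall fun x => ?_)
    rw [Real.norm_of_nonneg ENNReal.toReal_nonneg]
    exact ENNReal.toReal_mono hCt (hwC x)
  · have hNm : MeasurableSet (E ∩ {y | w y = 0}) := hEm.inter (hwm (measurableSet_singleton 0))
    -- `Λ` vanishes on the zero set of its own density, so this set is null.
    have hN := R.volume_eq_zero H hl hNm Set.inter_subset_left (by
      rw [hwA _ hNm Set.inter_subset_left]
      exact (setLIntegral_congr_fun hNm fun y hy => hy.2).trans (by simp))
    rw [ae_restrict_iff' hEm]
    have hae : ∀ᵐ y : ℝ, y ∉ E ∩ {y | w y = 0} := measure_eq_zero_iff_ae_notMem.1 hN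
    filter_upwards [hae] with y hy hyE
    exact ENNReal.toReal_pos (fun h0 => hy ⟨hyE, h0⟩) (hwt y)
  · intro A hA hAE
    simp_rw [ENNReal.ofReal_toReal (hwt _)]
    have hAm : Measurable (A.indicator fun _ => (1 : ℝ≥0∞)) := measurable_const.indicator hA
    have hA0 : ∀ x ∉ E, A.indicator (fun _ => (1 : ℝ≥0∞)) x = 0 := fun x hx =>
      Set.indicator_of_notMem (fun hc => hx (hAE hc)) _
    have hum := measurable_returnOp h a β l hAm
    obtain ⟨D, hDt, hub⟩ := exists_returnOp_le (a := a) (β := β) H hl hAm ENNReal.one_ne_top (h1 A)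
    have e1 := R.map_returnOp H hl hAm ENNReal.one_ne_top (h1 A) hA0
    rw [hwA A hA hAE, hw _ (hum.indicator hEm) D hDt
      (fun x => (Set.indicator_le_self' (fun _ _ => zero_le) x).trans (hub x))
      (fun x hx => Set.indicator_of_notMem hx _)] at e1
    rw [hρ, ← e1, ← lintegral_const_mul _ (show Measurable fun y => w y *
      (Set.Icc 0 a).indicator (returnOp h a β l (A.indicator fun _ => 1)) y from
        hwm.mul (hum.indicator hEm)), ← lintegral_indicator hEm]
    refine lintegral_congr fun x => ?_
    by_cases hx : x ∈ E
    · rw [Set.indicator_of_mem hx, Set.indicator_of_mem hx, laplaceKer_eq W H ha hx]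
      have e2 := lintegral_returnKernel (a := a) (l := l) (β := β) H hAm x
      rw [lintegral_indicator_const hA, one_mul] at e2
      rw [e2]
      ring
    · rw [Set.indicator_of_notMem hx, Set.indicator_of_notMem hx, mul_zero, mul_zero]
  · have hwV : ∫⁻ x in E, w x * V x = Z := by
      rw [hZ, hw _ hVEm 1 ENNReal.one_ne_top hVE fun x hx => Set.indicator_of_notMem hx _,
        ← lintegral_indicator hEm]
      refine lintegral_congr fun x => ?_
      by_cases hx : x ∈ E <;> simp [hx]
    rw [integral_eq_lintegral_of_nonneg_ae (Eventually.of_forall fun x =>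
        mul_nonneg (div_pos (hVr x) hZr).le ENNReal.toReal_nonneg)
      ((R.V_meas.ennreal_toReal.div_const _).mul hwm.ennreal_toReal).aestronglyMeasurable]
    have e : ∀ x, ENNReal.ofReal ((V x).toReal / Z.toReal * (w x).toReal) =
        Z⁻¹ * (w x * V x) := fun x => by
      rw [ENNReal.ofReal_mul (div_pos (hVr x) hZr).le, hv, ENNReal.ofReal_toReal (hwt x)]
      ring
    simp_rw [e]
    rw [lintegral_const_mul _ (show Measurable fun x => w x * V x from hwm.mul R.V_meas), hwV,
      ENNReal.inv_mul_cancel hZ0 hZt, ENNReal.toReal_one]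

end Eigenfunctions

/-! ### Sharp asymptotics of the partition functions -/

section Asymptotics

lemma isEquivalent_mul_exp {u : ℕ → ℝ} {F C : ℝ} (hC : C ≠ 0)
    (hu : Tendsto (fun N : ℕ => Real.exp (-F * N) * u N) atTop (𝓝 C)) :
    u ~[atTop] fun N : ℕ => C * Real.exp (F * N) := by
  have h1 := ((isEquivalent_const_iff_tendsto hC).2 hu).mul
    (IsEquivalent.refl (u := fun N : ℕ => Real.exp (F * N)) (l := atTop))
  refine h1.congr_left (Eventually.of_forall fun N => ?_)
  have : Real.exp (-F * N) * Real.exp (F * N) = 1 := by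
    rw [← Real.exp_add]
    simp
  calc Real.exp (-F * N) * u N * Real.exp (F * N)
      = Real.exp (-F * N) * Real.exp (F * N) * u N := by ring
    _ = u N := by rw [this, one_mul]

lemma tendsto_log_div {u : ℕ → ℝ} {F C : ℝ} (hC : 0 < C) (hpos : ∀ N, 0 < u N)
    (hu : Tendsto (fun N : ℕ => Real.exp (-F * N) * u N) atTop (𝓝 C)) :
    Tendsto (fun N : ℕ => 1 / (N : ℝ) * Real.log (u N)) atTop (𝓝 F) := by
  have h1 := (Real.continuousAt_log hC.ne').tendsto.comp hu
  have h2 := (tendsto_one_div_atTop_nhds_zero_nat (𝕜 := ℝ)).mul h1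
  have h3 := h2.add_const F
  rw [zero_mul, zero_add] at h3
  refine h3.congr' ?_
  filter_upwards [eventually_ge_atTop 1] with N hN
  have hN' : (N : ℝ) ≠ 0 := by positivity
  rw [Function.comp_apply, Real.log_mul (Real.exp_pos _).ne' (hpos N).ne', Real.log_exp]
  field_simp
  ring

variable {h : ℝ → ℝ} {M η δ : ℝ} {a β : ℝ}
  {V : ℝ → ℝ≥0∞} {Λ : (ℝ → ℝ≥0∞) → ℝ≥0∞} {ε : ℕ → ℝ≥0∞}

lemma exp_mul_pow_apply (H : IsStepDensity h M η δ) (a β l : ℝ) {A : Set ℝ} (hA : MeasurableSet A)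
    (N : ℕ) (x : ℝ) : ENNReal.ofReal (Real.exp (-l * N)) * (stepKernel h (gAll a β 0) ^ N) x A =
      ∫⁻ y, A.indicator (fun _ => 1) y ∂((stepKernel h (gAll a β l) ^ N) x) := by
  rw [lintegral_gAll_pow H a β l (measurable_const.indicator hA), lintegral_indicator_const hA,
    one_mul, ← ENNReal.ofReal_pow (Real.exp_pos _).le, ← Real.exp_nat_mul, mul_comm (N : ℝ)]

lemma tendsto_exp_mul_real (H : IsStepDensity h M η δ) {l : ℝ}
    (R : RankOneLimit (stepKernel h (gAll a β l)) V Λ ε) {A : Set ℝ} (hA : MeasurableSet A)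
    (x : ℝ) : Tendsto (fun N : ℕ => Real.exp (-l * N) * ((stepKernel h (gAll a β 0) ^ N) x).real A)
      atTop (𝓝 (Λ (A.indicator fun _ => 1) * V x).toReal) := by
  have h1 : ∀ x, A.indicator (fun _ => (1 : ℝ≥0∞)) x ≤ 1 := fun x =>
    Set.indicator_le_self' (fun _ _ => zero_le) x
  have hm : Measurable (A.indicator fun _ => (1 : ℝ≥0∞)) := measurable_const.indicator hA
  have ht := (ENNReal.tendsto_toReal (ENNReal.mul_ne_top (R.ne_top _ hm 1 ENNReal.one_ne_top h1)
    (R.V_ne_top x))).comp (R.tendsto hm ENNReal.one_ne_top h1 x)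
  refine ht.congr fun N => ?_
  rw [Function.comp_apply, ← exp_mul_pow_apply H a β l hA, ENNReal.toReal_mul,
    ENNReal.toReal_ofReal (Real.exp_pos _).le, measureReal_def]

/-- Needed for equivalence to the zero sequence, where the partition kernel must vanish exactly on
null sets from time `1` on. -/
lemma pow_succ_absolutelyContinuous (h : ℝ → ℝ) (g : ℝ → ℝ≥0∞) (N : ℕ) (x : ℝ) :
    (stepKernel h g ^ (N + 1)) x ≪ volume := by
  refine Measure.AbsolutelyContinuous.mk fun s hs h0 => ?_
  have := lintegral_pow_add (stepKernel h g) N 1 x (φ := s.indicator fun _ => 1)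
    (measurable_const.indicator hs)
  simp_rw [lintegral_pow_one, lintegral_indicator_const hs, one_mul] at this
  rw [this]
  simp_rw [stepKernel_absolutelyContinuous _ h0]
  exact lintegral_zero

variable {Ω : Type*} [MeasurableSpace Ω] {P : Measure Ω} [IsProbabilityMeasure P]
  {X : ℕ → Ω → ℝ}

lemma RankOneLimit.exists_Zc_equivalent (W : IsDensityWalk P X h) (H : IsStepDensity h M η δ)
    (ha : 0 < a) {l : ℝ} (hl : 0 < l)
    (R : RankOneLimit (stepKernel h (gAll a β l)) V Λ ε) :
    ∃ C : ℝ, 0 < C ∧ Zc P X a β ~[atTop] fun N : ℕ => C * Real.exp (l * N) := by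
  have ht := tendsto_exp_mul_real H R (measurableSet_Icc (a := (0 : ℝ)) (b := a)) 0
  simp_rw [← Zc_eq W H ha β] at ht
  have hC : 0 < (Λ ((Set.Icc 0 a).indicator fun _ => 1) * V 0).toReal :=
    ENNReal.toReal_pos (mul_ne_zero (R.map_strip_ne_zero H hl) (R.V_ne_zero 0))
      (ENNReal.mul_ne_top (R.ne_top _ (measurable_const.indicator measurableSet_Icc) 1
        ENNReal.one_ne_top fun x => Set.indicator_le_self' (fun _ _ => zero_le) x) (R.V_ne_top 0))
  exact ⟨_, hC, isEquivalent_mul_exp hC.ne' ht⟩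

lemma RankOneLimit.exists_tendsto_Zf (W : IsDensityWalk P X h) (H : IsStepDensity h M η δ)
    (ha : 0 < a) {l : ℝ} (R : RankOneLimit (stepKernel h (gAll a β l)) V Λ ε) :
    ∃ C : ℝ, 0 < C ∧ Tendsto (fun N : ℕ => Real.exp (-l * N) * Zf P X a β N) atTop (𝓝 C) := by
  have ht := tendsto_exp_mul_real H R MeasurableSet.univ 0
  simp_rw [← Zf_eq W H ha β] at ht
  refine ⟨_, ENNReal.toReal_pos (mul_ne_zero ?_ (R.V_ne_zero 0)) (ENNReal.mul_ne_top ?_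
    (R.V_ne_top 0)), ht⟩
  all_goals rw [Set.indicator_univ]
  · exact (one_pos.trans_le R.one_le_map_one).ne'
  · exact R.ne_top _ measurable_const 1 ENNReal.one_ne_top fun _ => le_rfl

omit [IsProbabilityMeasure P] in
lemma limitMeasure_apply {v w : ℝ → ℝ} (hvw : IsPFPair P X a β v w)
    (hC : 0 < (meanReturn P X a β v w).toReal) {x : ℝ} (hx : x ∈ Set.Icc 0 a) {A : Set ℝ}
    (hA : MeasurableSet A) : limitMeasure P X a β v w x A =
      ENNReal.ofReal (v x) * leftMeasure a w A / meanReturn P X a β v w := by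
  have hCt : meanReturn P X a β v w ≠ ∞ := fun hc => by simp [hc] at hC
  have e : ∀ y, ENNReal.ofReal (v x * w y / (meanReturn P X a β v w).toReal) =
      ENNReal.ofReal (v x) / meanReturn P X a β v w * ENNReal.ofReal (w y) := fun y => by
    rw [ENNReal.ofReal_div_of_pos hC, ENNReal.ofReal_toReal hCt,
      ENNReal.ofReal_mul (hvw.right.pos x hx).le, ENNReal.div_eq_inv_mul, ENNReal.div_eq_inv_mul,
      mul_assoc]
  have hfin : ENNReal.ofReal (v x) / meanReturn P X a β v w ≠ ∞ :=
    ENNReal.div_ne_top ENNReal.ofReal_ne_top fun h0 => by simp [h0] at hC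
  rw [limitMeasure, withDensity_apply _ hA, leftMeasure, withDensity_apply _ hA]
  simp_rw [e]
  rw [lintegral_const_mul' _ _ hfin, ENNReal.div_eq_inv_mul, ENNReal.div_eq_inv_mul, mul_assoc]

/-- The constrained partition kernel converges to the product of the eigenfunctions. -/
lemma IsPFPair.tendsto_kernel (W : IsDensityWalk P X h) (H : IsStepDensity h M η δ)
    (ha : 0 < a) (hl : 0 < freeEnergy P X a β)
    (R : RankOneLimit (stepKernel h (gAll a β (freeEnergy P X a β))) V Λ ε) {v w : ℝ → ℝ}
    (hvw : IsPFPair P X a β v w) :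
    0 < meanReturn P X a β v w ∧ meanReturn P X a β v w < ∞ ∧
      ∀ x ∈ Set.Icc (0 : ℝ) a,
        Tendsto (fun N : ℕ => tvDist
          (ENNReal.ofReal (Real.exp (-freeEnergy P X a β * N)) • ZcKer P X a β N x)
          (limitMeasure P X a β v w x)) atTop (𝓝 0) ∧
        ∀ A : Set ℝ, MeasurableSet A →
          (fun N : ℕ => (ZcKer P X a β N x).real A) ~[atTop]
            fun N : ℕ => (limitMeasure P X a β v w x).real A *
              Real.exp (freeEnergy P X a β * N) := by
  have hρ := kernelSpectralRadius_laplaceKer W H ha hl R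
  obtain ⟨u, K, hum, hK, huK, huv, hu⟩ := hvw.right.exists_extension W H ha hl hρ
  have hfin := hvw.left.isFiniteMeasure
  have hμ : ∀ φ : ℝ → ℝ≥0∞, Measurable φ →
      ∫⁻ x, returnOp h a β (freeEnergy P X a β) φ x ∂(leftMeasure a w) =
        ∫⁻ x, φ x ∂(leftMeasure a w) := fun φ hφ => hvw.left.lintegral_returnOp W H ha hρ hφ
  have hmean := hvw.meanReturn_eq W H ha hum huv hu
  set l := freeEnergy P X a β with hldef
  set C := meanReturn P X a β v w with hCdef
  -- The zeroth term of the potential alone gives the integral of `v * w`, which is `1`.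
  have hC1 : 1 ≤ C := by
    rw [hmean, ← hvw.lintegral_eq_one hum huv]
    refine lintegral_mono fun x => ?_
    rw [potential_eq_add h a l hum x]
    exact le_self_add
  have hCt : C ≠ ∞ := by
    rw [hmean]
    refine ne_top_of_le_ne_top ?_ (lintegral_mono fun x => potential_le H hum huK x)
    rw [lintegral_const]
    exact ENNReal.mul_ne_top (ENNReal.mul_ne_top (potentialBound_ne_top hl) hK)
      (measure_ne_top _ _)
  have hC0 : C ≠ 0 := (one_pos.trans_le hC1).ne'
  have hCr : 0 < C.toReal := ENNReal.toReal_pos hC0 hCt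
  refine ⟨one_pos.trans_le hC1, hCt.lt_top, fun x hx => ?_⟩
  have hEm : MeasurableSet (Set.Icc (0 : ℝ) a) := measurableSet_Icc
  have h1 : ∀ (s : Set ℝ) x, s.indicator (fun _ => (1 : ℝ≥0∞)) x ≤ 1 := fun s x =>
    Set.indicator_le_self' (fun _ _ => zero_le) x
  -- Where the abstract limit is identified: the exterior plays no role for functions supported in
  -- the strip, and the normalizing integral is the mean return time.
  have hlimit : ∀ A, MeasurableSet A → limitMeasure P X a β v w x A =
      Λ ((A ∩ Set.Icc 0 a).indicator fun _ => 1) * V x := by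
    intro A hA
    have hAE := hA.inter hEm
    have e := R.mul_eq H hl hμ hum hK huK hu (φ := (A ∩ Set.Icc 0 a).indicator fun _ => 1)
      (measurable_const.indicator hAE) (h1 _)
      (fun y hy => Set.indicator_of_notMem (fun hc => absurd hc.2.2 (not_le.2 hy)) _) x
    rw [lintegral_indicator_const hAE, one_mul, huv x hx, ← hmean] at e
    have hAμ : leftMeasure a w (A ∩ Set.Icc 0 a) = leftMeasure a w A := by
      rw [leftMeasure, withDensity_apply _ hA, withDensity_apply _ hAE,
        Measure.restrict_restrict hA, Measure.restrict_restrict hAE, Set.inter_assoc, Set.inter_self]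
    rw [limitMeasure_apply hvw hCr hx hA, ← hAμ, ← e, ← hCdef, ENNReal.mul_div_cancel_right hC0 hCt]
  have hker : ∀ (N : ℕ) A, MeasurableSet A →
      (ENNReal.ofReal (Real.exp (-l * N)) • ZcKer P X a β N x) A =
        ∫⁻ y, (A ∩ Set.Icc 0 a).indicator (fun _ => 1) y ∂((stepKernel h (gAll a β l) ^ N) x) := by
    intro N A hA
    rw [Measure.smul_apply, smul_eq_mul, ZcKer_apply W H ha β N hx.1 hA,
      exp_mul_pow_apply H a β l (hA.inter hEm)]
  constructor
  · refine tendsto_of_tendsto_of_tendsto_of_le_of_le tendsto_const_nhds R.tendsto_eps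
      (fun _ => zero_le) fun N => ?_
    refine iSup₂_le fun A hA => ?_
    have hm : Measurable ((A ∩ Set.Icc 0 a).indicator fun _ => (1 : ℝ≥0∞)) :=
      measurable_const.indicator (hA.inter hEm)
    have hup := R.upper _ hm 1 ENNReal.one_ne_top (h1 _) N x
    have hlo := R.lower _ hm 1 ENNReal.one_ne_top (h1 _) N x
    rw [one_mul] at hup hlo
    rw [hker N A hA, hlimit A hA]
    exact max_le (tsub_le_iff_left.2 hup) (tsub_le_iff_left.2 hlo)
  · intro A hA
    have hAE := hA.inter hEm
    have hreal : (limitMeasure P X a β v w x).real A =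
        (Λ ((A ∩ Set.Icc 0 a).indicator fun _ => 1) * V x).toReal := by
      rw [measureReal_def, hlimit A hA]
    have hZ : ∀ N : ℕ, (ZcKer P X a β N x).real A =
        ((stepKernel h (gAll a β 0) ^ N) x).real (A ∩ Set.Icc 0 a) := fun N => by
      rw [measureReal_def, measureReal_def, ZcKer_apply W H ha β N hx.1 hA]
    rw [hreal]
    simp_rw [hZ]
    -- If the limit charges no part of `A`, then `A` meets the strip in a null set and the sequence
    -- vanishes for `N ≥ 1`.
    by_cases h0 : Λ ((A ∩ Set.Icc 0 a).indicator fun _ => 1) = 0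
    · have hvol := R.volume_eq_zero H hl hAE Set.inter_subset_right h0
      rw [h0, zero_mul, ENNReal.toReal_zero]
      simp_rw [zero_mul]
      refine isEquivalent_zero_iff_eventually_zero.2 ?_
      filter_upwards [eventually_ge_atTop 1] with N hN
      obtain ⟨n, rfl⟩ := Nat.exists_eq_add_of_le' hN
      rw [Pi.zero_apply, measureReal_def, pow_succ_absolutelyContinuous h _ n x hvol,
        ENNReal.toReal_zero]
    · refine isEquivalent_mul_exp ?_ (tendsto_exp_mul_real H R hAE x)
      exact (ENNReal.toReal_pos (mul_ne_zero h0 (R.V_ne_zero x)) (ENNReal.mul_ne_top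
        (R.ne_top _ (measurable_const.indicator hAE) 1 ENNReal.one_ne_top (h1 _))
        (R.V_ne_top x))).ne'

end Asymptotics

lemma exists_isStepDensity {Ω : Type*} [MeasurableSpace Ω] {P : Measure Ω}
    [IsProbabilityMeasure P] {X : ℕ → Ω → ℝ} {h : ℝ → ℝ} (W : IsDensityWalk P X h)
    (h_cont : Continuous h) (h_nonneg : ∀ t, 0 ≤ h t) (h_bdd : ∃ M, ∀ t, h t ≤ M)
    (h_pos : 0 < h 0) {a : ℝ} (ha : 0 < a) : ∃ M η δ, IsStepDensity h M η δ ∧ δ ≤ a := by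
  obtain ⟨M, hM⟩ := h_bdd
  have hev : ∀ᶠ t in 𝓝 (0 : ℝ), h 0 / 2 < h t :=
    h_cont.continuousAt.eventually_const_lt (half_lt_self h_pos)
  obtain ⟨r, hr, hball⟩ := Metric.eventually_nhds_iff.1 hev
  -- `δ ≤ r / 4` keeps `[-2δ, 2δ]` inside the ball where `h > h 0 / 2`, and `δ ≤ a` keeps `[0, δ]`
  -- inside the strip.
  refine ⟨M, h 0 / 2, min a (r / 4), ⟨h_cont, h_nonneg, hM, ?_, half_pos h_pos,
    lt_min ha (by linarith), fun t ht => (hball ?_).le⟩, min_le_left _ _⟩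
  · have := Measure.isProbabilityMeasure_map (W.meas 0).aemeasurable (μ := P)
    rw [W.law 0] at this
    have h1 := this.measure_univ
    rwa [withDensity_apply _ MeasurableSet.univ, Measure.restrict_univ] at h1
  · rw [Real.dist_eq, sub_zero]
    have := min_le_right a (r / 4)
    linarith

end StripWetting
theorem theorem4p1 {Ω : Type*} [MeasurableSpace Ω] (P : Measure Ω) [IsProbabilityMeasure P]
    (X : ℕ → Ω → ℝ) (h : ℝ → ℝ)
    (hX_meas : ∀ i, Measurable (X i))
    (hX_indep : iIndepFun X P)
    (hX_law : ∀ i, P.map (X i) = volume.withDensity fun t => ENNReal.ofReal (h t))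
    (h_cont : Continuous h) (h_nonneg : ∀ t, 0 ≤ h t) (h_bdd : ∃ M, ∀ t, h t ≤ M)
    (h_pos : ∀ᶠ t in 𝓝 (0 : ℝ), 0 < h t)
    (hX_sq : MemLp (X 0) 2 P) (hX_mean : ∫ ω, X 0 ω ∂P = 0)
    (a : ℝ) (ha : 0 < a) (β : ℝ) (hβ : StripWetting.criticalPoint P X a < β) :
    Tendsto (fun N : ℕ => (1 / (N : ℝ)) * Real.log (StripWetting.Zf P X a β N)) atTop
        (𝓝 (StripWetting.freeEnergy P X a β)) ∧
    (∃ v w : ℝ → ℝ, StripWetting.IsPFPair P X a β v w) ∧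
    (∀ v w : ℝ → ℝ, StripWetting.IsPFPair P X a β v w →
      0 < StripWetting.meanReturn P X a β v w ∧ StripWetting.meanReturn P X a β v w < ∞ ∧
      ∀ x ∈ Set.Icc (0 : ℝ) a,
        Tendsto (fun N : ℕ => StripWetting.tvDist
          (ENNReal.ofReal (Real.exp (-StripWetting.freeEnergy P X a β * N)) •
            StripWetting.ZcKer P X a β N x)
          (StripWetting.limitMeasure P X a β v w x)) atTop (𝓝 0) ∧
        ∀ A : Set ℝ, MeasurableSet A →
          (fun N : ℕ => (StripWetting.ZcKer P X a β N x).real A) ~[atTop]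
            fun N : ℕ => (StripWetting.limitMeasure P X a β v w x).real A *
              Real.exp (StripWetting.freeEnergy P X a β * N)) ∧
    (∃ C : ℝ, 0 < C ∧ StripWetting.Zc P X a β ~[atTop]
      fun N : ℕ => C * Real.exp (StripWetting.freeEnergy P X a β * N)) ∧
    (∃ C : ℝ, 0 < C ∧ StripWetting.Zf P X a β ~[atTop]
      fun N : ℕ => C * Real.exp (StripWetting.freeEnergy P X a β * N)) := by
  have W : StripWetting.IsDensityWalk P X h := ⟨hX_meas, hX_indep, hX_law⟩
  obtain ⟨M, η, δ, H, hδa⟩ :=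
    StripWetting.exists_isStepDensity W h_cont h_nonneg h_bdd h_pos.self_of_nhds ha
  have hF := StripWetting.freeEnergy_pos W H ha hδa hβ
  obtain ⟨V, hVm, hV1, hV, hV0⟩ := StripWetting.exists_harmonic W H ha hδa hF
  obtain ⟨Λ, ε, R⟩ := StripWetting.exists_rankOneLimit_of_harmonic H hF hVm hV1 hV hV0
  obtain ⟨C, hC, hZf⟩ := R.exists_tendsto_Zf W H ha
  exact ⟨StripWetting.tendsto_log_div hC (StripWetting.Zf_pos W H ha hδa β) hZf,
    R.exists_isPFPair W H ha hF, fun v w hvw => hvw.tendsto_kernel W H ha hF R,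
    R.exists_Zc_equivalent W H ha hF, C, hC, StripWetting.isEquivalent_mul_exp hC.ne' hZf⟩
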